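/- Let $(\Omega,\mathcal F,(\mathcal F_t)_{t\in\mathbb N},P)$ be a filtered probability space with $\mathcal F_0$ $P$-trivial. Equalities and inequalities of random variables and processes are understood $P$-almost surely, and almost surely equal ones are identified. Essential infima and suprema are greatest lower and least upper bounds for the almost sure order. For an adapted process $a$ put $a_{-1}:=0$, $\Delta a_t:=a_t-a_{t-1}$. Let $\mathcal R^\infty$ be the space of adapted processes $X=(X_t)_{t\in\mathbb N}$ with $\sup_t|X_t|\le c$ for some $c\in\mathbb R$, let $\mathcal A^1$ be the space of adapted processes $a$ with $E[\sum_t|\Delta a_t|]<\infty$, let $\mathcal A^1_+:=\{a\in\mathcal A^1:\Delta a_t\ge 0 \text{ for all } t\}$, and let $\sigma(\mathcal R^\infty,\mathcal A^1)$ be the coarsest topology on $\mathcal R^\infty$ that makes $X\mapsto\langle X,a\rangle:=E[\sum_t X_t\Delta a_t]$ continuous for all $a\in\mathcal A^1$. Let $\tau,\theta$ be stopping times with $0\le\tau<\infty$ and $\tau\le\theta\le\infty$. Put $\pi_{\tau,\theta}(X)_t:=1_{\{\tau\le t\}}X_{t\wedge\theta}$, $\langle X,a\rangle_{\tau,\theta}:=E\big[\sum_{t\in[\tau,\theta]\cap\mathbb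 N}X_t\Delta a_t\,\big|\,\mathcal F_\tau\big]$, $\mathcal R^\infty_{\tau,\theta}:=\pi_{\tau,\theta}\mathcal R^\infty$ and $\mathcal D_{\tau,\theta}:=\{a\in\pi_{\tau,\theta}\mathcal A^1_+:\langle 1,a\rangle_{\tau,\theta}=1\}$. A map $\phi:\mathcal R^\infty_{\tau,\theta}\to L^\infty(\mathcal F_\tau)$ is a \emph{concave monetary utility functional} if for all $X,Y\in\mathcal R^\infty_{\tau,\theta}$: (0) $\phi(1_AX)=1_A\phi(X)$ for all $A\in\mathcal F_\tau$; (1) $X\le Y$ implies $\phi(X)\le\phi(Y)$; (2) $\phi(X+m1_{[\tau,\infty)})=\phi(X)+m$ for all $m\in L^\infty(\mathcal F_\tau)$; (3) $\phi(\lambda X+(1-\lambda)Y)\ge\lambda\phi(X)+(1-\lambda)\phi(Y)$ for all $\lambda\in L^\infty(\mathcal F_\tau)$ with $0\le\lambda\le1$. Put $\mathcal C_\phi:=\{X\in\mathcal R^\infty_{\tau,\theta}:\phi(X)\ge0\}$ (the acceptance set) and $\phi^\#(a):=\operatorname{ess\,inf}_{X\in\mathcal C_\phi}\langle X,a\rangle_{\tau,\theta}$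 for $a\in\mathcal D_{\tau,\theta}$. The functional $\phi$ is \emph{continuous for bounded decreasing sequences} if $\phi(X^n)\to\phi(X)$ almost surely whenever $(X^n)$ is a decreasing sequence in $\mathcal R^\infty_{\tau,\theta}$ and $X\in\mathcal R^\infty_{\tau,\theta}$ with $X^n_t\to X_t$ almost surely for all $t$. A \emph{penalty function} is a map $\gamma$ from $\mathcal D_{\tau,\theta}$ to the $\mathcal F_\tau$-measurable functions with values in $[-\infty,0]$ such that $\operatorname{ess\,sup}_{a\in\mathcal D_{\tau,\theta}}\gamma(a)=0$; it is \emph{special} if $\gamma(1_Aa+1_{A^c}b)=1_A\gamma(a)+1_{A^c}\gamma(b)$ for all $a,b\in\mathcal D_{\tau,\theta}$ and $A\in\mathcal F_\tau$. \textbf{Theorem.} For a map $\phi$ from $\mathcal R^\infty_{\tau,\theta}$ to the extended real random variables, the following are equivalent: \begin{enumerate} \item[(1)] there is a penalty function $\gamma$ such that $$\phi(X)=\operatorname{ess\,inf}_{a\in\mathcal D_{\tau,\theta}}\{\langle X,a\rangle_{\tau,\theta}-\gamma(a)\}\quad\text{for all }X\in\mathcal R^\infty_{\tau,\theta};\qquad(*)$$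 \item[(2)] $\phi$ is a concave monetary utility functional on $\mathcal R^\infty_{\tau,\theta}$ (in particular with values in $L^\infty(\mathcal F_\tau)$) whose acceptance set $\mathcal C_\phi$ is a $\sigma(\mathcal R^\infty,\mathcal A^1)$-closed subset of $\mathcal R^\infty$; \item[(3)] $\phi$ is a concave monetary utility functional on $\mathcal R^\infty_{\tau,\theta}$ that is continuous for bounded decreasing sequences. \end{enumerate} Moreover, if (1)--(3) hold, then $\phi^\#$ is a special penalty function on $\mathcal D_{\tau,\theta}$, the representation $(*)$ also holds with $\phi^\#$ instead of $\gamma$, and every penalty function $\gamma$ for which $(*)$ holds satisfies $\gamma(a)\le\phi^\#(a)$ for all $a\in\mathcal D_{\tau,\theta}$. -/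

import Mathlib

open MeasureTheory Filter Topology

noncomputable section

namespace CondUtility

/-! ### Processes, with almost surely equal processes identified -/

section Processes

variable {Ω : Type*} {mΩ : MeasurableSpace Ω}

/-- Real processes in discrete time, modulo almost sure equality.  The order and the algebraic
operations are the almost sure, time by time ones. -/
abbrev Proc (P : Measure Ω) : Type _ := ℕ → (Ω →ₘ[P] ℝ)

variable (P : Measure Ω) (ℱ : Filtration ℕ mΩ)

/-- The (class of the) indicator function of a measurable set. -/
def ind {A : Set Ω} (hA : MeasurableSet A) : Ω →ₘ[P] ℝ :=
  AEEqFun.mk (A.indicator fun _ => (1 : ℝ))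
    (measurable_const.indicator hA).aestronglyMeasurable

variable {P}

/-- A real random variable seen as an extended real one. -/
def toE (f : Ω →ₘ[P] ℝ) : Ω →ₘ[P] EReal :=
  AEEqFun.comp (fun x : ℝ => (x : EReal)) continuous_coe_real_ereal f

/-- `X` is adapted, up to null sets. -/
def IsAdapted (X : Proc P) : Prop := ∀ t, AEStronglyMeasurable[ℱ t] (X t) P

/-- The increments `Δ a_t = a_t - a_{t-1}`, with `a_{-1} = 0`. -/
def incr (a : Proc P) : Proc P
  | 0 => a 0
  | t + 1 => a (t + 1) - a t

variable (P)

/-- The space `ℛ^∞` of adapted, essentially bounded processes. -/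
def RInf : Set (Proc P) :=
  {X | IsAdapted ℱ X ∧ ∃ c : ℝ, ∀ t, ∀ᵐ ω ∂P, |X t ω| ≤ c}

/-- The space `𝒜^1` of adapted processes of integrable variation. -/
def AOne : Set (Proc P) :=
  {a | IsAdapted ℱ a ∧ ∫⁻ ω, ∑' t, ‖incr a t ω‖ₑ ∂P < ⊤}

/-- The increasing processes in `𝒜^1`. -/
def AOnePos : Set (Proc P) := {a | a ∈ AOne P ℱ ∧ ∀ t, 0 ≤ incr a t}

variable {P}

/-- The bilinear form `⟨X, a⟩ = E[∑ X_t Δ a_t]`. -/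
def pairing (X a : Proc P) : ℝ := ∫ ω, ∑' t, X t ω * incr a t ω ∂P

variable (P)

/-- The topology `σ(ℛ^∞, 𝒜^1)`: the coarsest one for which `X ↦ ⟨X, a⟩` is continuous for all
`a ∈ 𝒜^1`. -/
@[reducible] def sigmaTopology : TopologicalSpace (RInf P ℱ) :=
  ⨅ a ∈ AOne P ℱ, TopologicalSpace.induced (fun X : RInf P ℱ => pairing X.1 a) inferInstance

end Processes

/-! ### Essential infima -/

section EssInf

variable {Ω : Type*} {mΩ : MeasurableSpace Ω} {P : Measure Ω}

/-- An increasing bijection of the extended real line onto the unit interval. -/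
def squash (x : EReal) : ENNReal := (1 + EReal.exp (-x))⁻¹

lemma squash_strictMono : StrictMono squash := by
  intro x y h
  unfold squash
  rw [ENNReal.inv_lt_inv]
  exact ENNReal.add_lt_add_left ENNReal.one_ne_top
    (EReal.exp_strictMono (EReal.neg_lt_neg_iff.mpr h))

lemma squash_le_one (x : EReal) : squash x ≤ 1 := by
  unfold squash
  rw [ENNReal.inv_le_one]
  exact le_self_add

lemma measurable_squash : Measurable squash :=
  squash_strictMono.monotone.measurable

/-- Every family of extended random variables has a greatest lower bound for the almost sure
order. -/
theorem exists_isGLB [IsFiniteMeasure P] (S : Set (Ω →ₘ[P] EReal)) : ∃ g, IsGLB S g := by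
  classical
  by_cases hS : S.Nonempty
  swap
  · rw [Set.not_nonempty_iff_eq_empty] at hS
    subst hS
    refine ⟨AEEqFun.mk (fun _ => (⊤ : EReal)) aestronglyMeasurable_const, ?_⟩
    rw [isGLB_empty_iff]
    intro f
    rw [← AEEqFun.coeFn_le]
    filter_upwards [AEEqFun.coeFn_mk (fun _ : Ω => (⊤ : EReal))
      (aestronglyMeasurable_const (μ := P))] with ω hω
    rw [hω]; exact le_top
  obtain ⟨f₀, hf₀⟩ := hS
  let I : (ℕ → S) → Ω → EReal := fun u ω => ⨅ n, (u n).1 ω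
  have hI : ∀ u, Measurable (I u) := fun u =>
    Measurable.iInf fun n => (u n).1.stronglyMeasurable.measurable
  let V : (ℕ → S) → ENNReal := fun u => ∫⁻ ω, squash (I u ω) ∂P
  have hVtop : ∀ u, V u ≠ ⊤ := by
    intro u
    refine ne_top_of_le_ne_top (measure_ne_top P Set.univ) ?_
    calc V u ≤ ∫⁻ _, 1 ∂P := lintegral_mono fun ω => squash_le_one _
      _ = P Set.univ := by simp
  have : Nonempty (ℕ → S) := ⟨fun _ => ⟨f₀, hf₀⟩⟩
  obtain ⟨w, -, hw, hwm⟩ := exists_seq_tendsto_sInf (S := Set.range V)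
    (Set.range_nonempty V) (OrderBot.bddBelow _)
  choose u hu using hwm
  let v : ℕ → S := fun n => u n.unpair.1 n.unpair.2
  have hv : ∀ k ω, I v ω ≤ I (u k) ω := by
    intro k ω
    refine le_iInf fun n => ?_
    refine (iInf_le _ (Nat.pair k n)).trans ?_
    simp [v]
  have hVv : ∀ z, V v ≤ V z := by
    intro z
    have h1 : V v ≤ sInf (Set.range V) := by
      refine ge_of_tendsto' hw fun k => ?_
      rw [← hu k]
      exact lintegral_mono fun ω => squash_strictMono.monotone (hv k ω)
    exact h1.trans (sInf_le ⟨z, rfl⟩)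
  refine ⟨AEEqFun.mk (I v) (hI v).aestronglyMeasurable, ?_, ?_⟩
  · intro f hf
    let z : ℕ → S := fun n => Nat.casesOn n ⟨f, hf⟩ v
    have hz : ∀ ω, I z ω ≤ I v ω := fun ω =>
      le_iInf fun n => iInf_le (fun n => (z n).1 ω) (n + 1)
    have hzf : ∀ ω, I z ω ≤ f ω := fun ω => iInf_le (fun n => (z n).1 ω) 0
    have := ae_eq_of_ae_le_of_lintegral_le (μ := P)
      (f := fun ω => squash (I z ω)) (g := fun ω => squash (I v ω))
      (Eventually.of_forall fun ω => squash_strictMono.monotone (hz ω)) (hVtop z)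
      (measurable_squash.comp (hI v)).aemeasurable (hVv z)
    rw [← AEEqFun.coeFn_le]
    filter_upwards [this, AEEqFun.coeFn_mk (I v) (hI v).aestronglyMeasurable (μ := P)]
      with ω h1 h2
    rw [h2, ← squash_strictMono.injective h1]
    exact hzf ω
  · intro g hg
    rw [← AEEqFun.coeFn_le]
    have : ∀ᵐ ω ∂P, ∀ n, g ω ≤ (v n).1 ω :=
      ae_all_iff.mpr fun n => AEEqFun.coeFn_le.mpr (hg (v n).2)
    filter_upwards [this, AEEqFun.coeFn_mk (I v) (hI v).aestronglyMeasurable (μ := P)]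
      with ω h1 h2
    rw [h2]
    exact le_iInf h1

/-- The essential infimum of a family of extended random variables. -/
def essInfimum [IsFiniteMeasure P] (S : Set (Ω →ₘ[P] EReal)) : Ω →ₘ[P] EReal :=
  (exists_isGLB S).choose

theorem isGLB_essInfimum [IsFiniteMeasure P] (S : Set (Ω →ₘ[P] EReal)) :
    IsGLB S (essInfimum S) :=
  (exists_isGLB S).choose_spec

end EssInf

/-! ### Conditional objects attached to two stopping times `τ` and `θ` -/

section Conditional

variable {Ω : Type*} {mΩ : MeasurableSpace Ω} (P : Measure Ω) {ℱ : Filtration ℕ mΩ}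
  {τ θ : Ω → WithTop ℕ} (hτ : IsStoppingTime ℱ τ) (hθ : IsStoppingTime ℱ θ)

/-- `L^∞(ℱ_τ)`. -/
def LInf : Set (Ω →ₘ[P] ℝ) :=
  {f | AEStronglyMeasurable[hτ.measurableSpace] f P ∧ ∃ c : ℝ, ∀ᵐ ω ∂P, |f ω| ≤ c}

variable {P}

lemma measurable_proj (X : Proc P) (hτ : IsStoppingTime ℱ τ) (hθ : IsStoppingTime ℱ θ) (t : ℕ) :
    Measurable ({ω | τ ω ≤ t}.indicator (stoppedProcess (fun s => (X s : Ω → ℝ)) θ t)) := by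
  have hX : ∀ s, Measurable (X s : Ω → ℝ) := fun s => (X s).stronglyMeasurable.measurable
  refine Measurable.indicator ?_ (ℱ.le t _ (hτ t))
  have hn : Measurable fun ω => (min (t : WithTop ℕ) (θ ω)).untopA := by
    have h1 : Measurable fun ω => min (t : WithTop ℕ) (θ ω) :=
      measurable_const.min (hθ.measurable.mono hθ.measurableSpace_le le_rfl)
    exact (measurable_of_countable (fun x : WithTop ℕ => x.untopA)).comp h1
  have hpair : Measurable fun p : ℕ × Ω => X p.1 p.2 :=
    measurable_from_prod_countable_right fun s => hX s
  exact hpair.comp (hn.prodMk measurable_id)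

/-- The projection `π_{τ,θ}(X)_t = 1_{τ ≤ t} X_{t ∧ θ}`. -/
def proj (X : Proc P) : Proc P := fun t =>
  AEEqFun.mk ({ω | τ ω ≤ t}.indicator (stoppedProcess (fun s => (X s : Ω → ℝ)) θ t))
    (measurable_proj X hτ hθ t).aestronglyMeasurable

/-- The conditional form `⟨X, a⟩_{τ,θ} = E[∑_{t ∈ [τ,θ] ∩ ℕ} X_t Δ a_t | ℱ_τ]`. -/
def condPairing (θ : Ω → WithTop ℕ) (X a : Proc P) : Ω →ₘ[P] ℝ :=
  AEEqFun.mk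
    (P[fun ω => ∑' t : ℕ, {ω | τ ω ≤ t ∧ t ≤ θ ω}.indicator (fun ω => X t ω * incr a t ω) ω
      | hτ.measurableSpace])
    (stronglyMeasurable_condExp.mono hτ.measurableSpace_le).aestronglyMeasurable

variable (P)

/-- `ℛ^∞_{τ,θ} = π_{τ,θ} ℛ^∞`. -/
def RInfStop : Set (Proc P) := proj hτ hθ '' RInf P ℱ

/-- `𝒟_{τ,θ}`: the elements `a` of `π_{τ,θ} 𝒜^1_+` with `⟨1, a⟩_{τ,θ} = 1`. -/
def DStop : Set (Proc P) := {a | a ∈ proj hτ hθ '' AOnePos P ℱ ∧ condPairing hτ θ 1 a = 1}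

variable {P}

/-- The process `m 1_{[τ,∞)}`. -/
def cash (m : Ω →ₘ[P] ℝ) : Proc P := fun t => ind P (ℱ.le t _ (hτ t)) * m

/-- `φ` restricts to a concave monetary utility functional `ℛ^∞_{τ,θ} → L^∞(ℱ_τ)`.
Only the values of `φ` on `ℛ^∞_{τ,θ}` matter. Since these are finite, the arithmetic of
extended reals in the formulas is that of the reals. -/
structure IsConcaveMonetaryUtility (φ : Proc P → Ω →ₘ[P] EReal) : Prop where
  /-- the values are in `L^∞(ℱ_τ)` -/
  values : ∀ X ∈ RInfStop P hτ hθ, ∃ f ∈ LInf P hτ, φ X = toE f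
  /-- `φ(1_A X) = 1_A φ(X)` -/
  localProperty : ∀ X ∈ RInfStop P hτ hθ, ∀ (A : Set Ω) (hA : MeasurableSet[hτ.measurableSpace] A),
    (φ fun t => ind P (hτ.measurableSpace_le A hA) * X t) =ᵐ[P] A.indicator (φ X)
  /-- monotonicity -/
  mono : ∀ X ∈ RInfStop P hτ hθ, ∀ Y ∈ RInfStop P hτ hθ, X ≤ Y → φ X ≤ φ Y
  /-- `φ(X + m 1_{[τ,∞)}) = φ(X) + m` -/
  translation : ∀ X ∈ RInfStop P hτ hθ, ∀ m ∈ LInf P hτ,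
    φ (X + cash hτ m) =ᵐ[P] fun ω => φ X ω + ((m ω : ℝ) : EReal)
  /-- `φ(λ X + (1 - λ) Y) ≥ λ φ(X) + (1 - λ) φ(Y)` -/
  concave : ∀ X ∈ RInfStop P hτ hθ, ∀ Y ∈ RInfStop P hτ hθ, ∀ l ∈ LInf P hτ, 0 ≤ l → l ≤ 1 →
    ∀ᵐ ω ∂P, ((l ω : ℝ) : EReal) * φ X ω + ((1 - l ω : ℝ) : EReal) * φ Y ω
      ≤ φ (fun t => l * X t + (1 - l) * Y t) ω

/-- The acceptance set `𝒞_φ = {X ∈ ℛ^∞_{τ,θ} | φ(X) ≥ 0}`. -/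
def acceptanceSet (φ : Proc P → Ω →ₘ[P] EReal) : Set (Proc P) :=
  {X | X ∈ RInfStop P hτ hθ ∧ 0 ≤ φ X}

/-- The acceptance set is closed in `ℛ^∞` for `σ(ℛ^∞, 𝒜^1)`. -/
def AcceptanceSetClosed (φ : Proc P → Ω →ₘ[P] EReal) : Prop :=
  IsClosed[sigmaTopology P ℱ] {X : RInf P ℱ | X.1 ∈ acceptanceSet hτ hθ φ}

/-- Continuity for bounded decreasing sequences. -/
def ContinuousDecreasing (φ : Proc P → Ω →ₘ[P] EReal) : Prop :=
  ∀ (Xn : ℕ → Proc P) (X : Proc P), (∀ n, Xn n ∈ RInfStop P hτ hθ) → X ∈ RInfStop P hτ hθ →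
    Antitone Xn → (∀ t, ∀ᵐ ω ∂P, Tendsto (fun n => Xn n t ω) atTop (𝓝 (X t ω))) →
    ∀ᵐ ω ∂P, Tendsto (fun n => φ (Xn n) ω) atTop (𝓝 (φ X ω))

/-- `γ` restricts to a penalty function on `𝒟_{τ,θ}`: its values are `ℱ_τ`-measurable with values
in `[-∞, 0]`, and their essential supremum (least upper bound for the almost sure order) is `0`. -/
structure IsPenalty (γ : Proc P → Ω →ₘ[P] EReal) : Prop where
  measurable : ∀ a ∈ DStop P hτ hθ, AEStronglyMeasurable[hτ.measurableSpace] (γ a) P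
  nonpos : ∀ a ∈ DStop P hτ hθ, γ a ≤ 0
  isLUB : IsLUB (γ '' DStop P hτ hθ) 0

/-- A penalty function is special if
`γ(1_A a + 1_{Aᶜ} b) = 1_A γ(a) + 1_{Aᶜ} γ(b)` for all `A ∈ ℱ_τ`. -/
structure IsSpecialPenalty (γ : Proc P → Ω →ₘ[P] EReal) : Prop extends
    IsPenalty hτ hθ γ where
  special : ∀ a ∈ DStop P hτ hθ, ∀ b ∈ DStop P hτ hθ,
    ∀ (A : Set Ω) (hA : MeasurableSet[hτ.measurableSpace] A),
    (γ fun t => ind P (hτ.measurableSpace_le A hA) * a t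
        + ind P (hτ.measurableSpace_le A hA).compl * b t)
      =ᵐ[P] A.indicator (γ a) + Aᶜ.indicator (γ b)

/-- The extended random variable `⟨X, a⟩_{τ,θ} - γ(a)`. -/
def penalized (θ : Ω → WithTop ℕ) (γ : Proc P → Ω →ₘ[P] EReal) (X a : Proc P) : Ω →ₘ[P] EReal :=
  AEEqFun.mk (fun ω => ((condPairing hτ θ X a ω : ℝ) : EReal) - γ a ω) (by
    have h1 : Measurable (condPairing hτ θ X a : Ω → ℝ) :=
      (condPairing hτ θ X a).stronglyMeasurable.measurable
    have h2 : Measurable (γ a : Ω → EReal) := (γ a).stronglyMeasurable.measurable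
    simp only [sub_eq_add_neg]
    exact (h1.coe_real_ereal.add (continuous_neg.measurable.comp h2)).aestronglyMeasurable)

/-- `φ(X) = ess inf_{a ∈ 𝒟_{τ,θ}} {⟨X, a⟩_{τ,θ} - γ(a)}` for all `X ∈ ℛ^∞_{τ,θ}`. -/
def Represents [IsFiniteMeasure P] (γ φ : Proc P → Ω →ₘ[P] EReal) : Prop :=
  ∀ X ∈ RInfStop P hτ hθ, φ X = essInfimum (penalized hτ θ γ X '' DStop P hτ hθ)

/-- `φ^#(a) = ess inf_{X ∈ 𝒞_φ} ⟨X, a⟩_{τ,θ}`. -/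
def phiSharp [IsFiniteMeasure P] (φ : Proc P → Ω →ₘ[P] EReal) (a : Proc P) : Ω →ₘ[P] EReal :=
  essInfimum ((fun X => toE (condPairing hτ θ X a)) '' acceptanceSet hτ hθ φ)

end Conditional

end CondUtility

end

/-! The theorem is a bipolar theorem conditional on `ℱ_τ`. By `Represents.le_iff`, a representation
says that `f ≤ φ(X)` holds exactly when `γ(a) ≤ ⟨X, a⟩ - f` for all `a`. Read in both directions,
this equivalence gives each axiom of a utility functional, and with `f = 0` it shows the acceptance
set as an intersection of closed sets. That the essential supremum of `γ` is 0 bounds `φ(X)` from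
above.

A closed acceptance set is closed under bounded almost sure convergence, by dominated convergence in
the pairing. If `X^n` decreases to `X` and `m = lim φ(X^n)`, then all `X^n - m` are acceptable,
hence so is `X - m`, and `φ(X) ≥ m`. Monotonicity gives the other inequality.

The deep direction starts from continuity for decreasing sequences. Tail suprema show that the
acceptance set is closed under bounded almost sure convergence (`mem_acceptanceSet_of_tendsto`). A
Krein-Šmulian argument, carried out in a Hilbert space (`exists_separating_series`) and applied to
processes as functions on times and scenarios, separates any other process `Z` from it by an
integrable function (`exists_separating_integrable`). Conditioning on `ℱ_t` at each time makes this
function adapted, monotonicity of `φ` makes it nonnegative (`exists_separating_density`), and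
division by its conditional mass gives an `a` in `𝒟_{τ,θ}` and a weight `u ≥ 0`
(`IsDensity.exists_normalized`). Acceptable processes can be pasted along events of `ℱ_τ`, so their
forms `⟨X, a⟩` are directed downwards. Hence the separation of weighted expectations contradicts
`φ^#(a) ≤ ⟨Z, a⟩`. So every `Z` with `φ^#(a) ≤ ⟨Z, a⟩` for all `a` is acceptable
(`mem_of_phiSharp_le`), and translation by cash turns this into the representation by `φ^#`.
Maximality of `φ^#` is the equivalence above with `f = 0`. -/

noncomputable section

set_option linter.unusedSectionVars false

namespace CondUtility

/-! ### Separation of convex sets in a Hilbert space. -/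

section Hilbert

variable {H : Type*} [NormedAddCommGroup H] [InnerProductSpace ℝ H] [CompleteSpace H]

open scoped RealInnerProductSpace Pointwise

/-- The variational inequality at the point of `K` nearest to 0. It replaces both weak compactness
and the Hahn-Banach theorem below. -/
lemma exists_min_norm {K : Set H} (hne : K.Nonempty) (hcl : IsClosed K) (hcv : Convex ℝ K) :
    ∃ v ∈ K, ∀ w ∈ K, ‖v‖ ^ 2 ≤ ⟪v, w⟫ := by
  obtain ⟨v, hv, hmin⟩ := exists_norm_eq_iInf_of_complete_convex hne hcl.isComplete hcv 0
  refine ⟨v, hv, fun w hw => ?_⟩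
  have := (norm_eq_iInf_iff_real_inner_le_zero hcv hv).1 hmin w hw
  rw [zero_sub, inner_neg_left, inner_sub_right, real_inner_self_eq_norm_sq] at this
  linarith

/-- A decreasing sequence of nonempty bounded closed convex sets in a Hilbert space has a common
point. -/
lemma nonempty_iInter_of_closed_convex {S : ℕ → Set H} (hanti : Antitone S)
    (hne : ∀ n, (S n).Nonempty) (hcl : ∀ n, IsClosed (S n)) (hcv : ∀ n, Convex ℝ (S n))
    {R : ℝ} (hbd : ∀ x ∈ S 0, ‖x‖ ≤ R) : (⋂ n, S n).Nonempty := by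
  choose x hx hmin using fun n => exists_min_norm (hne n) (hcl n) (hcv n)
  -- The variational inequality for `x n`, tested at `x m`: convergence of the increasing bounded
  -- squared norms now makes `x` a Cauchy sequence.
  have key : ∀ n m, n ≤ m → ‖x m - x n‖ ^ 2 ≤ ‖x m‖ ^ 2 - ‖x n‖ ^ 2 := by
    intro n m h
    have := hmin n (x m) (hanti h (hx m))
    rw [norm_sub_sq_real, real_inner_comm]
    linarith
  have hmono : Monotone fun n => ‖x n‖ ^ 2 := fun n m h => by
    have := key n m h
    have h2 := sq_nonneg ‖x m - x n‖
    simp only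
    linarith
  have hbdd : BddAbove (Set.range fun n => ‖x n‖ ^ 2) := by
    refine ⟨R ^ 2, ?_⟩
    rintro _ ⟨n, rfl⟩
    exact pow_le_pow_left₀ (norm_nonneg _) (hbd _ (hanti (Nat.zero_le n) (hx n))) 2
  have hlim := tendsto_atTop_ciSup hmono hbdd
  set l := ⨆ n, ‖x n‖ ^ 2
  have hle : ∀ n, ‖x n‖ ^ 2 ≤ l := fun n => le_ciSup hbdd n
  have hcau : CauchySeq x := by
    rw [Metric.cauchySeq_iff']
    intro ε hε
    obtain ⟨N, hN⟩ := (hlim.eventually (lt_mem_nhds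
      (show l - ε ^ 2 < l by have := pow_pos hε 2; linarith))).exists
    refine ⟨N, fun n hn => ?_⟩
    rw [dist_eq_norm]
    have h1 := key N n hn
    have h2 := hle n
    exact lt_of_pow_lt_pow_left₀ 2 hε.le (by linarith)
  obtain ⟨y, hy⟩ := cauchySeq_tendsto_of_complete hcau
  refine ⟨y, Set.mem_iInter.2 fun n => (hcl n).mem_of_tendsto hy ?_⟩
  filter_upwards [eventually_ge_atTop n] with m hm using hanti hm (hx m)

/-- Two disjoint bounded closed convex sets in a Hilbert space are strictly separated. -/
lemma exists_strict_separation {K B : Set H} (hK : IsClosed K) (hKc : Convex ℝ K)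
    (hB : IsClosed B) (hBc : Convex ℝ B) (hBne : B.Nonempty) {R : ℝ} (hbd : ∀ x ∈ K, ‖x‖ ≤ R)
    (hdisj : Disjoint K B) :
    ∃ h : H, ∃ ε > 0, ∀ x ∈ K, ∀ y ∈ B, ⟪y, h⟫ + ε ≤ ⟪x, h⟫ := by
  rcases K.eq_empty_or_nonempty with rfl | hKne
  · exact ⟨0, 1, one_pos, by simp⟩
  -- Otherwise `K` meets every closed thickening of `B`. These sections of the bounded set `K` are
  -- nested, so they have a common point, which lies in `K ∩ B`.
  have h0 : (0 : H) ∉ closure (K - B) := by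
    intro h0
    have hpos : ∀ n : ℕ, (0 : ℝ) < 1 / (n + 1) := fun n => Nat.one_div_pos_of_nat
    have hne : (⋂ n : ℕ, K ∩ Metric.cthickening (1 / ((n : ℝ) + 1)) B).Nonempty := by
      refine nonempty_iInter_of_closed_convex (R := R) ?_ ?_ ?_ ?_ ?_
      · intro n m hnm
        exact Set.inter_subset_inter_right _
          (Metric.cthickening_mono (one_div_le_one_div_of_le (by positivity) (by simpa)) _)
      · intro n
        obtain ⟨z, hz, hd⟩ := Metric.mem_closure_iff.1 h0 _ (hpos n)
        obtain ⟨x, hx, y, hy, rfl⟩ := hz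
        refine ⟨x, hx, Metric.mem_cthickening_of_dist_le x y _ _ hy ?_⟩
        rw [dist_zero_left] at hd
        rw [dist_eq_norm]
        exact hd.le
      · exact fun n => hK.inter Metric.isClosed_cthickening
      · exact fun n => hKc.inter (hBc.cthickening _)
      · exact fun x hx => hbd x hx.1
    obtain ⟨x, hx⟩ := hne
    rw [Set.mem_iInter] at hx
    have hxB : x ∈ closure B := by
      rw [Metric.mem_closure_iff_infDist_zero hBne]
      refine le_antisymm ?_ Metric.infDist_nonneg
      refine ge_of_tendsto' tendsto_one_div_add_atTop_nhds_zero_nat fun n => ?_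
      exact ENNReal.toReal_le_of_le_ofReal (hpos n).le (Metric.mem_cthickening_iff.1 (hx n).2)
    rw [hB.closure_eq] at hxB
    exact Set.disjoint_left.1 hdisj (hx 0).1 hxB
  obtain ⟨h, hh, hmin⟩ := exists_min_norm (hKne.sub hBne).closure isClosed_closure
    (hKc.sub hBc).closure
  have hne : h ≠ 0 := fun h' => h0 (h' ▸ hh)
  refine ⟨h, ‖h‖ ^ 2, by positivity, fun x hx y hy => ?_⟩
  have := hmin (x - y) (subset_closure (Set.sub_mem_sub hx hy))
  rw [inner_sub_right, real_inner_comm, real_inner_comm y h] at this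
  linarith

/-- A form of the Krein-Šmulian theorem in a Hilbert space `H`: if a convex set `C` meets every
multiple of the bounded closed convex symmetric set `B` in a closed set, then it is separated from
any point outside of it by a series of elements of `H` that converges in the polar gauge
of `B`. -/
theorem exists_separating_series {B C : Set H} (hB : IsClosed B) (hBc : Convex ℝ B)
    (hBs : ∀ b ∈ B, -b ∈ B) {R : ℝ} (hbd : ∀ x ∈ B, ‖x‖ ≤ R) (hC : Convex ℝ C)
    (hcl : ∀ r : ℝ, 0 < r → IsClosed (C ∩ r • B)) (hcov : ∀ f ∈ C, ∃ r : ℝ, 0 < r ∧ f ∈ r • B)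
    (h0B : 0 ∈ B) (h0 : (0 : H) ∉ C) :
    ∃ (h : ℕ → H) (l : ℕ → ℝ) (M : ℝ), (∃ c, ∀ k, ∀ b ∈ B, ⟪b, h k⟫ ≤ c * (1 / 2) ^ k) ∧
      (∀ k, |l k| ≤ M) ∧ ∀ f ∈ C, 1 ≤ ∑' k, ⟪f, h k⟫ * l k := by
  have hBmono : ∀ {r s : ℝ}, 0 < r → r ≤ s → r • B ⊆ s • B := by
    intro r s hr hrs x hx
    rw [Set.mem_smul_set_iff_inv_smul_mem₀ (by linarith)]
    obtain ⟨b, hb, rfl⟩ := hx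
    rw [smul_smul]
    refine hBc.smul_mem_of_zero_mem h0B hb ⟨by have := hr.trans_le hrs; positivity, ?_⟩
    rw [inv_mul_le_iff₀ (by linarith)]
    linarith
  -- `C ∩ B` is closed and omits 0, so it omits a ball of radius `ε`. The factor `ε / (R + 1)` puts
  -- the multiple of `B` inside that ball, also when `R = 0`; the minimum with 1 keeps it inside
  -- `B`.
  obtain ⟨r₀, hr₀, hr₀C⟩ : ∃ r₀ : ℝ, 0 < r₀ ∧ C ∩ r₀ • B = ∅ := by
    have h1 : (C ∩ (1 : ℝ) • B)ᶜ ∈ 𝓝 (0 : H) :=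
      (hcl 1 one_pos).isOpen_compl.mem_nhds fun h => h0 h.1
    obtain ⟨ε, hε, hball⟩ := Metric.mem_nhds_iff.1 h1
    have hR : 0 ≤ R := (norm_nonneg _).trans (hbd 0 h0B)
    refine ⟨min 1 (ε / (R + 1)), by positivity, ?_⟩
    by_contra hne
    obtain ⟨f, hfC, hfB⟩ := Set.nonempty_iff_ne_empty.2 hne
    have hf1 := hBmono (by positivity) (min_le_left _ _) hfB
    refine hball ?_ ⟨hfC, hf1⟩
    obtain ⟨b, hb, rfl⟩ := hfB
    rw [mem_ball_zero_iff]
    simp only [norm_smul, Real.norm_eq_abs]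
    rw [abs_of_pos (by positivity)]
    calc min 1 (ε / (R + 1)) * ‖b‖ ≤ (ε / (R + 1)) * R :=
          mul_le_mul (min_le_right _ _) (hbd b hb) (norm_nonneg _) (by positivity)
      _ < ε := by rw [div_mul_eq_mul_div, div_lt_iff₀ (by positivity)]; nlinarith
  let r : ℕ → ℝ := fun k => r₀ * 2 ^ k
  have hr : ∀ k, 0 < r k := fun k => by positivity
  -- `Q` will be the intersection of the half-spaces chosen so far. The next functional is at most 1
  -- on `r k • B` and exceeds 1 on what `Q` leaves of `C ∩ r (k + 1) • B`, so its half-space removes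
  -- that remainder. The conditions on `Q` stand behind the existential so that `choose` gives a
  -- function of `k` and `Q` alone, which the recursion for `Q` needs.
  have step : ∀ (k : ℕ) (Q : Set H), ∃ h : H, IsClosed Q → Convex ℝ Q → C ∩ r k • B ∩ Q = ∅ →
      (∀ b ∈ B, ⟪b, h⟫ ≤ (r k)⁻¹) ∧ C ∩ r (k + 1) • B ∩ (Q ∩ {f | ⟪f, h⟫ ≤ 1}) = ∅ := by
    intro k Q
    by_cases hyp : IsClosed Q ∧ Convex ℝ Q ∧ C ∩ r k • B ∩ Q = ∅
    swap
    · exact ⟨0, fun h1 h2 h3 => (hyp ⟨h1, h2, h3⟩).elim⟩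
    obtain ⟨hQ, hQc, hQe⟩ := hyp
    have hle : r k ≤ r (k + 1) := by
      have := hr k
      simp only [r, pow_succ] at this ⊢
      linarith
    obtain ⟨h, ε, hε, hsep⟩ := exists_strict_separation (K := C ∩ r (k + 1) • B ∩ Q)
      (B := r k • B) (R := r (k + 1) * R) ((hcl _ (hr _)).inter hQ)
      ((hC.inter (hBc.smul _)).inter hQc) (hB.smul_of_ne_zero (hr k).ne') (hBc.smul _)
      ⟨_, Set.smul_mem_smul_set h0B⟩ (by
        rintro _ ⟨⟨-, b, hb, rfl⟩, -⟩
        simp only [norm_smul, Real.norm_eq_abs, abs_of_pos (hr _)]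
        exact mul_le_mul_of_nonneg_left (hbd b hb) (hr _).le)
      (by
        rw [Set.disjoint_left]
        rintro f ⟨⟨h1, -⟩, h3⟩ h4
        have : f ∈ C ∩ r k • B ∩ Q := ⟨⟨h1, h4⟩, h3⟩
        rwa [hQe] at this)
    rcases (C ∩ r (k + 1) • B ∩ Q).eq_empty_or_nonempty with he | ⟨f₀, hf₀⟩
    · refine ⟨0, fun _ _ _ => ⟨fun b _ => by rw [inner_zero_right]; exact (inv_pos.2 (hr k)).le, ?_⟩⟩
      rw [← Set.inter_assoc, he, Set.empty_inter]
    have hsup : BddAbove ((fun y => ⟪y, h⟫) '' (r k • B)) := by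
      refine ⟨⟪f₀, h⟫ - ε, ?_⟩
      rintro _ ⟨y, hy, rfl⟩
      have := hsep f₀ hf₀ y hy
      simp only
      linarith
    set s := sSup ((fun y => ⟪y, h⟫) '' (r k • B)) with hs
    have hles : ∀ y ∈ r k • B, ⟪y, h⟫ ≤ s := fun y hy => le_csSup hsup ⟨y, hy, rfl⟩
    have h0r : (0 : H) ∈ r k • B := ⟨0, h0B, smul_zero _⟩
    have hs0 : 0 ≤ s := by simpa using hles 0 h0r
    have hsε : ∀ f ∈ C ∩ r (k + 1) • B ∩ Q, s + ε ≤ ⟪f, h⟫ := by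
      intro f hf
      have : s ≤ ⟪f, h⟫ - ε := by
        refine csSup_le ⟨_, 0, h0r, rfl⟩ ?_
        rintro _ ⟨y, hy, rfl⟩
        have := hsep f hf y hy
        simp only
        linarith
      linarith
    -- The functional is at most `s` on `r k • B` and at least `s + ε` on the remainder. Any level
    -- strictly between would do for the normalization; `s` itself may be 0.
    have hc : 0 < s + ε / 2 := by positivity
    refine ⟨(s + ε / 2)⁻¹ • h, fun _ _ _ => ⟨fun b hb => ?_, ?_⟩⟩
    · have := hles (r k • b) (Set.smul_mem_smul_set hb)
      rw [inner_smul_left] at this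
      simp only [conj_trivial] at this
      rw [inner_smul_right, inv_mul_le_iff₀ hc, ← div_eq_mul_inv, le_div_iff₀ (hr k)]
      linarith
    · rw [Set.eq_empty_iff_forall_notMem]
      rintro f ⟨h1, h2, h3⟩
      have := hsε f ⟨h1, h2⟩
      rw [Set.mem_ofPred_eq, inner_smul_right, inv_mul_le_iff₀ hc] at h3
      linarith
  choose h hh using step
  let Q : ℕ → Set H := fun n => Nat.rec Set.univ (fun k Q => Q ∩ {f | ⟪f, h k Q⟫ ≤ 1}) n
  have hQs : ∀ k, Q (k + 1) = Q k ∩ {f | ⟪f, h k (Q k)⟫ ≤ 1} := fun k => rfl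
  have hQ : ∀ k, IsClosed (Q k) ∧ Convex ℝ (Q k) ∧ C ∩ r k • B ∩ Q k = ∅ := by
    intro k
    induction k with
    | zero => exact ⟨isClosed_univ, convex_univ, by simpa [Q, r] using hr₀C⟩
    | succ k ih =>
      rw [hQs]
      refine ⟨ih.1.inter (isClosed_le (by fun_prop) continuous_const), ih.2.1.inter ?_,
        (hh k (Q k) ih.1 ih.2.1 ih.2.2).2⟩
      intro x hx y hy a b ha hb hab
      simp only [Set.mem_ofPred_eq, inner_add_left, inner_smul_left, conj_trivial] at hx hy ⊢
      nlinarith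
  let g : ℕ → H := fun k => h k (Q k)
  have hg : ∀ k, ∀ b ∈ B, ⟪b, g k⟫ ≤ (r k)⁻¹ := fun k =>
    (hh k (Q k) (hQ k).1 (hQ k).2.1 (hQ k).2.2).1
  have hgc : ∀ k, ∀ b ∈ B, ⟪b, g k⟫ ≤ r₀⁻¹ * (1 / 2) ^ k := by
    intro k b hb
    refine (hg k b hb).trans (le_of_eq ?_)
    simp only [r, one_div, inv_pow, mul_inv]
  -- `f` lies in some `r n • B`. If no functional exceeded 1 at `f`, then `f` would also lie in `Q
  -- n`, against the emptiness of `C ∩ r n • B ∩ Q n`.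
  have hbig : ∀ f ∈ C, ∃ k, 1 < ⟪f, g k⟫ := by
    intro f hf
    by_contra! hcon
    obtain ⟨s, hs, hfs⟩ := hcov f hf
    obtain ⟨n, hn⟩ := pow_unbounded_of_one_lt (s / r₀) (one_lt_two (α := ℝ))
    have hsn : s ≤ r n := by
      rw [div_lt_iff₀ hr₀] at hn
      simp only [r]
      linarith
    have hfQ : ∀ k, f ∈ Q k := by
      intro k
      induction k with
      | zero => exact Set.mem_univ _
      | succ k ih => exact ⟨ih, hcon k⟩
    have : f ∈ C ∩ r n • B ∩ Q n := ⟨⟨hf, hBmono hs hsn hfs⟩, hfQ n⟩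
    rwa [(hQ n).2.2] at this
  rcases C.eq_empty_or_nonempty with rfl | ⟨f₀, hf₀⟩
  · exact ⟨0, 0, 0, ⟨1, by simp⟩, by simp, by simp⟩
  have hmem : ∀ f ∈ C, Memℓp (fun k => ⟪f, g k⟫) 2 := by
    intro f hf
    obtain ⟨s, hs, b, hb, rfl⟩ := hcov f hf
    rw [memℓp_gen_iff (by simp)]
    have hbound : ∀ k, |⟪s • b, g k⟫| ≤ s * (r₀⁻¹ * (1 / 2) ^ k) := by
      intro k
      rw [inner_smul_left, abs_mul]
      simp only [conj_trivial, abs_of_pos hs]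
      refine mul_le_mul_of_nonneg_left (abs_le.2 ⟨?_, hgc k b hb⟩) hs.le
      have := hgc k (-b) (hBs b hb)
      rw [inner_neg_left] at this
      linarith
    refine Summable.of_nonneg_of_le (fun k => by positivity)
      (f := fun k => (s * r₀⁻¹) ^ 2 * (1 / 4) ^ k) (fun k => ?_)
      ((summable_geometric_of_lt_one (by norm_num) (by norm_num)).mul_left _)
    simp only [ENNReal.toReal_ofNat, Real.rpow_two, Real.norm_eq_abs]
    calc |⟪s • b, g k⟫| ^ 2 ≤ (s * (r₀⁻¹ * (1 / 2) ^ k)) ^ 2 :=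
          pow_le_pow_left₀ (abs_nonneg _) (hbound k) 2
      _ = (s * r₀⁻¹) ^ 2 * (1 / 4) ^ k := by
          rw [← mul_assoc, mul_pow, ← pow_mul, mul_comm k 2, pow_mul]
          norm_num
  -- The sequences of pairings decay geometrically, so they form a convex set in `ℓ²`. It avoids the
  -- open unit ball because some coordinate exceeds 1. The point of least norm in its closure
  -- supplies the coefficients `l`.
  let D : Set (lp (fun _ : ℕ => ℝ) 2) := {x | ∃ f ∈ C, ∀ k, x k = ⟪f, g k⟫}
  have hD : Convex ℝ D := by
    rintro x ⟨f, hf, hx⟩ y ⟨f', hf', hy⟩ a b ha hb hab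
    refine ⟨a • f + b • f', hC hf hf' ha hb hab, fun k => ?_⟩
    change a • x k + b • y k = _
    simp [hx, hy, inner_add_left, inner_smul_left]
  have hD1 : ∀ x ∈ D, 1 ≤ ‖x‖ := by
    rintro x ⟨f, hf, hx⟩
    obtain ⟨k, hk⟩ := hbig f hf
    have := lp.norm_apply_le_norm two_ne_zero x k
    rw [hx k, Real.norm_eq_abs] at this
    linarith [le_abs_self ⟪f, g k⟫]
  obtain ⟨v, hv, hmin⟩ := exists_min_norm (K := closure D)
    (Set.Nonempty.closure ⟨⟨_, hmem f₀ hf₀⟩, f₀, hf₀, fun k => rfl⟩) isClosed_closure hD.closure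
  have hv1 : 1 ≤ ‖v‖ := closure_minimal (t := {x : lp (fun _ : ℕ => ℝ) 2 | 1 ≤ ‖x‖}) hD1
    (isClosed_le continuous_const continuous_norm) hv
  refine ⟨g, fun k => v k, ‖v‖, ⟨_, hgc⟩, fun k => lp.norm_apply_le_norm two_ne_zero v k,
    fun f hf => ?_⟩
  have := hmin ⟨_, hmem f hf⟩ (subset_closure ⟨f, hf, fun k => rfl⟩)
  rw [lp.inner_eq_tsum] at this
  have h1 : 1 ≤ ‖v‖ ^ 2 := one_le_pow₀ hv1
  exact h1.trans this

end Hilbert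

/-! ### Absolutely convergent series of integrable functions. -/

section Series

variable {α : Type*} {mα : MeasurableSpace α} {μ : Measure α} {F : ℕ → α → ℝ}

lemma tsum_lintegral_enorm_lt_top (hF : ∀ k, Integrable (F k) μ)
    (h : Summable fun k => ∫ x, ‖F k x‖ ∂μ) : ∑' k, ∫⁻ x, ‖F k x‖ₑ ∂μ < ⊤ := by
  have : ∀ k, ∫⁻ x, ‖F k x‖ₑ ∂μ = ENNReal.ofReal (∫ x, ‖F k x‖ ∂μ) := fun k =>
    (ofReal_integral_norm_eq_lintegral_enorm (hF k)).symm
  simp only [this]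
  exact h.tsum_ofReal_lt_top

lemma ae_summable_of_lintegral (hF : ∀ k, AEStronglyMeasurable (F k) μ)
    (h : ∫⁻ x, ∑' k, ‖F k x‖ₑ ∂μ < ⊤) : ∀ᵐ x ∂μ, Summable fun k => ‖F k x‖ := by
  filter_upwards [ae_lt_top' (AEMeasurable.tsum fun k => (hF k).enorm) h.ne] with x hx
  have := ENNReal.summable_toReal hx.ne
  simpa using this

lemma enorm_tsum_le_tsum_enorm' (f : ℕ → ℝ) : ‖∑' k, f k‖ₑ ≤ ∑' k, ‖f k‖ₑ := by
  by_cases hs : Summable f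
  · exact le_of_tendsto_of_tendsto' hs.hasSum.tendsto_sum_nat.enorm
      ENNReal.summable.hasSum.tendsto_sum_nat fun n => enorm_sum_le _ _
  · simp [tsum_eq_zero_of_not_summable hs]

lemma integrable_tsum_of_lintegral (hF : ∀ k, AEStronglyMeasurable (F k) μ)
    (h : ∫⁻ x, ∑' k, ‖F k x‖ₑ ∂μ < ⊤) : Integrable (fun x => ∑' k, F k x) μ := by
  refine ⟨?_, (lintegral_mono fun x => enorm_tsum_le_tsum_enorm' fun k => F k x).trans_lt h⟩
  have hs := ae_summable_of_lintegral hF h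
  refine aestronglyMeasurable_of_tendsto_ae (f := fun n x => ∑ k ∈ Finset.range n, F k x) atTop
    (fun n => Finset.aestronglyMeasurable_fun_sum _ fun k _ => hF k) ?_
  filter_upwards [hs] with x hx using hx.of_norm.hasSum.tendsto_sum_nat

lemma integral_tsum_of_lintegral (hF : ∀ k, AEStronglyMeasurable (F k) μ)
    (h : ∫⁻ x, ∑' k, ‖F k x‖ₑ ∂μ < ⊤) : ∫ x, ∑' k, F k x ∂μ = ∑' k, ∫ x, F k x ∂μ := by
  refine integral_tsum hF ?_
  rw [← lintegral_tsum fun k => (hF k).enorm]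
  exact h.ne

end Series

/-! ### Separation of bounded functions by an integrable function. -/

section Bounded

open scoped RealInnerProductSpace Pointwise ENNReal

variable {α : Type*} {mα : MeasurableSpace α} {μ : Measure α}

lemma exists_subseq_tendsto_ae {F : ℕ → Lp ℝ 2 μ} {f : Lp ℝ 2 μ} (h : Tendsto F atTop (𝓝 f)) :
    ∃ ns : ℕ → ℕ, StrictMono ns ∧ ∀ᵐ x ∂μ, Tendsto (fun i => F (ns i) x) atTop (𝓝 (f x)) :=
  (tendstoInMeasure_of_tendsto_Lp h).exists_seq_tendsto_ae

/-- A convex set of bounded functions that is closed under bounded almost everywhere convergence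
is strictly separated by an integrable function from each point outside of it. -/
theorem exists_separating_integrable [IsFiniteMeasure μ] {C : Set (α →ₘ[μ] ℝ)} (hC : Convex ℝ C)
    (hbdd : ∀ f ∈ C, ∃ c : ℝ, ∀ᵐ x ∂μ, |f x| ≤ c)
    (hcl : ∀ (F : ℕ → α →ₘ[μ] ℝ) (f : α →ₘ[μ] ℝ) (c : ℝ), (∀ n, F n ∈ C) →
      (∀ n, ∀ᵐ x ∂μ, |F n x| ≤ c) → (∀ᵐ x ∂μ, Tendsto (fun n => F n x) atTop (𝓝 (f x))) → f ∈ C)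
    (h0 : 0 ∉ C) : ∃ g : α → ℝ, Integrable g μ ∧ ∀ f ∈ C, 1 ≤ ∫ x, f x * g x ∂μ := by
  -- The unit ball of `L^∞`, placed in `L²`. Its polar gauge is the `L¹` norm, so the separating
  -- series converges in `L¹`.
  let B : Set (Lp ℝ 2 μ) := {f | ∀ᵐ x ∂μ, |f x| ≤ 1}
  let C' : Set (Lp ℝ 2 μ) := {f | (f : α →ₘ[μ] ℝ) ∈ C}
  have hmemB : ∀ (r : ℝ), 0 < r → ∀ f : Lp ℝ 2 μ, f ∈ r • B ↔ ∀ᵐ x ∂μ, |f x| ≤ r := by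
    intro r hr f
    rw [Set.mem_smul_set_iff_inv_smul_mem₀ hr.ne']
    refine eventually_congr (f := ae μ) ?_
    filter_upwards [Lp.coeFn_smul r⁻¹ f] with x hx
    rw [hx, Pi.smul_apply, smul_eq_mul, abs_mul, abs_of_pos (inv_pos.2 hr), inv_mul_le_iff₀ hr,
      mul_one]
  have hBcl : IsClosed B := by
    refine isClosed_of_closure_subset fun f hf => ?_
    obtain ⟨F, hF, hlim⟩ := mem_closure_iff_seq_limit.1 hf
    obtain ⟨ns, -, hns⟩ := exists_subseq_tendsto_ae hlim
    have hF' : ∀ᵐ x ∂μ, ∀ n, |F n x| ≤ 1 := ae_all_iff.2 hF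
    filter_upwards [hns, hF'] with x h1 h2
    exact le_of_tendsto' h1.abs fun n => h2 _
  have hBcv : Convex ℝ B := by
    intro f hf g hg a b ha hb hab
    filter_upwards [hf, hg, Lp.coeFn_add (a • f) (b • g), Lp.coeFn_smul a f, Lp.coeFn_smul b g]
      with x h1 h2 h3 h4 h5
    rw [h3, Pi.add_apply, h4, h5]
    simp only [Pi.smul_apply, smul_eq_mul]
    rw [abs_le] at h1 h2 ⊢
    constructor <;> nlinarith
  have hBsym : ∀ b ∈ B, -b ∈ B := by
    intro b hb
    filter_upwards [hb, Lp.coeFn_neg b] with x h1 h2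
    rwa [h2, Pi.neg_apply, abs_neg]
  have hBbd : ∀ f ∈ B, ‖f‖ ≤ (measureUnivNNReal μ : ℝ) ^ ((2 : ℝ≥0∞).toReal)⁻¹ * 1 :=
    fun f hf => Lp.norm_le_of_ae_bound zero_le_one hf
  have h0B : (0 : Lp ℝ 2 μ) ∈ B := by
    filter_upwards [Lp.coeFn_zero ℝ 2 μ] with x hx
    rw [hx]
    simp
  obtain ⟨h, l, M, ⟨c, hc⟩, hl, hsep⟩ := exists_separating_series (B := B) (C := C') hBcl hBcv hBsym
    hBbd
    (by
      intro f hf g hg a b ha hb hab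
      exact hC hf hg ha hb hab)
    (by
      -- A sequence that converges in `L²` converges almost everywhere along a subsequence, and
      -- inside `r • B` it is bounded by `r`: this is the situation of `hcl`.
      intro r hr
      refine isClosed_of_closure_subset fun f hf => ?_
      obtain ⟨F, hF, hlim⟩ := mem_closure_iff_seq_limit.1 hf
      obtain ⟨ns, -, hns⟩ := exists_subseq_tendsto_ae hlim
      have hF1 : ∀ n, ∀ᵐ x ∂μ, |F n x| ≤ r := fun n => (hmemB r hr _).1 (hF n).2
      refine ⟨hcl (fun n => F (ns n)) f r (fun n => (hF _).1) (fun n => hF1 _) hns, ?_⟩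
      rw [hmemB r hr]
      filter_upwards [hns, ae_all_iff.2 hF1] with x h1 h2
      exact le_of_tendsto' h1.abs fun n => h2 _)
    (by
      intro f hf
      obtain ⟨c, hc⟩ := hbdd _ hf
      refine ⟨max c 1, by positivity, (hmemB _ (by positivity) _).2 ?_⟩
      filter_upwards [hc] with x hx using hx.trans (le_max_left _ _))
    h0B (by
      intro h
      exact h0 h)
  have hint : ∀ k, Integrable (h k) μ := fun k => (Lp.memLp (h k)).integrable (by norm_num)
  have hnorm : ∀ k, ∫ x, ‖h k x‖ ∂μ ≤ c * (1 / 2) ^ k := by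
    intro k
    have hm : Measurable (h k) := (Lp.stronglyMeasurable (h k)).measurable
    -- The sign of `h k` belongs to `B`, and its pairing with `h k` is the `L¹` norm of `h k`.
    let b : α → ℝ := fun x => if 0 ≤ h k x then 1 else -1
    have hbm : Measurable b := Measurable.ite (measurableSet_le measurable_const hm)
      measurable_const measurable_const
    have hb1 : ∀ x, |b x| ≤ 1 := fun x => by
      simp only [b]
      split_ifs <;> simp
    have hbL : MemLp b 2 μ := MemLp.of_bound hbm.aestronglyMeasurable 1 (Eventually.of_forall hb1)
    have hbB : hbL.toLp b ∈ B := by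
      filter_upwards [hbL.coeFn_toLp] with x hx
      rw [hx]
      exact hb1 x
    refine le_trans (le_of_eq ?_) (hc k _ hbB)
    rw [L2.inner_def]
    refine integral_congr_ae ?_
    filter_upwards [hbL.coeFn_toLp] with x hx
    rw [hx]
    simp only [b, RCLike.inner_apply, conj_trivial, Real.norm_eq_abs]
    split_ifs with h0
    · rw [abs_of_nonneg h0, mul_one]
    · rw [abs_of_neg (not_le.1 h0), mul_neg, mul_one]
  have hMpos : 0 ≤ M := (abs_nonneg _).trans (hl 0)
  have hn0 : ∀ k, 0 ≤ ∫ x, ‖h k x‖ ∂μ := fun k => integral_nonneg fun x => norm_nonneg _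
  have hsum : Summable fun k => ∫ x, ‖l k * h k x‖ ∂μ := by
    simp only [norm_mul, integral_const_mul]
    refine Summable.of_nonneg_of_le (fun k => mul_nonneg (norm_nonneg _) (hn0 k))
      (fun k => mul_le_mul (hl k) (hnorm k) (hn0 k) hMpos)
      (((summable_geometric_of_lt_one (by norm_num) (by norm_num)).mul_left _).mul_left _)
  have hint' : ∀ k, Integrable (fun x => l k * h k x) μ := fun k => (hint k).const_mul _
  have hlin : ∫⁻ x, ∑' k, ‖l k * h k x‖ₑ ∂μ < ⊤ := by
    rw [lintegral_tsum fun k => (hint' k).aestronglyMeasurable.enorm]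
    exact tsum_lintegral_enorm_lt_top hint' hsum
  refine ⟨fun x => ∑' k, l k * h k x,
    integrable_tsum_of_lintegral (fun k => (hint' k).aestronglyMeasurable) hlin, fun f hf => ?_⟩
  obtain ⟨r, hr⟩ := hbdd f hf
  have hfL : MemLp f 2 μ := MemLp.of_bound f.aestronglyMeasurable r hr
  let f' : Lp ℝ 2 μ := ⟨f, (Lp.mem_Lp_iff_memLp).2 hfL⟩
  have hff' : ∀ x, f' x = f x := fun _ => rfl
  refine (hsep f' hf).trans (le_of_eq ?_)
  have hfint : ∀ k, Integrable (fun x => f x * (l k * h k x)) μ := fun k =>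
    (hint' k).bdd_mul f.aestronglyMeasurable hr
  have h1 : ∀ k, ∫ x, f x * (l k * h k x) ∂μ = ⟪f', h k⟫ * l k := by
    intro k
    rw [L2.inner_def, ← integral_mul_const]
    refine integral_congr_ae (Eventually.of_forall fun x => ?_)
    simp only [RCLike.inner_apply, conj_trivial, hff']
    ring
  have h2 := integral_tsum_of_summable_integral_norm hfint (by
    refine Summable.of_nonneg_of_le (fun k => integral_nonneg fun x => norm_nonneg _) (fun k => ?_)
      (hsum.mul_left r)
    rw [← integral_const_mul]
    refine integral_mono_ae (hfint k).norm ((hint' k).norm.const_mul _) ?_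
    filter_upwards [hr] with x hx
    rw [norm_mul]
    exact mul_le_mul_of_nonneg_right hx (norm_nonneg _))
  simp only [h1, tsum_mul_left] at h2
  exact h2

end Bounded

/-! ### Essential infima as countable infima. -/

section EssInf

variable {Ω : Type*} {mΩ : MeasurableSpace Ω} {P : Measure Ω} [IsFiniteMeasure P]

/-- The essential infimum of a nonempty family is the infimum of countably many of its members. -/
lemma exists_seq_essInfimum_eq {S : Set (Ω →ₘ[P] EReal)} (hS : S.Nonempty) :
    ∃ u : ℕ → Ω →ₘ[P] EReal, (∀ n, u n ∈ S) ∧ essInfimum S =ᵐ[P] fun ω => ⨅ n, u n ω := by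
  classical
  let I : (ℕ → S) → Ω → EReal := fun u ω => ⨅ n, (u n).1 ω
  have hI : ∀ u, Measurable (I u) := fun u =>
    Measurable.iInf fun n => (u n).1.stronglyMeasurable.measurable
  let V : (ℕ → S) → ENNReal := fun u => ∫⁻ ω, squash (I u ω) ∂P
  have hVtop : ∀ u, V u ≠ ⊤ := fun u => by
    refine ne_top_of_le_ne_top (measure_ne_top P Set.univ) ?_
    calc V u ≤ ∫⁻ _, 1 ∂P := lintegral_mono fun ω => squash_le_one _
      _ = P Set.univ := by simp
  have : Nonempty S := hS.to_subtype
  obtain ⟨w, -, hw, hwm⟩ := exists_seq_tendsto_sInf (S := Set.range V)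
    (Set.range_nonempty V) (OrderBot.bddBelow _)
  choose u hu using hwm
  -- One sequence that runs through all members of all the minimizing sequences attains the least
  -- value of `V`.
  let v : ℕ → S := fun n => u n.unpair.1 n.unpair.2
  have hv : ∀ k ω, I v ω ≤ I (u k) ω := fun k ω => le_iInf fun n =>
    (iInf_le _ (Nat.pair k n)).trans (by simp [v])
  have hVv : ∀ z, V v ≤ V z := fun z => by
    refine le_trans (ge_of_tendsto' hw fun k => ?_) (sInf_le ⟨z, rfl⟩)
    rw [← hu k]
    exact lintegral_mono fun ω => squash_strictMono.monotone (hv k ω)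
  have hmin : ∀ f ∈ S, ∀ᵐ ω ∂P, I v ω ≤ f ω := by
    intro f hf
    -- Putting `f` in front of `v` cannot lower the minimal integral, so strict monotonicity of
    -- `squash` makes the two infima agree almost everywhere.
    let z : ℕ → S := fun n => Nat.casesOn n ⟨f, hf⟩ v
    have hz : ∀ ω, I z ω ≤ I v ω := fun ω =>
      le_iInf fun n => iInf_le (fun n => (z n).1 ω) (n + 1)
    have := ae_eq_of_ae_le_of_lintegral_le (μ := P)
      (f := fun ω => squash (I z ω)) (g := fun ω => squash (I v ω))
      (Eventually.of_forall fun ω => squash_strictMono.monotone (hz ω)) (hVtop z)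
      (measurable_squash.comp (hI v)).aemeasurable (hVv z)
    filter_upwards [this] with ω h1
    rw [← squash_strictMono.injective h1]
    exact iInf_le (fun n => (z n).1 ω) 0
  refine ⟨fun n => (v n).1, fun n => (v n).2, ?_⟩
  have hle : AEEqFun.mk (I v) (hI v).aestronglyMeasurable ≤ essInfimum S := by
    refine (isGLB_essInfimum S).2 fun f hf => ?_
    rw [← AEEqFun.coeFn_le]
    filter_upwards [hmin f hf, AEEqFun.coeFn_mk (I v) (hI v).aestronglyMeasurable (μ := P)]
      with ω h1 h2
    rwa [h2]
  have hge : ∀ᵐ ω ∂P, ∀ n, essInfimum S ω ≤ (v n).1 ω :=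
    ae_all_iff.2 fun n => AEEqFun.coeFn_le.2 ((isGLB_essInfimum S).1 (v n).2)
  filter_upwards [hge, AEEqFun.coeFn_le.2 hle,
    AEEqFun.coeFn_mk (I v) (hI v).aestronglyMeasurable (μ := P)] with ω h1 h2 h3
  rw [h3] at h2
  exact le_antisymm (le_iInf h1) h2

/-- The essential infimum is taken among all random variables, but as a countable infimum it
inherits measurability for a smaller σ-algebra. This makes `φ` and `φ^#` measurable for `ℱ_τ`. -/
lemma aestronglyMeasurable_essInfimum {α : Type*} {m mα : MeasurableSpace α} {μ : Measure α}
    [IsFiniteMeasure μ] {S : Set (α →ₘ[μ] EReal)}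
    (hS : S.Nonempty) (hm : ∀ f ∈ S, AEStronglyMeasurable[m] f μ) :
    AEStronglyMeasurable[m] (essInfimum S) μ := by
  obtain ⟨u, hu, he⟩ := exists_seq_essInfimum_eq hS
  choose g hg hug using fun n => hm (u n) (hu n)
  have hgm : ∀ n, Measurable[m] (g n) := fun n => (hg n).measurable
  have hinf : Measurable[m] fun ω => ⨅ n, g n ω := Measurable.iInf hgm
  refine ⟨fun ω => ⨅ n, g n ω, hinf.stronglyMeasurable, ?_⟩
  filter_upwards [he, ae_all_iff.2 hug] with ω h1 h2
  rw [h1]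
  simp only [h2]

lemma essInfimum_le {S : Set (Ω →ₘ[P] EReal)} {f : Ω →ₘ[P] EReal} (hf : f ∈ S) :
    ∀ᵐ ω ∂P, essInfimum S ω ≤ f ω :=
  AEEqFun.coeFn_le.2 ((isGLB_essInfimum S).1 hf)

/-- A measurable function that is almost surely below every member of a family is below the
essential infimum. -/
lemma le_essInfimum {S : Set (Ω →ₘ[P] EReal)} {g : Ω → EReal} (hg : AEStronglyMeasurable g P)
    (h : ∀ f ∈ S, ∀ᵐ ω ∂P, g ω ≤ f ω) : ∀ᵐ ω ∂P, g ω ≤ essInfimum S ω := by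
  have : AEEqFun.mk g hg ≤ essInfimum S := by
    refine (isGLB_essInfimum S).2 fun f hf => ?_
    rw [← AEEqFun.coeFn_le]
    filter_upwards [h f hf, AEEqFun.coeFn_mk g hg] with ω h1 h2
    rwa [h2]
  filter_upwards [AEEqFun.coeFn_le.2 this, AEEqFun.coeFn_mk g hg] with ω h1 h2
  rwa [h2] at h1

end EssInf

/-! ### Increments, stopped processes and the projection. -/

section Processes

variable {Ω : Type*} {mΩ : MeasurableSpace Ω} {P : Measure Ω} {ℱ : Filtration ℕ mΩ}
  {τ θ : Ω → WithTop ℕ}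

lemma toE_ae (f : Ω →ₘ[P] ℝ) : ∀ᵐ ω ∂P, toE f ω = ((f ω : ℝ) : EReal) :=
  AEEqFun.coeFn_comp _ continuous_coe_real_ereal f

lemma ind_ae {A : Set Ω} (hA : MeasurableSet A) :
    ∀ᵐ ω ∂P, ind P hA ω = A.indicator (fun _ => (1 : ℝ)) ω :=
  AEEqFun.coeFn_mk _ _

lemma add_ae (X Y : Proc P) : ∀ᵐ ω ∂P, ∀ t, (X + Y) t ω = X t ω + Y t ω :=
  ae_all_iff.2 fun t => AEEqFun.coeFn_add (X t) (Y t)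

lemma mul_ae (l : Ω →ₘ[P] ℝ) (X : Proc P) : ∀ᵐ ω ∂P, ∀ t, (l * X t) ω = l ω * X t ω :=
  ae_all_iff.2 fun t => AEEqFun.coeFn_mul l (X t)

lemma mix_ae (l k : Ω →ₘ[P] ℝ) (X Y : Proc P) :
    ∀ᵐ ω ∂P, ∀ t, (l * X t + k * Y t) ω = l ω * X t ω + k ω * Y t ω := by
  filter_upwards [add_ae (fun t => l * X t) (fun t => k * Y t), mul_ae l X, mul_ae k Y]
    with ω h1 h2 h3 t
  rw [← h2, ← h3]
  exact h1 t

lemma incr_ae (a : Proc P) : ∀ᵐ ω ∂P, incr a 0 ω = a 0 ω ∧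
    ∀ t, incr a (t + 1) ω = a (t + 1) ω - a t ω := by
  filter_upwards [ae_all_iff.2 fun t => AEEqFun.coeFn_sub (a (t + 1)) (a t)] with ω h
  exact ⟨rfl, h⟩

/-- The process with given increments. -/
def ofIncr (d : Proc P) : Proc P := fun t => ∑ s ∈ Finset.range (t + 1), d s

lemma incr_ofIncr (d : Proc P) : incr (ofIncr d) = d := by
  funext t
  cases t with
  | zero => simp [incr, ofIncr]
  | succ t => simp [incr, ofIncr, Finset.sum_range_succ _ (t + 1)]

lemma sum_incr (a : Proc P) (t : ℕ) : ∑ s ∈ Finset.range (t + 1), incr a s = a t := by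
  induction t with
  | zero => simp [incr]
  | succ t ih => rw [Finset.sum_range_succ, ih]; simp [incr]

lemma ofIncr_incr (a : Proc P) : ofIncr (incr a) = a := funext fun t => sum_incr a t

lemma sum_ae (d : Proc P) (n : ℕ) :
    ∀ᵐ ω ∂P, (∑ s ∈ Finset.range n, d s) ω = ∑ s ∈ Finset.range n, d s ω := by
  induction n with
  | zero => exact AEEqFun.coeFn_zero (β := ℝ) (μ := P)
  | succ n ih =>
    filter_upwards [ih, AEEqFun.coeFn_add (∑ s ∈ Finset.range n, d s) (d n)] with ω h1 h2
    rw [Finset.sum_range_succ, Finset.sum_range_succ, h2, Pi.add_apply, h1]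

lemma sum_incr_ae (a : Proc P) :
    ∀ᵐ ω ∂P, ∀ t, ∑ s ∈ Finset.range (t + 1), incr a s ω = a t ω := by
  filter_upwards [ae_all_iff.2 (sum_ae (incr a))] with ω h t
  rw [← h, sum_incr]

lemma isAdapted_incr {a : Proc P} (ha : IsAdapted ℱ a) : IsAdapted ℱ (incr a) := by
  intro t
  cases t with
  | zero => exact ha 0
  | succ t =>
    have h := (ha (t + 1)).sub ((ha t).mono (ℱ.mono t.le_succ))
    exact h.congr (AEEqFun.coeFn_sub _ _).symm

lemma isAdapted_ofIncr {d : Proc P} (hd : IsAdapted ℱ d) : IsAdapted ℱ (ofIncr d) := by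
  intro t
  refine AEStronglyMeasurable.congr ?_ (EventuallyEq.symm (sum_ae d (t + 1)))
  choose g hg hdg using hd
  refine ⟨fun ω => ∑ s ∈ Finset.range (t + 1), g s ω, Finset.stronglyMeasurable_fun_sum _
    fun s hs => (hg s).mono (ℱ.mono (Nat.lt_succ_iff.1 (Finset.mem_range.1 hs))), ?_⟩
  filter_upwards [ae_all_iff.2 hdg] with ω h
  simp only [h]

/-- The process vanishes before `τ` and is constant from `θ` on. -/
def IsStopped (τ θ : Ω → WithTop ℕ) (X : Proc P) : Prop :=
  ∀ᵐ ω ∂P, ∀ t : ℕ, (¬ τ ω ≤ t → X t ω = 0) ∧ (θ ω ≤ t → X (t + 1) ω = X t ω)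

lemma eq_top_or_eq_natCast (r : WithTop ℕ) : r = ⊤ ∨ ∃ s : ℕ, r = s :=
  or_iff_not_imp_left.2 fun h => (WithTop.ne_top_iff_exists.1 h).imp fun _ hs => hs.symm

/-- The minimum with a natural number is never `⊤`, so the default value of `untopA` plays no role
in stopped processes. -/
lemma untopA_min_natCast (t s : ℕ) : (min (t : WithTop ℕ) (s : WithTop ℕ)).untopA = min t s := by
  rcases le_total t s with h | h
  · rw [min_eq_left h, min_eq_left (by exact_mod_cast h)]
    rfl
  · rw [min_eq_right h, min_eq_right (by exact_mod_cast h)]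
    rfl

lemma untopA_min_top (t : ℕ) : (min (t : WithTop ℕ) ⊤).untopA = t := by
  rw [min_top_right]
  rfl

lemma apply_min_untopA {x : ℕ → ℝ} {r : WithTop ℕ} (h : ∀ t : ℕ, r ≤ t → x (t + 1) = x t) (t : ℕ) :
    x (min (t : WithTop ℕ) r).untopA = x t := by
  obtain rfl | ⟨s, rfl⟩ := eq_top_or_eq_natCast r
  · rw [untopA_min_top]
  · rw [untopA_min_natCast]
    rcases le_total t s with hts | hts
    · rw [min_eq_left hts]
    · rw [min_eq_right hts]
      induction t, hts using Nat.le_induction with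
      | base => rfl
      | succ t hst ih => rw [h t (by exact_mod_cast hst), ih]

variable (hτ : IsStoppingTime ℱ τ) (hθ : IsStoppingTime ℱ θ)

lemma proj_ae (X : Proc P) : ∀ᵐ ω ∂P, ∀ t : ℕ, (τ ω ≤ t → proj hτ hθ X t ω =
    X (min (t : WithTop ℕ) (θ ω)).untopA ω) ∧ (¬ τ ω ≤ t → proj hτ hθ X t ω = 0) := by
  filter_upwards [ae_all_iff.2 fun t => AEEqFun.coeFn_mk _
    (measurable_proj X hτ hθ t).aestronglyMeasurable (μ := P)] with ω h t
  have h' : proj hτ hθ X t ω = _ := h t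
  rw [h']
  refine ⟨fun hle => ?_, fun hle => ?_⟩
  · exact Set.indicator_of_mem (s := {ω | τ ω ≤ t}) hle _
  · exact Set.indicator_of_notMem (s := {ω | τ ω ≤ t}) hle _

lemma isAdapted_proj {X : Proc P} (hX : IsAdapted ℱ X) : IsAdapted ℱ (proj hτ hθ X) := by
  intro t
  choose Y hY hXY using hX
  have hY' : StronglyAdapted ℱ Y := hY
  refine ⟨{ω | τ ω ≤ t}.indicator (stoppedProcess Y θ t),
    (hY'.stoppedProcess_of_discrete hθ t).indicator (hτ t), ?_⟩
  filter_upwards [AEEqFun.coeFn_mk _ (measurable_proj X hτ hθ t).aestronglyMeasurable (μ := P),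
    ae_all_iff.2 hXY] with ω h1 h2
  have h1' : proj hτ hθ X t ω = _ := h1
  rw [h1']
  simp only [Set.indicator, stoppedProcess, h2]

lemma untopA_min_mono (r : WithTop ℕ) (s t : ℕ) (h : s ≤ t) :
    (min (s : WithTop ℕ) r).untopA ≤ (min (t : WithTop ℕ) r).untopA := by
  obtain rfl | ⟨r, rfl⟩ := eq_top_or_eq_natCast r
  · simpa only [untopA_min_top]
  · rw [untopA_min_natCast, untopA_min_natCast]
    exact min_le_min_right _ h

lemma untopA_min_le (r : WithTop ℕ) (t : ℕ) : (min (t : WithTop ℕ) r).untopA ≤ t := by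
  obtain rfl | ⟨r, rfl⟩ := eq_top_or_eq_natCast r
  · rw [untopA_min_top]
  · rw [untopA_min_natCast]
    exact min_le_left _ _

lemma untopA_min_of_le {r : WithTop ℕ} {t : ℕ} (h : t ≤ r) :
    (min (t : WithTop ℕ) r).untopA = t := by
  rw [min_eq_left h]
  rfl

lemma untopA_min_of_ge {r : WithTop ℕ} {t : ℕ} (h : r ≤ t) :
    (min ((t + 1 : ℕ) : WithTop ℕ) r).untopA = (min (t : WithTop ℕ) r).untopA := by
  rw [min_eq_right h, min_eq_right (h.trans (by exact_mod_cast t.le_succ))]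

variable {hτ hθ}

lemma isStopped_proj (hτθ : ∀ᵐ ω ∂P, τ ω ≤ θ ω) (X : Proc P) : IsStopped τ θ (proj hτ hθ X) := by
  filter_upwards [proj_ae hτ hθ X, hτθ] with ω h hle t
  refine ⟨(h t).2, fun ht => ?_⟩
  rw [(h t).1 (hle.trans ht),
    (h (t + 1)).1 ((hle.trans ht).trans (by exact_mod_cast t.le_succ)), untopA_min_of_ge ht]

lemma IsStopped.proj_eq {X : Proc P} (hX : IsStopped τ θ X) : proj hτ hθ X = X := by
  funext t
  refine AEEqFun.ext ?_
  filter_upwards [proj_ae hτ hθ X, hX] with ω h1 h2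
  by_cases hle : τ ω ≤ t
  · rw [(h1 t).1 hle]
    exact apply_min_untopA (x := fun t => X t ω) (fun s => (h2 s).2) t
  · rw [(h1 t).2 hle, (h2 t).1 hle]

lemma proj_mem_RInf {X : Proc P} (hX : X ∈ RInf P ℱ) : proj hτ hθ X ∈ RInf P ℱ := by
  obtain ⟨h1, c, hc⟩ := hX
  refine ⟨isAdapted_proj hτ hθ h1, c, fun t => ?_⟩
  filter_upwards [proj_ae hτ hθ X, ae_all_iff.2 hc] with ω h h2
  by_cases hle : τ ω ≤ t
  · rw [(h t).1 hle]
    exact h2 _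
  · rw [(h t).2 hle, abs_zero]
    exact (abs_nonneg _).trans (h2 0)

/-- The projection is idempotent, so its image consists of its fixed points, and these are
recognized path by path. Unlike the existence of a preimage, this condition passes to limits and can
be tested by integrals. -/
lemma mem_RInfStop_iff (hτθ : ∀ᵐ ω ∂P, τ ω ≤ θ ω) {X : Proc P} :
    X ∈ RInfStop P hτ hθ ↔ X ∈ RInf P ℱ ∧ IsStopped τ θ X := by
  constructor
  · rintro ⟨Y, hY, rfl⟩
    exact ⟨proj_mem_RInf hY, isStopped_proj hτθ Y⟩
  · rintro ⟨h1, h2⟩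
    exact ⟨X, h1, h2.proj_eq⟩

/-- The increments of an element of `π_{τ,θ} 𝒜^1_+`. -/
structure IsDensity (ℱ : Filtration ℕ mΩ) (τ θ : Ω → WithTop ℕ) (d : Proc P) : Prop where
  adapted : IsAdapted ℱ d
  lintegral : ∫⁻ ω, ∑' t, ‖d t ω‖ₑ ∂P < ⊤
  nonneg : ∀ᵐ ω ∂P, ∀ t, 0 ≤ d t ω
  support : ∀ᵐ ω ∂P, ∀ t : ℕ, ¬ (τ ω ≤ t ∧ t ≤ θ ω) → d t ω = 0

lemma isDensity_incr_proj (hτθ : ∀ᵐ ω ∂P, τ ω ≤ θ ω) {b : Proc P} (hb : b ∈ AOnePos P ℱ) :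
    IsDensity ℱ τ θ (incr (proj hτ hθ b)) := by
  have hpos : ∀ᵐ ω ∂P, ∀ t, 0 ≤ incr b t ω := by
    refine ae_all_iff.2 fun t => ?_
    filter_upwards [AEEqFun.coeFn_le.2 (hb.2 t), AEEqFun.coeFn_zero (β := ℝ) (μ := P)] with ω h h0
    rwa [h0] at h
  have hmono : ∀ᵐ ω ∂P, Monotone (fun t => b t ω) ∧ ∀ t, 0 ≤ b t ω := by
    filter_upwards [hpos, incr_ae b, sum_incr_ae b] with ω h1 h2 h3
    refine ⟨monotone_nat_of_le_succ fun t => ?_, fun t => ?_⟩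
    · have := h1 (t + 1)
      rw [h2.2] at this
      linarith
    · rw [← h3]
      exact Finset.sum_nonneg fun s _ => h1 s
  have hnn : ∀ᵐ ω ∂P, ∀ t, 0 ≤ incr (proj hτ hθ b) t ω := by
    filter_upwards [hmono, incr_ae (proj hτ hθ b), proj_ae hτ hθ b] with ω h1 h2 h3 t
    have hp : ∀ t, 0 ≤ proj hτ hθ b t ω := fun t => by
      by_cases hle : τ ω ≤ t
      · rw [(h3 t).1 hle]; exact h1.2 _
      · rw [(h3 t).2 hle]
    cases t with
    | zero => rw [h2.1]; exact hp 0
    | succ t =>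
      rw [h2.2, sub_nonneg]
      by_cases hle : τ ω ≤ t
      · rw [(h3 t).1 hle, (h3 (t + 1)).1 (hle.trans (by exact_mod_cast t.le_succ))]
        exact h1.1 (untopA_min_mono _ _ _ t.le_succ)
      · rw [(h3 t).2 hle]; exact hp _
  refine ⟨isAdapted_incr (isAdapted_proj hτ hθ hb.1.1), ?_, hnn, ?_⟩
  · refine lt_of_le_of_lt (lintegral_mono_ae ?_) hb.1.2
    filter_upwards [hnn, hmono, hpos, proj_ae hτ hθ b, sum_incr_ae b, sum_incr_ae (proj hτ hθ b)]
      with ω h1 h2 h3 h4 h5 h6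
    refine ENNReal.tsum_le_of_sum_range_le fun n => ?_
    cases n with
    | zero => simp
    | succ n =>
      refine le_trans ?_ (ENNReal.sum_le_tsum (Finset.range (n + 1)))
      simp only [Real.enorm_of_nonneg (h1 _), Real.enorm_of_nonneg (h3 _)]
      rw [← ENNReal.ofReal_sum_of_nonneg fun i _ => h1 i,
        ← ENNReal.ofReal_sum_of_nonneg fun i _ => h3 i, h5, h6]
      refine ENNReal.ofReal_le_ofReal ?_
      by_cases hle : τ ω ≤ n
      · rw [(h4 n).1 hle]
        exact h2.1 (untopA_min_le _ _)
      · rw [(h4 n).2 hle]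
        exact h2.2 _
  · filter_upwards [isStopped_proj (hτ := hτ) (hθ := hθ) hτθ b, incr_ae (proj hτ hθ b), hτθ]
      with ω h1 h2 h3 t ht
    cases t with
    | zero =>
      rw [h2.1]
      exact (h1 0).1 fun h => ht ⟨h, bot_le⟩
    | succ t =>
      rw [h2.2]
      by_cases hle : τ ω ≤ (t + 1 : ℕ)
      · have h4 : ¬ ((t + 1 : ℕ) : WithTop ℕ) ≤ θ ω := fun h => ht ⟨hle, h⟩
        have h5 : θ ω ≤ t := by
          rw [not_le] at h4
          obtain h | ⟨s, hs⟩ := eq_top_or_eq_natCast (θ ω)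
          · exact (ne_top_of_lt h4 h).elim
          rw [hs] at h4 ⊢
          have : s < t + 1 := by exact_mod_cast h4
          exact_mod_cast Nat.lt_succ_iff.1 this
        rw [(h1 t).2 h5, sub_self]
      · have h4 : ¬ τ ω ≤ t := fun h => hle (h.trans (by exact_mod_cast t.le_succ))
        rw [(h1 _).1 hle, (h1 _).1 h4, sub_zero]

lemma IsDensity.mem_AOnePos {a : Proc P} (h : IsDensity ℱ τ θ (incr a)) : a ∈ AOnePos P ℱ := by
  refine ⟨⟨ofIncr_incr a ▸ isAdapted_ofIncr h.adapted, h.lintegral⟩, fun t => ?_⟩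
  rw [← AEEqFun.coeFn_le]
  filter_upwards [h.nonneg, AEEqFun.coeFn_zero (β := ℝ) (μ := P)] with ω h1 h0
  rw [h0]
  exact h1 t

lemma IsDensity.isStopped {a : Proc P} (h : IsDensity ℱ τ θ (incr a)) : IsStopped τ θ a := by
  filter_upwards [h.support, incr_ae a, sum_incr_ae a] with ω h1 h2 h3 t
  refine ⟨fun ht => ?_, fun ht => ?_⟩
  · rw [← h3]
    refine Finset.sum_eq_zero fun s hs => h1 s fun hs' => ht (hs'.1.trans ?_)
    exact_mod_cast Nat.lt_succ_iff.1 (Finset.mem_range.1 hs)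
  · have := h1 (t + 1) fun h => by
      have h4 := h.2.trans ht
      have h5 : t + 1 ≤ t := by exact_mod_cast h4
      omega
    rw [h2.2] at this
    linarith

/-- Increments determine the process, so membership becomes a list of conditions that can be checked
on increments built by hand. -/
lemma mem_DStop_iff (hτθ : ∀ᵐ ω ∂P, τ ω ≤ θ ω) {a : Proc P} :
    a ∈ DStop P hτ hθ ↔ IsDensity ℱ τ θ (incr a) ∧ condPairing hτ θ 1 a = 1 := by
  constructor
  · rintro ⟨⟨b, hb, rfl⟩, h⟩
    exact ⟨isDensity_incr_proj hτθ hb, h⟩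
  · rintro ⟨h1, h2⟩
    exact ⟨⟨a, h1.mem_AOnePos, h1.isStopped.proj_eq⟩, h2⟩

end Processes

/-! ### Ring identities for classes of random variables. -/

section Algebra

variable {Ω : Type*} {mΩ : MeasurableSpace Ω} {P : Measure Ω}

protected lemma mul_zero (l : Ω →ₘ[P] ℝ) : l * 0 = 0 :=
  AEEqFun.toGerm_injective (by rw [AEEqFun.mul_toGerm, AEEqFun.zero_toGerm, mul_zero])

protected lemma zero_mul (l : Ω →ₘ[P] ℝ) : 0 * l = 0 := by
  rw [mul_comm, CondUtility.mul_zero]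

protected lemma mul_add (l k m : Ω →ₘ[P] ℝ) : l * (k + m) = l * k + l * m :=
  AEEqFun.toGerm_injective (by simp only [AEEqFun.mul_toGerm, AEEqFun.add_toGerm, mul_add])

protected lemma mul_neg (l k : Ω →ₘ[P] ℝ) : l * -k = -(l * k) := by
  rw [eq_neg_iff_add_eq_zero, ← CondUtility.mul_add, neg_add_cancel, CondUtility.mul_zero]

end Algebra

/-! ### The series of a bounded process against increments. -/

section Series

variable {Ω : Type*} {mΩ : MeasurableSpace Ω} {P : Measure Ω}

/-- The process is essentially bounded, uniformly in time. -/
def IsBdd (X : Proc P) : Prop := ∃ c : ℝ, ∀ t, ∀ᵐ ω ∂P, |X t ω| ≤ c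

/-- The random variable `∑ X_t d_t`. -/
def series (X d : Proc P) (ω : Ω) : ℝ := ∑' t, X t ω * d t ω

variable {X Y d e : Proc P}

lemma aestronglyMeasurable_mul (X d : Proc P) (t : ℕ) :
    AEStronglyMeasurable (fun ω => X t ω * d t ω) P :=
  (X t).aestronglyMeasurable.mul (d t).aestronglyMeasurable

lemma lintegral_tsum_mul_lt_top (hX : IsBdd X) (hd : ∫⁻ ω, ∑' t, ‖d t ω‖ₑ ∂P < ⊤) :
    ∫⁻ ω, ∑' t, ‖X t ω * d t ω‖ₑ ∂P < ⊤ := by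
  obtain ⟨c, hc⟩ := hX
  refine lt_of_le_of_lt (b := ∫⁻ ω, ENNReal.ofReal c * ∑' t, ‖d t ω‖ₑ ∂P) (lintegral_mono_ae ?_) ?_
  · filter_upwards [ae_all_iff.2 hc] with ω h
    rw [← ENNReal.tsum_mul_left]
    refine ENNReal.tsum_le_tsum fun t => ?_
    rw [enorm_mul]
    refine mul_le_mul_left ?_ _
    rw [← ofReal_norm]
    exact ENNReal.ofReal_le_ofReal (h t)
  · rw [lintegral_const_mul'' _ (AEMeasurable.tsum fun t => (d t).aestronglyMeasurable.enorm)]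
    exact ENNReal.mul_lt_top ENNReal.ofReal_lt_top hd

lemma ae_summable_mul (hX : IsBdd X) (hd : ∫⁻ ω, ∑' t, ‖d t ω‖ₑ ∂P < ⊤) :
    ∀ᵐ ω ∂P, Summable fun t => X t ω * d t ω := by
  filter_upwards [ae_summable_of_lintegral (aestronglyMeasurable_mul X d)
    (lintegral_tsum_mul_lt_top hX hd)] with ω h using h.of_norm

lemma integrable_series (hX : IsBdd X) (hd : ∫⁻ ω, ∑' t, ‖d t ω‖ₑ ∂P < ⊤) :
    Integrable (series X d) P :=
  integrable_tsum_of_lintegral (aestronglyMeasurable_mul X d) (lintegral_tsum_mul_lt_top hX hd)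

lemma integral_series (hX : IsBdd X) (hd : ∫⁻ ω, ∑' t, ‖d t ω‖ₑ ∂P < ⊤) :
    ∫ ω, series X d ω ∂P = ∑' t, ∫ ω, X t ω * d t ω ∂P :=
  integral_tsum_of_lintegral (aestronglyMeasurable_mul X d) (lintegral_tsum_mul_lt_top hX hd)

lemma pairing_ofIncr (X d : Proc P) : pairing X (ofIncr d) = ∫ ω, series X d ω ∂P := by
  simp only [pairing, incr_ofIncr, series]

lemma series_mix_left (l k : Ω →ₘ[P] ℝ) (hX : IsBdd X) (hY : IsBdd Y)
    (hd : ∫⁻ ω, ∑' t, ‖d t ω‖ₑ ∂P < ⊤) : ∀ᵐ ω ∂P, series (fun t => l * X t + k * Y t) d ω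
      = l ω * series X d ω + k ω * series Y d ω := by
  filter_upwards [mix_ae l k X Y, ae_summable_mul hX hd, ae_summable_mul hY hd] with ω h1 h2 h3
  simp only [series, h1]
  rw [← tsum_mul_left, ← tsum_mul_left, ← (h2.mul_left _).tsum_add (h3.mul_left _)]
  exact tsum_congr fun t => by ring

lemma series_mix_right (l k : Ω →ₘ[P] ℝ) (hX : IsBdd X) (hd : ∫⁻ ω, ∑' t, ‖d t ω‖ₑ ∂P < ⊤)
    (he : ∫⁻ ω, ∑' t, ‖e t ω‖ₑ ∂P < ⊤) : ∀ᵐ ω ∂P, series X (fun t => l * d t + k * e t) ω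
      = l ω * series X d ω + k ω * series X e ω := by
  filter_upwards [mix_ae l k d e, ae_summable_mul hX hd, ae_summable_mul hX he] with ω h1 h2 h3
  simp only [series, h1]
  rw [← tsum_mul_left, ← tsum_mul_left, ← (h2.mul_left _).tsum_add (h3.mul_left _)]
  exact tsum_congr fun t => by ring

end Series

/-! ### The conditional form, bilinear over `L^∞(ℱ_τ)`. -/

section Cond

variable {Ω : Type*} {mΩ : MeasurableSpace Ω} {P : Measure Ω} [IsProbabilityMeasure P]
  {ℱ : Filtration ℕ mΩ} {τ θ : Ω → WithTop ℕ} {hτ : IsStoppingTime ℱ τ} {hθ : IsStoppingTime ℱ θ}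
  {X Y a b : Proc P}

lemma isBdd_of_mem (hX : X ∈ RInfStop P hτ hθ) : IsBdd X := by
  obtain ⟨Z, hZ, rfl⟩ := hX
  exact (proj_mem_RInf hZ).2

lemma one_ae : ∀ᵐ ω ∂P, ∀ t, (1 : Proc P) t ω = 1 :=
  ae_all_iff.2 fun _ => AEEqFun.coeFn_one

lemma isBdd_one : IsBdd (1 : Proc P) :=
  ⟨1, fun t => by filter_upwards [one_ae (P := P)] with ω h; rw [h t, abs_one]⟩

variable (hτ) in
-- The increments vanish outside `[τ, θ]`, so the indicator in the definition can be dropped and the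
-- form is the conditional expectation of the full series.
lemma condPairing_ae (ha : ∀ᵐ ω ∂P, ∀ t : ℕ, ¬ (τ ω ≤ t ∧ t ≤ θ ω) → incr a t ω = 0) (X : Proc P) :
    condPairing hτ θ X a =ᵐ[P] P[series X (incr a) | hτ.measurableSpace] := by
  refine (AEEqFun.coeFn_mk _ _).trans (condExp_congr_ae ?_)
  filter_upwards [ha] with ω h
  refine tsum_congr fun t => ?_
  by_cases ht : τ ω ≤ t ∧ t ≤ θ ω
  · exact Set.indicator_of_mem (s := {ω | τ ω ≤ t ∧ t ≤ θ ω}) ht _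
  · rw [h t ht, mul_zero]
    exact Set.indicator_of_notMem (s := {ω | τ ω ≤ t ∧ t ≤ θ ω}) ht _

lemma aestronglyMeasurable_condPairing (X a : Proc P) :
    AEStronglyMeasurable[hτ.measurableSpace] (condPairing hτ θ X a) P :=
  ⟨_, stronglyMeasurable_condExp, AEEqFun.coeFn_mk _ _⟩

/-- Bounded `ℱ_τ`-measurable factors can be pulled out of the conditional expectation. Additivity
and homogeneity are the special cases with coefficients 1 and 0. -/
lemma condPairing_mix_left (ha : IsDensity ℱ τ θ (incr a)) (hX : IsBdd X) (hY : IsBdd Y)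
    {l k : Ω →ₘ[P] ℝ} (hl : l ∈ LInf P hτ) (hk : k ∈ LInf P hτ) :
    ∀ᵐ ω ∂P, condPairing hτ θ (fun t => l * X t + k * Y t) a ω
      = l ω * condPairing hτ θ X a ω + k ω * condPairing hτ θ Y a ω := by
  have hiX := integrable_series hX ha.lintegral
  have hiY := integrable_series hY ha.lintegral
  obtain ⟨hlm, cl, hcl⟩ := hl
  obtain ⟨hkm, ck, hck⟩ := hk
  have h1 := condExp_stronglyMeasurable_mul_of_bound₀ hτ.measurableSpace_le hlm hiX cl hcl
  have h2 := condExp_stronglyMeasurable_mul_of_bound₀ hτ.measurableSpace_le hkm hiY ck hck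
  have h3 : P[series (fun t => l * X t + k * Y t) (incr a) | hτ.measurableSpace] =ᵐ[P]
      P[(l * series X (incr a) : Ω → ℝ) + (k * series Y (incr a) : Ω → ℝ)
        | hτ.measurableSpace] :=
    condExp_congr_ae (series_mix_left l k hX hY ha.lintegral)
  have h4 := condExp_add (m := hτ.measurableSpace) (hiX.bdd_mul l.aestronglyMeasurable hcl)
    (hiY.bdd_mul k.aestronglyMeasurable hck)
  filter_upwards [h1, h2, h3, h4, condPairing_ae hτ ha.support X, condPairing_ae hτ ha.support Y,
    condPairing_ae hτ ha.support fun t => l * X t + k * Y t] with ω h1 h2 h3 h4 h5 h6 h7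
  rw [h7, h3, h5, h6]
  refine h4.trans ?_
  rw [Pi.add_apply]
  exact congrArg₂ (· + ·) h1 h2

lemma incr_mix (l k : Ω →ₘ[P] ℝ) (a b : Proc P) :
    incr (fun t => l * a t + k * b t) = fun t => l * incr a t + k * incr b t := by
  funext t
  cases t with
  | zero => rfl
  | succ t =>
    simp only [incr, sub_eq_add_neg, CondUtility.mul_add, CondUtility.mul_neg, neg_add]
    abel

lemma condPairing_mix_right (ha : IsDensity ℱ τ θ (incr a)) (hb : IsDensity ℱ τ θ (incr b))
    (hX : IsBdd X) {l k : Ω →ₘ[P] ℝ} (hl : l ∈ LInf P hτ) (hk : k ∈ LInf P hτ) :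
    ∀ᵐ ω ∂P, condPairing hτ θ X (fun t => l * a t + k * b t) ω
      = l ω * condPairing hτ θ X a ω + k ω * condPairing hτ θ X b ω := by
  have hia := integrable_series hX ha.lintegral
  have hib := integrable_series hX hb.lintegral
  obtain ⟨hlm, cl, hcl⟩ := hl
  obtain ⟨hkm, ck, hck⟩ := hk
  have hs : ∀ᵐ ω ∂P, ∀ t : ℕ, ¬ (τ ω ≤ t ∧ t ≤ θ ω) →
      incr (fun t => l * a t + k * b t) t ω = 0 := by
    filter_upwards [mix_ae l k (incr a) (incr b), ha.support, hb.support] with ω h1 h2 h3 t ht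
    rw [incr_mix, h1, h2 t ht, h3 t ht, mul_zero, mul_zero, add_zero]
  have h1 := condExp_stronglyMeasurable_mul_of_bound₀ hτ.measurableSpace_le hlm hia cl hcl
  have h2 := condExp_stronglyMeasurable_mul_of_bound₀ hτ.measurableSpace_le hkm hib ck hck
  have h3 : P[series X (fun t => l * incr a t + k * incr b t) | hτ.measurableSpace] =ᵐ[P]
      P[(l * series X (incr a) : Ω → ℝ) + (k * series X (incr b) : Ω → ℝ)
        | hτ.measurableSpace] :=
    condExp_congr_ae (series_mix_right l k hX ha.lintegral hb.lintegral)
  have h4 := condExp_add (m := hτ.measurableSpace) (hia.bdd_mul l.aestronglyMeasurable hcl)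
    (hib.bdd_mul k.aestronglyMeasurable hck)
  have h7 := condPairing_ae hτ hs X
  rw [incr_mix] at h7
  filter_upwards [h1, h2, h3, h4, condPairing_ae hτ ha.support X, condPairing_ae hτ hb.support X,
    h7] with ω h1 h2 h3 h4 h5 h6 h7
  rw [h7, h3, h5, h6]
  refine h4.trans ?_
  rw [Pi.add_apply]
  exact congrArg₂ (· + ·) h1 h2

lemma condPairing_mono (ha : IsDensity ℱ τ θ (incr a)) (hX : IsBdd X) (hY : IsBdd Y)
    (h : ∀ᵐ ω ∂P, ∀ t : ℕ, τ ω ≤ t → X t ω ≤ Y t ω) :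
    ∀ᵐ ω ∂P, condPairing hτ θ X a ω ≤ condPairing hτ θ Y a ω := by
  have h1 : series X (incr a) ≤ᵐ[P] series Y (incr a) := by
    filter_upwards [h, ha.nonneg, ha.support, ae_summable_mul hX ha.lintegral,
      ae_summable_mul hY ha.lintegral] with ω h1 h2 h3 h4 h5
    refine h4.tsum_le_tsum (fun t => ?_) h5
    by_cases ht : τ ω ≤ t
    · exact mul_le_mul_of_nonneg_right (h1 t ht) (h2 t)
    · rw [h3 t fun h => ht h.1, mul_zero, mul_zero]
  filter_upwards [condPairing_ae hτ ha.support X, condPairing_ae hτ ha.support Y,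
    condExp_mono (m := hτ.measurableSpace) (integrable_series hX ha.lintegral)
      (integrable_series hY ha.lintegral) h1] with ω h1 h2 h3
  rwa [h1, h2]

lemma const_mem_LInf (c : ℝ) : AEEqFun.const Ω c ∈ LInf P hτ := by
  refine ⟨⟨fun _ => c, stronglyMeasurable_const, AEEqFun.coeFn_const Ω c⟩, |c|, ?_⟩
  filter_upwards [AEEqFun.coeFn_const (μ := P) Ω c] with ω h
  rw [h]
  rfl

lemma one_mem_LInf : 1 ∈ LInf P hτ := const_mem_LInf 1

lemma zero_mem_LInf : 0 ∈ LInf P hτ := const_mem_LInf 0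

lemma mix_one_one (X Y : Proc P) : (fun t => 1 * X t + 1 * Y t) = X + Y := by
  funext t
  simp

lemma mix_zero (l : Ω →ₘ[P] ℝ) (X : Proc P) : (fun t => l * X t + 0 * X t) = fun t => l * X t := by
  simp only [CondUtility.zero_mul, add_zero]

lemma condPairing_add (ha : IsDensity ℱ τ θ (incr a)) (hX : IsBdd X) (hY : IsBdd Y) :
    ∀ᵐ ω ∂P, condPairing hτ θ (X + Y) a ω
      = condPairing hτ θ X a ω + condPairing hτ θ Y a ω := by
  filter_upwards [condPairing_mix_left ha hX hY (one_mem_LInf (hτ := hτ)) one_mem_LInf,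
    AEEqFun.coeFn_one (β := ℝ) (μ := P)] with ω h1 h2
  rw [mix_one_one, h2] at h1
  simpa using h1

lemma condPairing_mul (ha : IsDensity ℱ τ θ (incr a)) (hX : IsBdd X)
    {l : Ω →ₘ[P] ℝ} (hl : l ∈ LInf P hτ) :
    ∀ᵐ ω ∂P, condPairing hτ θ (fun t => l * X t) a ω = l ω * condPairing hτ θ X a ω := by
  filter_upwards [condPairing_mix_left ha hX hX hl (zero_mem_LInf (hτ := hτ)),
    AEEqFun.coeFn_zero (β := ℝ) (μ := P)] with ω h1 h2
  rw [mix_zero, h2] at h1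
  simpa using h1

lemma cash_ae (m : Ω →ₘ[P] ℝ) : ∀ᵐ ω ∂P, ∀ t : ℕ, (τ ω ≤ t → cash hτ m t ω = m ω) ∧
    (¬ τ ω ≤ t → cash hτ m t ω = 0) := by
  refine ae_all_iff.2 fun t => ?_
  filter_upwards [ind_ae (P := P) (ℱ.le t _ (hτ t)),
    AEEqFun.coeFn_mul (ind P (ℱ.le t _ (hτ t))) m] with ω h1 h2
  have h2' : cash hτ m t ω = _ := h2
  rw [h2', Pi.mul_apply, h1]
  refine ⟨fun h => ?_, fun h => ?_⟩
  · refine (congrArg (· * m ω) (Set.indicator_of_mem ?_ _)).trans (one_mul _)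
    exact h
  · refine (congrArg (· * m ω) (Set.indicator_of_notMem ?_ _)).trans (zero_mul _)
    exact h

lemma isBdd_cash {m : Ω →ₘ[P] ℝ} (hm : m ∈ LInf P hτ) : IsBdd (cash hτ m) := by
  obtain ⟨-, c, hc⟩ := hm
  refine ⟨c, fun t => ?_⟩
  filter_upwards [cash_ae (hτ := hτ) m, hc] with ω h1 h2
  by_cases ht : τ ω ≤ t
  · rwa [(h1 t).1 ht]
  · rw [(h1 t).2 ht, abs_zero]
    exact (abs_nonneg _).trans h2

lemma isBdd_mul {l : Ω →ₘ[P] ℝ} (hl : l ∈ LInf P hτ) (hX : IsBdd X) :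
    IsBdd fun t => l * X t := by
  obtain ⟨-, c, hc⟩ := hl
  obtain ⟨b, hb⟩ := hX
  refine ⟨c * b, fun t => ?_⟩
  filter_upwards [hc, hb t, mul_ae l X] with ω h1 h2 h3
  rw [h3, abs_mul]
  exact mul_le_mul h1 h2 (abs_nonneg _) ((abs_nonneg _).trans h1)

lemma condPairing_one_mul (ha : a ∈ DStop P hτ hθ) (ha' : IsDensity ℱ τ θ (incr a))
    {m : Ω →ₘ[P] ℝ} (hm : m ∈ LInf P hτ) :
    ∀ᵐ ω ∂P, condPairing hτ θ (fun t => m * (1 : Proc P) t) a ω = m ω := by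
  filter_upwards [condPairing_mul ha' isBdd_one hm, AEEqFun.coeFn_one (β := ℝ) (μ := P)]
    with ω h1 h2
  rw [h1, ha.2, h2]
  simp

/-- From `τ` on, `m 1_{[τ,∞)}` coincides with the constant process `m`, whose form is `m ⟨1, a⟩ =
m`. Monotonicity ignores times before `τ`, so applying it both ways identifies the two forms. -/
lemma condPairing_cash (ha : a ∈ DStop P hτ hθ) (ha' : IsDensity ℱ τ θ (incr a))
    {m : Ω →ₘ[P] ℝ} (hm : m ∈ LInf P hτ) :
    ∀ᵐ ω ∂P, condPairing hτ θ (cash hτ m) a ω = m ω := by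
  have h : ∀ᵐ ω ∂P, ∀ t : ℕ, τ ω ≤ t → cash hτ m t ω = (m * (1 : Proc P) t) ω := by
    filter_upwards [cash_ae (hτ := hτ) m, mul_ae m (1 : Proc P), one_ae (P := P)]
      with ω h1 h2 h3 t ht
    rw [(h1 t).1 ht, h2, h3, mul_one]
  have hb := isBdd_mul hm isBdd_one
  filter_upwards [condPairing_mono (hτ := hτ) ha' (isBdd_cash hm) hb
      (h.mono fun ω h t ht => (h t ht).le),
    condPairing_mono (hτ := hτ) ha' hb (isBdd_cash hm) (h.mono fun ω h t ht => (h t ht).ge),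
    condPairing_one_mul ha ha' hm] with ω h1 h2 h3
  linarith

/-- From `τ` on, `X` lies between the cash processes of `-c` and `c`, whose forms are known. -/
lemma abs_condPairing_le (ha : a ∈ DStop P hτ hθ) (ha' : IsDensity ℱ τ θ (incr a)) {c : ℝ}
    (hX : ∀ t, ∀ᵐ ω ∂P, |X t ω| ≤ c) : ∀ᵐ ω ∂P, |condPairing hτ θ X a ω| ≤ c := by
  have key : ∀ r : ℝ, ∀ᵐ ω ∂P, condPairing hτ θ (cash hτ (AEEqFun.const Ω r)) a ω = r := by
    intro r
    filter_upwards [condPairing_cash ha ha' (const_mem_LInf r),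
      AEEqFun.coeFn_const (μ := P) Ω r] with ω h1 h2
    rw [h1, h2]
    rfl
  have hc : ∀ r : ℝ, ∀ᵐ ω ∂P, ∀ t : ℕ, τ ω ≤ t →
      cash hτ (AEEqFun.const (μ := P) Ω r) t ω = r := by
    intro r
    filter_upwards [cash_ae (hτ := hτ) (AEEqFun.const (μ := P) Ω r),
      AEEqFun.coeFn_const (μ := P) Ω r] with ω h1 h2 t ht
    rw [(h1 t).1 ht, h2]
    rfl
  have hX' := ae_all_iff.2 hX
  filter_upwards [key c, key (-c), condPairing_mono (hτ := hτ) ha' ⟨c, hX⟩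
      (isBdd_cash (const_mem_LInf c))
      (by filter_upwards [hc c, hX'] with ω h1 h2 t ht; rw [h1 t ht]; exact (abs_le.1 (h2 t)).2),
    condPairing_mono (hτ := hτ) ha' (isBdd_cash (const_mem_LInf (-c))) ⟨c, hX⟩
      (by filter_upwards [hc (-c), hX'] with ω h1 h2 t ht; rw [h1 t ht]; exact (abs_le.1 (h2 t)).1)]
    with ω h1 h2 h3 h4
  rw [h1] at h3
  rw [h2] at h4
  exact abs_le.2 ⟨h4, h3⟩

lemma condPairing_mem_LInf (ha : a ∈ DStop P hτ hθ) (ha' : IsDensity ℱ τ θ (incr a))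
    (hX : IsBdd X) : condPairing hτ θ X a ∈ LInf P hτ :=
  ⟨aestronglyMeasurable_condPairing X a, hX.imp fun _ hc => abs_condPairing_le ha ha' hc⟩

/-- `E[u ⟨X, a⟩_{τ,θ}] = E[u ∑ X_t Δ a_t]` for `ℱ_τ`-measurable `u`. -/
lemma integral_mul_condPairing (ha : IsDensity ℱ τ θ (incr a)) (hX : IsBdd X) {u : Ω → ℝ}
    (hu : AEStronglyMeasurable[hτ.measurableSpace] u P)
    (hi : Integrable (fun ω => u ω * series X (incr a) ω) P) :
    ∫ ω, u ω * condPairing hτ θ X a ω ∂P = ∫ ω, u ω * series X (incr a) ω ∂P := by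
  rw [← integral_condExp hτ.measurableSpace_le (f := fun ω => u ω * series X (incr a) ω)]
  refine integral_congr_ae ?_
  filter_upwards [condExp_mul_of_aestronglyMeasurable_left hu hi
    (integrable_series hX ha.lintegral), condPairing_ae hτ ha.support X] with ω h1 h2
  rw [h2]
  exact h1.symm

lemma ind_mem_LInf {A : Set Ω} (hA : MeasurableSet[hτ.measurableSpace] A)
    (hA' : MeasurableSet A) : ind P hA' ∈ LInf P hτ := by
  refine ⟨⟨A.indicator fun _ => 1, stronglyMeasurable_const.indicator hA, ind_ae hA'⟩, 1, ?_⟩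
  filter_upwards [ind_ae (P := P) hA'] with ω h
  rw [h]
  by_cases hω : ω ∈ A <;> simp [hω]

lemma sub_mem_LInf {l k : Ω →ₘ[P] ℝ} (hl : l ∈ LInf P hτ) (hk : k ∈ LInf P hτ) :
    l - k ∈ LInf P hτ := by
  obtain ⟨h1, c, hc⟩ := hl
  obtain ⟨h2, b, hb⟩ := hk
  refine ⟨(h1.sub h2).congr (AEEqFun.coeFn_sub l k).symm, c + b, ?_⟩
  filter_upwards [hc, hb, AEEqFun.coeFn_sub l k] with ω h1 h2 h3
  rw [h3, Pi.sub_apply]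
  exact (abs_sub _ _).trans (add_le_add h1 h2)

lemma neg_mem_LInf {l : Ω →ₘ[P] ℝ} (hl : l ∈ LInf P hτ) : -l ∈ LInf P hτ := by
  have := sub_mem_LInf zero_mem_LInf hl
  rwa [zero_sub] at this

/-- On `{τ ≤ t}` an `ℱ_τ`-measurable function is `ℱ_t`-measurable. -/
lemma aestronglyMeasurable_indicator_le {f : Ω → ℝ}
    (hf : AEStronglyMeasurable[hτ.measurableSpace] f P) (t : ℕ) :
    AEStronglyMeasurable[ℱ t] ({ω | τ ω ≤ t}.indicator f) P := by
  obtain ⟨g, hg, hfg⟩ := hf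
  refine ⟨{ω | τ ω ≤ t}.indicator g, ?_, ?_⟩
  · suffices Measurable[ℱ t] ({ω | τ ω ≤ t}.indicator g) from this.stronglyMeasurable
    intro s hs
    have h1 : MeasurableSet[ℱ t] (g ⁻¹' s ∩ {ω | τ ω ≤ t}) := (hg.measurable hs).2 t
    rw [Set.indicator_preimage]
    have h2 : ({ω | τ ω ≤ t} : Set Ω).ite (g ⁻¹' s) (0 ⁻¹' s)
        = g ⁻¹' s ∩ {ω | τ ω ≤ t} ∪ ((0 : Ω → ℝ) ⁻¹' s) \ {ω | τ ω ≤ t} := rfl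
    rw [h2]
    refine h1.union (MeasurableSet.diff ?_ (hτ t))
    exact @measurable_const _ _ _ (ℱ t) (0 : ℝ) s hs
  · exact hfg.indicator

/-- `l` is known only at time `τ`. Since `X` vanishes before `τ`, only the part of `l` on `{τ ≤ t}`
enters at time `t`, and that part is `ℱ_t`-measurable. -/
lemma isAdapted_mul {l : Ω →ₘ[P] ℝ} (hl : AEStronglyMeasurable[hτ.measurableSpace] l P)
    (hX : IsAdapted ℱ X) (hX0 : ∀ᵐ ω ∂P, ∀ t : ℕ, ¬ τ ω ≤ t → X t ω = 0) :
    IsAdapted ℱ fun t => l * X t := by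
  intro t
  refine ((aestronglyMeasurable_indicator_le hl t).mul (hX t)).congr ?_
  filter_upwards [mul_ae l X, hX0] with ω h1 h2
  rw [h1, Pi.mul_apply]
  by_cases ht : τ ω ≤ t
  · rw [Set.indicator_of_mem (s := {ω | τ ω ≤ t}) ht]
  · rw [h2 t ht, mul_zero, mul_zero]

lemma mix_mem_RInfStop (hτθ : ∀ᵐ ω ∂P, τ ω ≤ θ ω) {l k : Ω →ₘ[P] ℝ} (hl : l ∈ LInf P hτ)
    (hk : k ∈ LInf P hτ) (hX : X ∈ RInfStop P hτ hθ) (hY : Y ∈ RInfStop P hτ hθ) :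
    (fun t => l * X t + k * Y t) ∈ RInfStop P hτ hθ := by
  rw [mem_RInfStop_iff hτθ] at hX hY ⊢
  obtain ⟨⟨hX1, hX2⟩, hX3⟩ := hX
  obtain ⟨⟨hY1, hY2⟩, hY3⟩ := hY
  obtain ⟨c, hc⟩ := isBdd_mul hl hX2
  obtain ⟨b, hb⟩ := isBdd_mul hk hY2
  refine ⟨⟨fun t => ?_, c + b, fun t => ?_⟩, ?_⟩
  · exact ((isAdapted_mul hl.1 hX1 (hX3.mono fun ω h t => (h t).1) t).add
      (isAdapted_mul hk.1 hY1 (hY3.mono fun ω h t => (h t).1) t)).congr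
        (AEEqFun.coeFn_add (l * X t) (k * Y t)).symm
  · filter_upwards [hc t, hb t, AEEqFun.coeFn_add (l * X t) (k * Y t)] with ω h1 h2 h3
    rw [h3, Pi.add_apply]
    exact (abs_add_le _ _).trans (add_le_add h1 h2)
  · filter_upwards [hX3, hY3, mix_ae l k X Y] with ω h1 h2 h3 t
    refine ⟨fun ht => ?_, fun ht => ?_⟩
    · rw [h3, (h1 t).1 ht, (h2 t).1 ht, mul_zero, mul_zero, add_zero]
    · rw [h3, h3, (h1 t).2 ht, (h2 t).2 ht]

lemma add_mem_RInfStop (hτθ : ∀ᵐ ω ∂P, τ ω ≤ θ ω) (hX : X ∈ RInfStop P hτ hθ)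
    (hY : Y ∈ RInfStop P hτ hθ) : X + Y ∈ RInfStop P hτ hθ := by
  have := mix_mem_RInfStop hτθ one_mem_LInf one_mem_LInf hX hY
  rwa [mix_one_one] at this

lemma mul_mem_RInfStop (hτθ : ∀ᵐ ω ∂P, τ ω ≤ θ ω) {l : Ω →ₘ[P] ℝ} (hl : l ∈ LInf P hτ)
    (hX : X ∈ RInfStop P hτ hθ) : (fun t => l * X t) ∈ RInfStop P hτ hθ := by
  have := mix_mem_RInfStop hτθ hl zero_mem_LInf hX hX
  rwa [mix_zero] at this

lemma cash_mem_RInfStop (hτθ : ∀ᵐ ω ∂P, τ ω ≤ θ ω) {m : Ω →ₘ[P] ℝ} (hm : m ∈ LInf P hτ) :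
    cash hτ m ∈ RInfStop P hτ hθ := by
  rw [mem_RInfStop_iff hτθ]
  refine ⟨⟨fun t => ?_, isBdd_cash hm⟩, ?_⟩
  · refine (aestronglyMeasurable_indicator_le hm.1 t).congr ?_
    filter_upwards [cash_ae (hτ := hτ) m] with ω h
    by_cases ht : τ ω ≤ t
    · rw [(h t).1 ht, Set.indicator_of_mem (s := {ω | τ ω ≤ t}) ht]
    · rw [(h t).2 ht, Set.indicator_of_notMem (s := {ω | τ ω ≤ t}) ht]
  · filter_upwards [cash_ae (hτ := hτ) m, hτθ] with ω h h2 t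
    refine ⟨(h t).2, fun ht => ?_⟩
    have h3 := h2.trans ht
    rw [(h t).1 h3, (h (t + 1)).1 (h3.trans (by exact_mod_cast t.le_succ))]

lemma cash_zero : cash hτ (0 : Ω →ₘ[P] ℝ) = 0 :=
  funext fun _ => CondUtility.mul_zero _

lemma zero_mem_RInfStop (hτθ : ∀ᵐ ω ∂P, τ ω ≤ θ ω) : (0 : Proc P) ∈ RInfStop P hτ hθ := by
  have := cash_mem_RInfStop (hθ := hθ) hτθ (zero_mem_LInf (hτ := hτ) (P := P))
  rwa [cash_zero] at this

end Cond

/-! ### Adapted parts of integrable families, and continuous functionals. -/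

section Adapted

variable {Ω : Type*} {mΩ : MeasurableSpace Ω} {P : Measure Ω} [IsProbabilityMeasure P]
  {ℱ : Filtration ℕ mΩ}

/-- The adapted process of the conditional expectations `E[G_t | ℱ_t]`. -/
def adaptedPart (P : Measure Ω) (ℱ : Filtration ℕ mΩ) (G : ℕ → Ω → ℝ) : Proc P := fun t =>
  AEEqFun.mk (P[G t | ℱ t]) (stronglyMeasurable_condExp.mono (ℱ.le t)).aestronglyMeasurable

lemma adaptedPart_ae (G : ℕ → Ω → ℝ) :
    ∀ᵐ ω ∂P, ∀ t, adaptedPart P ℱ G t ω = (P[G t | ℱ t]) ω :=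
  ae_all_iff.2 fun _ => AEEqFun.coeFn_mk _ _

lemma isAdapted_adaptedPart (G : ℕ → Ω → ℝ) : IsAdapted ℱ (adaptedPart P ℱ G) :=
  fun _ => ⟨_, stronglyMeasurable_condExp, AEEqFun.coeFn_mk _ _⟩

lemma lintegral_adaptedPart_lt_top {G : ℕ → Ω → ℝ} (hG : ∀ t, AEStronglyMeasurable (G t) P)
    (h : ∫⁻ ω, ∑' t, ‖G t ω‖ₑ ∂P < ⊤) : ∫⁻ ω, ∑' t, ‖adaptedPart P ℱ G t ω‖ₑ ∂P < ⊤ := by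
  refine lt_of_le_of_lt ?_ h
  rw [lintegral_tsum fun t => (adaptedPart P ℱ G t).aestronglyMeasurable.enorm,
    lintegral_tsum fun t => (hG t).enorm]
  refine ENNReal.tsum_le_tsum fun t => ?_
  have := eLpNorm_condExp_le_eLpNorm (μ := P) (m := ℱ t) (G t) le_rfl
  rw [eLpNorm_one_eq_lintegral_enorm, eLpNorm_one_eq_lintegral_enorm] at this
  refine le_trans (le_of_eq (lintegral_congr_ae ?_)) this
  filter_upwards [adaptedPart_ae (P := P) (ℱ := ℱ) G] with ω h
  rw [h]

/-- `X t` can be moved inside the conditional expectation given `ℱ_t`. Adapted processes therefore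
do not distinguish a family from its adapted part, and a separating family may be replaced by an
adapted one. -/
lemma integral_mul_adaptedPart {G : ℕ → Ω → ℝ} {X : Proc P} (hX : X ∈ RInf P ℱ) {t : ℕ}
    (hG : Integrable (G t) P) :
    ∫ ω, X t ω * adaptedPart P ℱ G t ω ∂P = ∫ ω, X t ω * G t ω ∂P := by
  obtain ⟨hX1, c, hc⟩ := hX
  rw [← integral_condExp (ℱ.le t) (f := fun ω => X t ω * G t ω)]
  refine integral_congr_ae ?_
  filter_upwards [adaptedPart_ae (P := P) (ℱ := ℱ) G,
    condExp_stronglyMeasurable_mul_of_bound₀ (ℱ.le t) (hX1 t) hG c (hc t)] with ω h1 h2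
  rw [h1]
  exact h2.symm

lemma adaptedPart_support {G : ℕ → Ω → ℝ} {E : ℕ → Set Ω} (hE : ∀ t, MeasurableSet[ℱ t] (E t))
    (hG : ∀ t, Integrable (G t) P) (h : ∀ t, ∀ ω ∉ E t, G t ω = 0) :
    ∀ᵐ ω ∂P, ∀ t, ω ∉ E t → adaptedPart P ℱ G t ω = 0 := by
  have h1 : ∀ᵐ ω ∂P, ∀ t, (P[(E t).indicator (G t) | ℱ t]) ω
      = (E t).indicator (P[G t | ℱ t]) ω :=
    ae_all_iff.2 fun t => condExp_indicator (hG t) (hE t)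
  have h2 : ∀ t, (E t).indicator (G t) = G t := fun t =>
    Set.indicator_eq_self.2 fun ω hω => by_contra fun h' => hω (h t ω h')
  filter_upwards [h1, adaptedPart_ae (P := P) (ℱ := ℱ) G] with ω h3 h4 t ht
  have := h3 t
  rw [h2] at this
  rw [h4, this, Set.indicator_of_notMem ht]

lemma ofIncr_mem_AOne {d : Proc P} (h1 : IsAdapted ℱ d) (h2 : ∫⁻ ω, ∑' t, ‖d t ω‖ₑ ∂P < ⊤) :
    ofIncr d ∈ AOne P ℱ :=
  ⟨isAdapted_ofIncr h1, by rwa [incr_ofIncr]⟩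

lemma continuous_pairing {a : Proc P} (ha : a ∈ AOne P ℱ) :
    @Continuous _ _ (sigmaTopology P ℱ) _ fun X : RInf P ℱ => pairing X.1 a := by
  refine continuous_iInf_dom (i := a) (continuous_iInf_dom (i := ha) ?_)
  exact continuous_induced_dom

lemma integral_mul_single {G : Ω → ℝ} {X : Proc P} (t : ℕ) :
    ∑' s, ∫ ω, X s ω * (if s = t then G else 0) ω ∂P = ∫ ω, X t ω * G ω ∂P := by
  rw [tsum_eq_single t]
  · simp
  · intro s hs
    simp [hs]

/-- This functional is the pairing with the process whose only increment is `E[1_C | ℱ_t]`, at time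
`t`. `C` need not belong to `ℱ_t`. -/
lemma continuous_setIntegral (t : ℕ) {C : Set Ω} (hC : MeasurableSet C) :
    @Continuous _ _ (sigmaTopology P ℱ) _ fun X : RInf P ℱ => ∫ ω in C, X.1 t ω ∂P := by
  let G : ℕ → Ω → ℝ := fun s => if s = t then C.indicator (fun _ => 1) else 0
  have hG : ∀ s, Integrable (G s) P := by
    intro s
    by_cases hs : s = t
    · simp only [G, hs, if_true]
      exact (integrable_const 1).indicator hC
    · simp only [G, hs, if_false]
      exact integrable_zero _ _ _
  have hG' : ∫⁻ ω, ∑' s, ‖G s ω‖ₑ ∂P < ⊤ := by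
    rw [lintegral_tsum fun s => (hG s).aestronglyMeasurable.enorm, tsum_eq_single t]
    · exact (hG t).2
    · intro s hs
      simp [G, hs]
  have hd := lintegral_adaptedPart_lt_top (ℱ := ℱ) (fun s => (hG s).aestronglyMeasurable) hG'
  let _ := sigmaTopology P ℱ
  have := continuous_pairing (ofIncr_mem_AOne (isAdapted_adaptedPart (P := P) (ℱ := ℱ) G) hd)
  refine this.congr fun X => ?_
  rw [pairing_ofIncr, integral_series X.2.2 hd]
  simp only [integral_mul_adaptedPart X.2 (hG _)]
  simp only [G]
  rw [integral_mul_single, ← integral_indicator hC]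
  congr 1
  funext ω
  by_cases hω : ω ∈ C <;> simp [hω]

end Adapted

/-! ### Closed sets of the topology `σ(ℛ^∞, 𝒜^1)`. -/

section Closed

variable {Ω : Type*} {mΩ : MeasurableSpace Ω} {P : Measure Ω} [IsProbabilityMeasure P]
  {ℱ : Filtration ℕ mΩ} {τ θ : Ω → WithTop ℕ} {hτ : IsStoppingTime ℱ τ} {hθ : IsStoppingTime ℱ θ}
  {X Y a b : Proc P}

lemma integrable_of_bdd (hX : IsBdd X) (t : ℕ) : Integrable (X t) P := by
  obtain ⟨c, hc⟩ := hX
  exact Integrable.of_bound (X t).aestronglyMeasurable c (hc t)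

/-- `ℛ^∞_{τ,θ}` is closed in `ℛ^∞`. -/
lemma isClosed_RInfStop (hτθ : ∀ᵐ ω ∂P, τ ω ≤ θ ω) :
    IsClosed[sigmaTopology P ℱ] {X : RInf P ℱ | X.1 ∈ RInfStop P hτ hθ} := by
  have hA : ∀ t : ℕ, MeasurableSet {ω | τ ω ≤ t}ᶜ := fun t => (ℱ.le t _ (hτ t)).compl
  have hB : ∀ t : ℕ, MeasurableSet {ω | θ ω ≤ t} := fun t => ℱ.le t _ (hθ t)
  -- Both pathwise conditions are equalities of random variables on an event. They amount to
  -- equalities of integrals over all measurable parts of the event, and these are closed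
  -- conditions.
  have heq : {X : RInf P ℱ | X.1 ∈ RInfStop P hτ hθ} =
      (⋂ (t : ℕ) (C : Set Ω) (_ : MeasurableSet C),
        {X : RInf P ℱ | ∫ ω in C ∩ {ω | τ ω ≤ t}ᶜ, X.1 t ω ∂P = 0}) ∩
      ⋂ (t : ℕ) (C : Set Ω) (_ : MeasurableSet C),
        {X : RInf P ℱ | ∫ ω in C ∩ {ω | θ ω ≤ t}, X.1 (t + 1) ω ∂P
          = ∫ ω in C ∩ {ω | θ ω ≤ t}, X.1 t ω ∂P} := by
    ext X
    simp only [Set.mem_inter_iff, Set.mem_iInter, Set.mem_ofPred_eq, mem_RInfStop_iff hτθ, X.2,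
      true_and]
    constructor
    · intro h
      refine ⟨fun t C hC => ?_, fun t C hC => ?_⟩
      · refine setIntegral_eq_zero_of_ae_eq_zero ?_
        filter_upwards [h] with ω h1 h2 using (h1 t).1 h2.2
      · refine setIntegral_congr_ae (hC.inter (hB t)) ?_
        filter_upwards [h] with ω h1 h2 using (h1 t).2 h2.2
    · rintro ⟨h1, h2⟩
      have hi := integrable_of_bdd X.2.2
      refine ae_all_iff.2 fun t => ?_
      have k1 : {ω | τ ω ≤ t}ᶜ.indicator (X.1 t) =ᵐ[P] 0 := by
        refine ((hi t).indicator (hA t)).ae_eq_zero_of_forall_setIntegral_eq_zero fun C hC _ => ?_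
        rw [setIntegral_indicator (hA t)]
        exact h1 t C hC
      have k2 : {ω | θ ω ≤ t}.indicator (X.1 (t + 1)) =ᵐ[P] {ω | θ ω ≤ t}.indicator (X.1 t) := by
        refine ((hi (t + 1)).indicator (hB t)).ae_eq_of_forall_setIntegral_eq _ _
          ((hi t).indicator (hB t)) fun C hC _ => ?_
        rw [setIntegral_indicator (hB t), setIntegral_indicator (hB t)]
        exact h2 t C hC
      filter_upwards [k1, k2] with ω h3 h4
      refine ⟨fun ht => ?_, fun ht => ?_⟩
      · rwa [Set.indicator_of_mem (s := {ω | τ ω ≤ t}ᶜ) ht] at h3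
      · rwa [Set.indicator_of_mem (s := {ω | θ ω ≤ t}) ht,
          Set.indicator_of_mem (s := {ω | θ ω ≤ t}) ht] at h4
  rw [heq]
  let _ := sigmaTopology P ℱ
  refine IsClosed.inter ?_ ?_
  · exact isClosed_iInter fun t => isClosed_iInter fun C => isClosed_iInter fun hC =>
      isClosed_eq (continuous_setIntegral t (hC.inter (hA t))) continuous_const
  · exact isClosed_iInter fun t => isClosed_iInter fun C => isClosed_iInter fun hC =>
      isClosed_eq (continuous_setIntegral _ (hC.inter (hB t)))
        (continuous_setIntegral _ (hC.inter (hB t)))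

lemma setIntegral_condPairing (ha : IsDensity ℱ τ θ (incr a)) (hX : IsBdd X) {A : Set Ω}
    (hA : MeasurableSet[hτ.measurableSpace] A) :
    ∫ ω in A, condPairing hτ θ X a ω ∂P = ∫ ω in A, series X (incr a) ω ∂P := by
  rw [← setIntegral_condExp hτ.measurableSpace_le (integrable_series hX ha.lintegral) hA]
  refine setIntegral_congr_ae (hτ.measurableSpace_le _ hA) ?_
  filter_upwards [condPairing_ae hτ ha.support X] with ω h _ using h

/-- For `A ∈ ℱ_τ` the increments `1_A Δ a` are still adapted, because `Δ a` vanishes before `τ`. The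
functional is thus one of the pairings that define the topology. -/
lemma continuous_setIntegral_condPairing (ha : IsDensity ℱ τ θ (incr a)) {A : Set Ω}
    (hA : MeasurableSet[hτ.measurableSpace] A) : @Continuous _ _ (sigmaTopology P ℱ) _
      fun X : RInf P ℱ => ∫ ω in A, condPairing hτ θ X.1 a ω ∂P := by
  have hA' := hτ.measurableSpace_le _ hA
  let d : Proc P := fun t => ind P hA' * incr a t
  have hd : ∀ᵐ ω ∂P, ∀ t, d t ω = A.indicator (fun ω => incr a t ω) ω := by
    filter_upwards [mul_ae (ind P hA') (incr a), ind_ae (P := P) hA'] with ω h1 h2 t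
    have h3 : d t ω = _ := h1 t
    rw [h3, h2]
    by_cases hω : ω ∈ A <;> simp [hω]
  have h1 : IsAdapted ℱ d := isAdapted_mul (hτ := hτ) (ind_mem_LInf hA hA').1 ha.adapted (by
    filter_upwards [ha.support] with ω h t ht using h t fun h' => ht h'.1)
  have h2 : ∫⁻ ω, ∑' t, ‖d t ω‖ₑ ∂P < ⊤ := by
    refine lt_of_le_of_lt (lintegral_mono_ae ?_) ha.lintegral
    filter_upwards [hd] with ω h
    refine ENNReal.tsum_le_tsum fun t => ?_
    rw [h]
    by_cases hω : ω ∈ A <;> simp [hω]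
  let _ := sigmaTopology P ℱ
  refine (continuous_pairing (ofIncr_mem_AOne h1 h2)).congr fun X => ?_
  rw [pairing_ofIncr, setIntegral_condPairing ha X.2.2 hA, ← integral_indicator hA']
  refine integral_congr_ae ?_
  filter_upwards [hd] with ω h
  by_cases hω : ω ∈ A <;> simp [hω, series, h]

/-- If `γ` does not depend on `X`, the processes `X` with `γ ≤ ⟨X, a⟩_{τ,θ}` form a closed set. -/
lemma isClosed_le_condPairing (ha : IsDensity ℱ τ θ (incr a)) {γ : Ω →ₘ[P] EReal}
    (hγ : AEStronglyMeasurable[hτ.measurableSpace] γ P) :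
    IsClosed[sigmaTopology P ℱ]
      {X : RInf P ℱ | ∀ᵐ ω ∂P, γ ω ≤ ((condPairing hτ θ X.1 a ω : ℝ) : EReal)} := by
  -- `γ` may be infinite and need not be integrable, so it enters only through rational levels `q`
  -- and events of `ℱ_τ` on which `q ≤ γ`.
  have heq : {X : RInf P ℱ | ∀ᵐ ω ∂P, γ ω ≤ ((condPairing hτ θ X.1 a ω : ℝ) : EReal)} =
      ⋂ (A : Set Ω) (_ : MeasurableSet[hτ.measurableSpace] A) (q : ℚ)
        (_ : ∀ᵐ ω ∂P, ω ∈ A → ((q : ℝ) : EReal) ≤ γ ω),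
        {X : RInf P ℱ | ∫ _ in A, (q : ℝ) ∂P ≤ ∫ ω in A, condPairing hτ θ X.1 a ω ∂P} := by
    ext X
    have hi : Integrable (condPairing hτ θ X.1 a) P :=
      (integrable_condExp (m := hτ.measurableSpace) (f := series X.1 (incr a))).congr
        (condPairing_ae hτ ha.support X.1).symm
    simp only [Set.mem_iInter, Set.mem_ofPred_eq]
    constructor
    · intro h A hA q hq
      refine setIntegral_mono_on_ae (integrable_const _).integrableOn hi.integrableOn
        (hτ.measurableSpace_le _ hA) ?_
      filter_upwards [h, hq] with ω h1 h2 h3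
      exact EReal.coe_le_coe_iff.1 ((h2 h3).trans h1)
    · intro h
      obtain ⟨g, hg, hγg⟩ := hγ
      obtain ⟨f, hf, hXf⟩ := aestronglyMeasurable_condPairing (hτ := hτ) (θ := θ) X.1 a
      -- A violation of the inequality lies in one of the countably many events `{⟨X, a⟩ < q ≤ γ}`;
      -- testing with these events shows that each is null.
      have hA : ∀ q : ℚ, MeasurableSet[hτ.measurableSpace]
          ({ω | f ω < q} ∩ {ω | ((q : ℝ) : EReal) ≤ g ω}) := fun q =>
        MeasurableSet.inter (hf.measurable measurableSet_Iio) (hg.measurable measurableSet_Ici)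
      have hzero : ∀ q : ℚ, ∀ᵐ ω ∂P, ¬ (f ω < q ∧ ((q : ℝ) : EReal) ≤ g ω) := by
        intro q
        have hA' := hτ.measurableSpace_le _ (hA q)
        have h1 := h _ (hA q) q (by
          filter_upwards [hγg] with ω h1 h2
          rw [h1]
          exact h2.2)
        have h2 : ∫ ω in {ω | f ω < q} ∩ {ω | ((q : ℝ) : EReal) ≤ g ω},
            ((q : ℝ) - condPairing hτ θ X.1 a ω) ∂P ≤ 0 := by
          rw [integral_sub (integrable_const _).integrableOn hi.integrableOn]
          linarith
        have hpos : ∀ᵐ ω ∂P, ω ∈ {ω | f ω < q} ∩ {ω | ((q : ℝ) : EReal) ≤ g ω} →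
            0 < (q : ℝ) - condPairing hτ θ X.1 a ω := by
          filter_upwards [hXf] with ω h3 h4
          rw [h3, sub_pos]
          exact h4.1
        have hnn : 0 ≤ᵐ[P.restrict ({ω | f ω < q} ∩ {ω | ((q : ℝ) : EReal) ≤ g ω})]
            fun ω => (q : ℝ) - condPairing hτ θ X.1 a ω := by
          rw [EventuallyLE, ae_restrict_iff' hA']
          filter_upwards [hpos] with ω h3 h4 using (h3 h4).le
        have h3 := (setIntegral_eq_zero_iff_of_nonneg_ae hnn
          ((integrable_const _).sub hi).integrableOn).1
          (le_antisymm h2 (integral_nonneg_of_ae hnn))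
        rw [EventuallyEq, ae_restrict_iff' hA'] at h3
        filter_upwards [h3, hpos] with ω h4 h5 h6
        have h7 := h5 h6
        rw [h4 h6] at h7
        exact lt_irrefl _ h7
      filter_upwards [ae_all_iff.2 hzero, hγg, hXf] with ω h1 h2 h3
      rw [h2, h3]
      by_contra! hlt
      obtain ⟨q, hq1, hq2⟩ := EReal.exists_rat_btwn_of_lt hlt
      exact h1 q ⟨EReal.coe_lt_coe_iff.1 hq1, hq2.le⟩
  rw [heq]
  let _ := sigmaTopology P ℱ
  exact isClosed_iInter fun A => isClosed_iInter fun hA => isClosed_iInter fun q =>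
    isClosed_iInter fun _ => isClosed_le continuous_const
      (continuous_setIntegral_condPairing ha hA)

end Closed

/-- Real `x` and `y` make this valid for infinite `g` as well, since `y - ⊥ = ⊤` and `y - ⊤ = ⊥`. It
isolates the penalty in a representation. -/
lemma coe_le_coe_sub_iff (x y : ℝ) (g : EReal) :
    (x : EReal) ≤ (y : EReal) - g ↔ g ≤ ((y - x : ℝ) : EReal) := by
  induction g with
  | bot => simp
  | top =>
    refine iff_of_false (fun h => ?_) fun h => EReal.coe_ne_top _ (top_le_iff.1 h)
    rw [EReal.sub_top] at h
    exact EReal.coe_ne_bot _ (le_bot_iff.1 h)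
  | coe g =>
    rw [← EReal.coe_sub, EReal.coe_le_coe_iff, EReal.coe_le_coe_iff]
    constructor <;> intro h <;> linarith

/-! ### Represented functionals are utilities with closed acceptance set. -/

section Represented

variable {Ω : Type*} {mΩ : MeasurableSpace Ω} {P : Measure Ω} [IsProbabilityMeasure P]
  {ℱ : Filtration ℕ mΩ} {τ θ : Ω → WithTop ℕ} {hτ : IsStoppingTime ℱ τ} {hθ : IsStoppingTime ℱ θ}
  {X Y a b : Proc P} {γ φ : Proc P → Ω →ₘ[P] EReal}

lemma measurableSet_eq_natCast (hτ : IsStoppingTime ℱ τ) (t : ℕ) :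
    MeasurableSet[ℱ t] {ω | τ ω = t} := hτ.measurableSet_eq t

/-- The witness puts a unit mass at time `τ`, with increments `1_{τ = t}`. Finiteness of `τ` makes
the total mass 1. -/
lemma nonempty_DStop (hτfin : ∀ᵐ ω ∂P, τ ω < ⊤) (hτθ : ∀ᵐ ω ∂P, τ ω ≤ θ ω) :
    (DStop P hτ hθ).Nonempty := by
  have hm := fun t => measurableSet_eq_natCast hτ t
  let d : Proc P := fun t => ind P (ℱ.le t _ (hm t))
  have hd : ∀ᵐ ω ∂P, ∀ t : ℕ, d t ω = {ω | τ ω = t}.indicator (fun _ => (1 : ℝ)) ω :=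
    ae_all_iff.2 fun t => ind_ae _
  have hd' : ∀ᵐ ω ∂P, ∃ s : ℕ, τ ω = s ∧ d s ω = 1 ∧ ∀ t ≠ s, d t ω = 0 := by
    filter_upwards [hτfin, hd] with ω h1 h2
    obtain h | ⟨s, hs⟩ := eq_top_or_eq_natCast (τ ω)
    · exact (h1.ne h).elim
    refine ⟨s, hs, ?_, fun t ht => ?_⟩
    · rw [h2, Set.indicator_of_mem (s := {ω | τ ω = s}) hs]
    · refine (h2 t).trans (Set.indicator_of_notMem (fun h => ht ?_) _)
      have h' : τ ω = t := h
      rw [hs] at h'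
      exact_mod_cast h'.symm
  have hdens : IsDensity ℱ τ θ d := by
    refine ⟨fun t => ⟨_, stronglyMeasurable_const.indicator (hm t), ind_ae _⟩, ?_, ?_, ?_⟩
    · have : ∫⁻ ω, ∑' t, ‖d t ω‖ₑ ∂P = ∫⁻ _, 1 ∂P := by
        refine lintegral_congr_ae ?_
        filter_upwards [hd'] with ω ⟨s, _, h1, h2⟩
        rw [tsum_eq_single s fun t ht => by rw [h2 t ht, enorm_zero], h1, enorm_one]
      rw [this]
      simp
    · filter_upwards [hd] with ω h t
      rw [h]
      exact Set.indicator_nonneg (fun _ _ => zero_le_one) _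
    · filter_upwards [hd', hτθ] with ω ⟨s, h1, _, h2⟩ h3 t ht
      refine h2 t fun hts => ht ?_
      rw [hts, ← h1]
      exact ⟨le_rfl, h3⟩
  refine ⟨ofIncr d, (mem_DStop_iff hτθ).2 ⟨by rwa [incr_ofIncr], AEEqFun.ext ?_⟩⟩
  have hsup : ∀ᵐ ω ∂P, ∀ t : ℕ, ¬ (τ ω ≤ t ∧ t ≤ θ ω) → incr (ofIncr d) t ω = 0 := by
    rw [incr_ofIncr]
    exact hdens.support
  have hs : series 1 (incr (ofIncr d)) =ᵐ[P] fun _ => 1 := by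
    rw [incr_ofIncr]
    filter_upwards [hd', one_ae (P := P)] with ω ⟨s, _, h1, h2⟩ h3
    rw [series, tsum_eq_single s fun t ht => by rw [h2 t ht, mul_zero], h1, h3, mul_one]
  filter_upwards [condPairing_ae hτ hsup 1, condExp_congr_ae (m := hτ.measurableSpace) hs,
    AEEqFun.coeFn_one (β := ℝ) (μ := P)] with ω h1 h2 h3
  rw [h1, h2, condExp_const hτ.measurableSpace_le, h3, Pi.one_apply]

lemma penalized_ae (γ : Proc P → Ω →ₘ[P] EReal) (X a : Proc P) : ∀ᵐ ω ∂P,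
    penalized hτ θ γ X a ω = ((condPairing hτ θ X a ω : ℝ) : EReal) - γ a ω :=
  AEEqFun.coeFn_mk _ _

lemma aestronglyMeasurable_penalized (hγ : AEStronglyMeasurable[hτ.measurableSpace] (γ a) P) :
    AEStronglyMeasurable[hτ.measurableSpace] (penalized hτ θ γ X a) P := by
  obtain ⟨g, hg, hγg⟩ := hγ
  obtain ⟨f, hf, hXf⟩ := aestronglyMeasurable_condPairing (hτ := hτ) (θ := θ) X a
  have h : Measurable[hτ.measurableSpace] fun ω => ((f ω : ℝ) : EReal) + -(g ω) :=
    hf.measurable.coe_real_ereal.add (continuous_neg.measurable.comp hg.measurable)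
  refine ⟨_, h.stronglyMeasurable, ?_⟩
  filter_upwards [penalized_ae γ X a, hγg, hXf] with ω h1 h2 h3
  rw [h1, h2, h3, sub_eq_add_neg]

/-- This is the universal property of the essential infimum with the penalty isolated. A lower bound
for `φ(X)` becomes a family of bounds on `γ` and conversely, which is how all the axioms are
obtained. -/
lemma Represents.le_iff (hφ : Represents hτ hθ γ φ) (hX : X ∈ RInfStop P hτ hθ) {f : Ω → ℝ}
    (hf : AEStronglyMeasurable f P) : (∀ᵐ ω ∂P, ((f ω : ℝ) : EReal) ≤ φ X ω) ↔
      ∀ a ∈ DStop P hτ hθ, ∀ᵐ ω ∂P, γ a ω ≤ ((condPairing hτ θ X a ω - f ω : ℝ) : EReal) := by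
  rw [hφ X hX]
  constructor
  · intro h a ha
    filter_upwards [h, essInfimum_le (Set.mem_image_of_mem (penalized hτ θ γ X) ha),
      penalized_ae γ X a] with ω h1 h2 h3
    rw [h3] at h2
    exact (coe_le_coe_sub_iff _ _ _).1 (h1.trans h2)
  · intro h
    refine le_essInfimum (continuous_coe_real_ereal.comp_aestronglyMeasurable hf) ?_
    rintro _ ⟨a, ha, rfl⟩
    filter_upwards [h a ha, penalized_ae γ X a] with ω h1 h2
    rw [h2]
    exact (coe_le_coe_sub_iff _ _ _).2 h1

/-- This form of `ess sup γ = 0` is the source of upper bounds for `φ`, which `Represents.le_iff`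
does not give by itself. -/
lemma IsPenalty.nonneg_of_le (hγ : IsPenalty hτ hθ γ) {u : Ω → ℝ} (hu : AEStronglyMeasurable u P)
    (h : ∀ a ∈ DStop P hτ hθ, ∀ᵐ ω ∂P, γ a ω ≤ ((u ω : ℝ) : EReal)) : ∀ᵐ ω ∂P, 0 ≤ u ω := by
  have hu' := continuous_coe_real_ereal.comp_aestronglyMeasurable hu
  have : (0 : Ω →ₘ[P] EReal) ≤ AEEqFun.mk _ hu' := by
    refine hγ.isLUB.2 ?_
    rintro _ ⟨a, ha, rfl⟩
    rw [← AEEqFun.coeFn_le]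
    filter_upwards [h a ha, AEEqFun.coeFn_mk _ hu'] with ω h1 h2
    rw [h2]
    exact h1
  filter_upwards [AEEqFun.coeFn_le.2 this, AEEqFun.coeFn_mk _ hu',
    AEEqFun.coeFn_zero (β := EReal) (μ := P)] with ω h1 h2 h3
  rw [h2, h3] at h1
  exact EReal.coe_le_coe_iff.1 h1

lemma IsPenalty.le_zero (hγ : IsPenalty hτ hθ γ) (ha : a ∈ DStop P hτ hθ) :
    ∀ᵐ ω ∂P, γ a ω ≤ 0 := by
  filter_upwards [AEEqFun.coeFn_le.2 (hγ.nonpos a ha),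
    AEEqFun.coeFn_zero (β := EReal) (μ := P)] with ω h1 h2
  rwa [h2] at h1

lemma Represents.values (hτfin : ∀ᵐ ω ∂P, τ ω < ⊤) (hτθ : ∀ᵐ ω ∂P, τ ω ≤ θ ω)
    (hγ : IsPenalty hτ hθ γ) (hφ : Represents hτ hθ γ φ) (hX : X ∈ RInfStop P hτ hθ) :
    ∃ f ∈ LInf P hτ, φ X = toE f := by
  obtain ⟨c, hc⟩ := isBdd_of_mem hX
  have hcp : ∀ a ∈ DStop P hτ hθ, ∀ᵐ ω ∂P, |condPairing hτ θ X a ω| ≤ c := fun a ha =>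
    abs_condPairing_le ha ((mem_DStop_iff hτθ).1 ha).1 hc
  have hm : AEStronglyMeasurable[hτ.measurableSpace] (φ X) P := by
    rw [hφ X hX]
    refine aestronglyMeasurable_essInfimum ((nonempty_DStop hτfin hτθ).image _) ?_
    rintro _ ⟨a, ha, rfl⟩
    exact aestronglyMeasurable_penalized (hγ.measurable a ha)
  have hlow : ∀ᵐ ω ∂P, ((-c : ℝ) : EReal) ≤ φ X ω := by
    refine (hφ.le_iff hX (f := fun _ => -c) aestronglyMeasurable_const).2 fun a ha => ?_
    filter_upwards [hγ.le_zero ha, hcp a ha] with ω h1 h2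
    refine h1.trans (EReal.coe_nonneg.2 ?_)
    linarith [(abs_le.1 h2).1]
  -- `φ X` is not yet known to be finite, and the truncation provides a real lower bound for it. The
  -- estimate `u ≤ c` obtained below lies under the level `c + 1`, so the truncation was not active.
  let u : Ω → ℝ := fun ω => (min (φ X ω) ((c + 1 : ℝ) : EReal)).toReal
  have hu : AEStronglyMeasurable u P :=
    (Measurable.ereal_toReal ((φ X).stronglyMeasurable.measurable.min
      measurable_const)).aestronglyMeasurable
  have hcoe : ∀ᵐ ω ∂P, ((u ω : ℝ) : EReal) = min (φ X ω) ((c + 1 : ℝ) : EReal) := by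
    filter_upwards [hlow] with ω h
    refine EReal.coe_toReal ?_ ?_
    · exact ne_top_of_le_ne_top (EReal.coe_ne_top _) (min_le_right _ _)
    · refine ne_of_gt (lt_min ((EReal.bot_lt_coe _).trans_le h) (EReal.bot_lt_coe _))
  have hup : ∀ᵐ ω ∂P, φ X ω ≤ (c : EReal) := by
    have h1 := (hφ.le_iff hX hu).1 (by
      filter_upwards [hcoe] with ω h
      rw [h]
      exact min_le_left _ _)
    have h2 := hγ.nonneg_of_le (u := fun ω => c - u ω) (aestronglyMeasurable_const.sub hu)
      fun a ha => by
        filter_upwards [h1 a ha, hcp a ha] with ω h3 h4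
        refine h3.trans (EReal.coe_le_coe_iff.2 ?_)
        linarith [(abs_le.1 h4).2]
    filter_upwards [h2, hcoe] with ω h3 h4
    have h5 : min (φ X ω) ((c + 1 : ℝ) : EReal) ≤ (c : EReal) := by
      rw [← h4]
      exact EReal.coe_le_coe_iff.2 (by linarith)
    refine (min_le_iff.1 h5).resolve_right fun h6 => ?_
    have := EReal.coe_le_coe_iff.1 h6
    linarith
  have hf : Measurable fun ω => (φ X ω).toReal :=
    Measurable.ereal_toReal (φ X).stronglyMeasurable.measurable
  have hval : ∀ᵐ ω ∂P, ((AEEqFun.mk _ hf.aestronglyMeasurable : Ω →ₘ[P] ℝ) ω : EReal)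
      = φ X ω := by
    filter_upwards [hlow, hup, AEEqFun.coeFn_mk _ hf.aestronglyMeasurable (μ := P)] with ω h1 h2 h3
    rw [h3]
    exact EReal.coe_toReal (ne_top_of_le_ne_top (EReal.coe_ne_top _) h2)
      (ne_of_gt ((EReal.bot_lt_coe _).trans_le h1))
  refine ⟨AEEqFun.mk _ hf.aestronglyMeasurable, ⟨?_, c, ?_⟩, AEEqFun.ext ?_⟩
  · obtain ⟨g, hg, hfg⟩ := hm
    have hg' : Measurable[hτ.measurableSpace] fun ω => (g ω).toReal :=
      Measurable.ereal_toReal hg.measurable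
    refine ⟨_, hg'.stronglyMeasurable, ?_⟩
    filter_upwards [hfg, AEEqFun.coeFn_mk _ hf.aestronglyMeasurable (μ := P)] with ω h1 h2
    rw [h2, h1]
  · filter_upwards [hlow, hup, hval] with ω h1 h2 h3
    rw [← h3] at h1 h2
    exact abs_le.2 ⟨EReal.coe_le_coe_iff.1 h1, EReal.coe_le_coe_iff.1 h2⟩
  · filter_upwards [hval, toE_ae (AEEqFun.mk _ hf.aestronglyMeasurable : Ω →ₘ[P] ℝ)] with ω h1 h2
    rw [h2, h1]

theorem Represents.isConcaveMonetaryUtility (hτfin : ∀ᵐ ω ∂P, τ ω < ⊤)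
    (hτθ : ∀ᵐ ω ∂P, τ ω ≤ θ ω) (hγ : IsPenalty hτ hθ γ) (hφ : Represents hτ hθ γ φ) :
    IsConcaveMonetaryUtility hτ hθ φ := by
  have hval : ∀ X ∈ RInfStop P hτ hθ, ∃ f ∈ LInf P hτ, ∀ᵐ ω ∂P, φ X ω = ((f ω : ℝ) : EReal) := by
    intro X hX
    obtain ⟨f, hf, h⟩ := hφ.values hτfin hτθ hγ hX
    exact ⟨f, hf, by rw [h]; exact toE_ae f⟩
  have hbd : ∀ {X : Proc P}, X ∈ RInfStop P hτ hθ → IsBdd X := fun h => isBdd_of_mem h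
  have hdens : ∀ {a : Proc P}, a ∈ DStop P hτ hθ → IsDensity ℱ τ θ (incr a) := fun h =>
    ((mem_DStop_iff hτθ).1 h).1
  have hself : ∀ {X : Proc P} {f : Ω →ₘ[P] ℝ}, X ∈ RInfStop P hτ hθ →
      (∀ᵐ ω ∂P, φ X ω = ((f ω : ℝ) : EReal)) → ∀ a ∈ DStop P hτ hθ,
      ∀ᵐ ω ∂P, γ a ω ≤ ((condPairing hτ θ X a ω - f ω : ℝ) : EReal) := fun hX hf =>
    (hφ.le_iff hX (AEEqFun.aestronglyMeasurable _)).1 (hf.mono fun ω h => h.ge)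
  refine ⟨fun X hX => hφ.values hτfin hτθ hγ hX, ?_, ?_, ?_, ?_⟩
  · intro X hX A hA
    classical
    have hA' := hτ.measurableSpace_le A hA
    have hI := ind_mem_LInf (P := P) hA hA'
    have hW := mul_mem_RInfStop hτθ hI hX
    obtain ⟨f, hf, hfX⟩ := hval X hX
    obtain ⟨w, hw, hwW⟩ := hval _ hW
    have hcp : ∀ a ∈ DStop P hτ hθ, ∀ᵐ ω ∂P,
        condPairing hτ θ (fun t => ind P hA' * X t) a ω
          = A.indicator (fun ω => condPairing hτ θ X a ω) ω := by
      intro a ha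
      filter_upwards [condPairing_mul (hdens ha) (hbd hX) hI, ind_ae (P := P) hA'] with ω h1 h2
      rw [h1, h2]
      by_cases hω : ω ∈ A <;> simp [hω]
    -- The trial value is the one of `1_A X` on `A`, where the forms of the two processes agree, and
    -- the one of `X` itself off `A`.
    have h1 := (hφ.le_iff hX (f := A.piecewise w f)
      (w.stronglyMeasurable.piecewise hA' f.stronglyMeasurable).aestronglyMeasurable).2 (by
        intro a ha
        filter_upwards [hself hX hfX a ha, hself hW hwW a ha, hcp a ha] with ω h1 h2 h3
        by_cases hω : ω ∈ A
        · rw [Set.piecewise_eq_of_mem _ _ _ hω]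
          rwa [h3, Set.indicator_of_mem hω] at h2
        · rwa [Set.piecewise_eq_of_notMem _ _ _ hω])
    have h2 := (hφ.le_iff hW (f := A.piecewise f 0)
      (f.stronglyMeasurable.piecewise hA' stronglyMeasurable_zero).aestronglyMeasurable).2 (by
        intro a ha
        filter_upwards [hself hX hfX a ha, hγ.le_zero ha, hcp a ha] with ω h1 h2 h3
        by_cases hω : ω ∈ A
        · rwa [Set.piecewise_eq_of_mem _ _ _ hω, h3, Set.indicator_of_mem hω]
        · rw [Set.piecewise_eq_of_notMem _ _ _ hω, h3, Set.indicator_of_notMem hω]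
          simpa using h2)
    -- Off `A` the form of `1_A X` vanishes, so every `γ a` is at most `-w` there, and the essential
    -- supremum 0 forces `w ≤ 0`.
    have h3 := hγ.nonneg_of_le (u := A.piecewise 0 (fun ω => -w ω))
      (stronglyMeasurable_zero.piecewise hA' w.stronglyMeasurable.neg).aestronglyMeasurable (by
        intro a ha
        filter_upwards [hself hW hwW a ha, hγ.le_zero ha, hcp a ha] with ω h1 h2 h3
        by_cases hω : ω ∈ A
        · rw [Set.piecewise_eq_of_mem _ _ _ hω]
          simpa using h2
        · rw [Set.piecewise_eq_of_notMem _ _ _ hω]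
          rwa [h3, Set.indicator_of_notMem hω, zero_sub] at h1)
    filter_upwards [h1, h2, h3, hfX, hwW] with ω h1 h2 h3 h4 h5
    rw [h5] at h2 ⊢
    by_cases hω : ω ∈ A
    · rw [Set.piecewise_eq_of_mem _ _ _ hω] at h1 h2
      rw [Set.indicator_of_mem hω]
      rw [h4] at h1 ⊢
      exact le_antisymm h1 h2
    · rw [Set.piecewise_eq_of_notMem _ _ _ hω] at h2 h3
      rw [Set.indicator_of_notMem hω]
      refine le_antisymm ?_ (by simpa using h2)
      rw [← EReal.coe_zero]
      exact EReal.coe_le_coe_iff.2 (by linarith)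
  · intro X hX Y hY hXY
    obtain ⟨f, hf, hfX⟩ := hval X hX
    rw [← AEEqFun.coeFn_le]
    have h1 := (hφ.le_iff hY f.aestronglyMeasurable).2 (by
      intro a ha
      filter_upwards [hself hX hfX a ha, condPairing_mono (hτ := hτ) (hdens ha) (hbd hX) (hbd hY)
        ((ae_all_iff.2 fun t => AEEqFun.coeFn_le.2 (hXY t)).mono fun ω h t _ => h t)] with ω h1 h2
      exact h1.trans (EReal.coe_le_coe_iff.2 (by linarith)))
    filter_upwards [h1, hfX] with ω h1 h2
    rwa [h2]
  · intro X hX m hm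
    have hW := add_mem_RInfStop hτθ hX (cash_mem_RInfStop hτθ hm)
    obtain ⟨f, hf, hfX⟩ := hval X hX
    obtain ⟨w, hw, hwW⟩ := hval _ hW
    have hcp : ∀ a ∈ DStop P hτ hθ, ∀ᵐ ω ∂P,
        condPairing hτ θ (X + cash hτ m) a ω = condPairing hτ θ X a ω + m ω := by
      intro a ha
      filter_upwards [condPairing_add (hτ := hτ) (hdens ha) (hbd hX) (isBdd_cash hm),
        condPairing_cash ha (hdens ha) hm] with ω h1 h2
      rw [h1, h2]
    have h1 := (hφ.le_iff hX (w.aestronglyMeasurable.sub m.aestronglyMeasurable)).2 (by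
      intro a ha
      filter_upwards [hself hW hwW a ha, hcp a ha] with ω h1 h2
      rw [h2] at h1
      refine h1.trans (EReal.coe_le_coe_iff.2 ?_)
      simp only [Pi.sub_apply]
      linarith)
    have h2 := (hφ.le_iff hW (f.aestronglyMeasurable.add m.aestronglyMeasurable)).2 (by
      intro a ha
      filter_upwards [hself hX hfX a ha, hcp a ha] with ω h1 h2
      rw [h2]
      refine h1.trans (EReal.coe_le_coe_iff.2 ?_)
      simp only [Pi.add_apply]
      linarith)
    filter_upwards [h1, h2, hfX, hwW] with ω h1 h2 h3 h4
    rw [h3, EReal.coe_le_coe_iff] at h1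
    rw [h4, EReal.coe_le_coe_iff] at h2
    rw [h3, h4, ← EReal.coe_add, EReal.coe_eq_coe_iff]
    simp only [Pi.add_apply, Pi.sub_apply] at h1 h2
    linarith
  · intro X hX Y hY l hl hl0 hl1
    have hk := sub_mem_LInf one_mem_LInf hl
    have hW := mix_mem_RInfStop hτθ hl hk hX hY
    obtain ⟨f, hf, hfX⟩ := hval X hX
    obtain ⟨g, hg, hgY⟩ := hval Y hY
    have hl0' : ∀ᵐ ω ∂P, 0 ≤ l ω := by
      filter_upwards [AEEqFun.coeFn_le.2 hl0, AEEqFun.coeFn_zero (β := ℝ) (μ := P)] with ω h1 h2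
      rwa [h2] at h1
    have hl1' : ∀ᵐ ω ∂P, l ω ≤ 1 := by
      filter_upwards [AEEqFun.coeFn_le.2 hl1, AEEqFun.coeFn_one (β := ℝ) (μ := P)] with ω h1 h2
      rwa [h2] at h1
    have hk' : ∀ᵐ ω ∂P, (1 - l : Ω →ₘ[P] ℝ) ω = 1 - l ω := by
      filter_upwards [AEEqFun.coeFn_sub 1 l, AEEqFun.coeFn_one (β := ℝ) (μ := P)] with ω h1 h2
      rw [h1, Pi.sub_apply, h2, Pi.one_apply]
    have h1 := (hφ.le_iff hW (f := fun ω => l ω * f ω + (1 - l ω) * g ω)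
      ((l.aestronglyMeasurable.mul f.aestronglyMeasurable).add
        ((aestronglyMeasurable_const.sub l.aestronglyMeasurable).mul g.aestronglyMeasurable))).2 (by
      intro a ha
      filter_upwards [hself hX hfX a ha, hself hY hgY a ha, hl0', hl1', hk',
        condPairing_mix_left (hdens ha) (hbd hX) (hbd hY) hl hk] with ω h1 h2 h3 h4 h5 h6
      rw [h6, h5]
      -- `γ a` lies below both differences. The smaller one lies below their average with weights
      -- `l` and `1 - l`.
      rcases le_total (condPairing hτ θ X a ω - f ω) (condPairing hτ θ Y a ω - g ω) with h | h
      · refine h1.trans (EReal.coe_le_coe_iff.2 ?_)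
        nlinarith
      · refine h2.trans (EReal.coe_le_coe_iff.2 ?_)
        nlinarith)
    filter_upwards [h1, hfX, hgY] with ω h1 h2 h3
    rw [h2, h3]
    exact_mod_cast h1

theorem Represents.acceptanceSetClosed (hτθ : ∀ᵐ ω ∂P, τ ω ≤ θ ω) (hγ : IsPenalty hτ hθ γ)
    (hφ : Represents hτ hθ γ φ) : AcceptanceSetClosed hτ hθ φ := by
  have heq : {X : RInf P ℱ | X.1 ∈ acceptanceSet hτ hθ φ} =
      {X : RInf P ℱ | X.1 ∈ RInfStop P hτ hθ} ∩ ⋂ (a : Proc P) (_ : a ∈ DStop P hτ hθ),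
        {X : RInf P ℱ | ∀ᵐ ω ∂P, γ a ω ≤ ((condPairing hτ θ X.1 a ω : ℝ) : EReal)} := by
    ext X
    simp only [acceptanceSet, Set.mem_inter_iff, Set.mem_iInter, Set.mem_ofPred_eq]
    refine and_congr_right fun hX => ?_
    have h := hφ.le_iff hX (f := fun _ => 0) aestronglyMeasurable_const
    simp only [sub_zero] at h
    rw [← h, ← AEEqFun.coeFn_le]
    refine eventually_congr ?_
    filter_upwards [AEEqFun.coeFn_zero (β := EReal) (μ := P)] with ω h1
    rw [h1]
    rfl
  rw [AcceptanceSetClosed, heq]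
  let _ := sigmaTopology P ℱ
  exact (isClosed_RInfStop hτθ).inter (isClosed_iInter fun a => isClosed_iInter fun ha =>
    isClosed_le_condPairing ((mem_DStop_iff hτθ).1 ha).1 (hγ.measurable a ha))

end Represented

/-! ### Bounded almost sure convergence and the acceptance set. -/

section Utility

variable {Ω : Type*} {mΩ : MeasurableSpace Ω} {P : Measure Ω} [IsProbabilityMeasure P]
  {ℱ : Filtration ℕ mΩ} {τ θ : Ω → WithTop ℕ} {hτ : IsStoppingTime ℱ τ} {hθ : IsStoppingTime ℱ θ}
  {X Y a b : Proc P} {φ : Proc P → Ω →ₘ[P] EReal}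

/-- Dominated convergence is used twice, for the sum over times and for the expectation, with
majorant `c ∑ |Δ a_t|`. -/
lemma tendsto_pairing {Xn : ℕ → Proc P} {c : ℝ} (hc : ∀ n t, ∀ᵐ ω ∂P, |Xn n t ω| ≤ c)
    (hX : ∀ t, ∀ᵐ ω ∂P, Tendsto (fun n => Xn n t ω) atTop (𝓝 (X t ω))) (ha : a ∈ AOne P ℱ) :
    Tendsto (fun n => pairing (Xn n) a) atTop (𝓝 (pairing X a)) := by
  have hm : ∀ t, AEStronglyMeasurable (fun ω => c * ‖incr a t ω‖) P := fun t =>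
    (incr a t).aestronglyMeasurable.norm.const_mul c
  have hfin : ∫⁻ ω, ∑' t, ‖c * ‖incr a t ω‖‖ₑ ∂P < ⊤ := by
    simp only [enorm_mul, enorm_norm, ENNReal.tsum_mul_left]
    rw [lintegral_const_mul'' _ (AEMeasurable.tsum fun t => (incr a t).aestronglyMeasurable.enorm)]
    exact ENNReal.mul_lt_top enorm_lt_top ha.2
  have hc' : ∀ᵐ ω ∂P, ∀ n t, |Xn n t ω| ≤ c := ae_all_iff.2 fun n => ae_all_iff.2 (hc n)
  have hbound : ∀ᵐ ω ∂P, ∀ n t, ‖Xn n t ω * incr a t ω‖ ≤ c * ‖incr a t ω‖ := by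
    filter_upwards [hc'] with ω h n t
    rw [norm_mul]
    exact mul_le_mul_of_nonneg_right (h n t) (norm_nonneg _)
  have hsum : ∀ᵐ ω ∂P, Summable fun t => c * ‖incr a t ω‖ := by
    filter_upwards [ae_summable_of_lintegral hm hfin] with ω h using h.of_norm
  refine tendsto_integral_of_dominated_convergence (fun ω => ∑' t, c * ‖incr a t ω‖) (fun n => ?_)
    (integrable_tsum_of_lintegral hm hfin) (fun n => ?_) ?_
  · exact (integrable_series ⟨c, hc n⟩ ha.2).aestronglyMeasurable
  · filter_upwards [hbound, hsum] with ω h1 h2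
    exact tsum_of_norm_bounded h2.hasSum (h1 n)
  · filter_upwards [hbound, hsum, ae_all_iff.2 hX] with ω h1 h2 h3
    exact tendsto_tsum_of_dominated_convergence h2 (fun t => (h3 t).mul_const _)
      (Eventually.of_forall h1)

lemma mem_of_isClosed_sigmaTopology {S : Set (Proc P)}
    (hS : IsClosed[sigmaTopology P ℱ] {X : RInf P ℱ | X.1 ∈ S}) {Xn : ℕ → Proc P} {c : ℝ}
    (hXn : ∀ n, Xn n ∈ RInf P ℱ) (hXS : ∀ n, Xn n ∈ S) (hX : X ∈ RInf P ℱ)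
    (hc : ∀ n t, ∀ᵐ ω ∂P, |Xn n t ω| ≤ c)
    (hlim : ∀ t, ∀ᵐ ω ∂P, Tendsto (fun n => Xn n t ω) atTop (𝓝 (X t ω))) : X ∈ S := by
  let _ := sigmaTopology P ℱ
  have ht : Tendsto (fun n => (⟨Xn n, hXn n⟩ : RInf P ℱ)) atTop (𝓝 ⟨X, hX⟩) := by
    simp only [nhds_iInf, nhds_induced, tendsto_iInf, tendsto_comap_iff]
    exact fun a ha => tendsto_pairing hc hlim ha
  exact hS.mem_of_tendsto ht (Eventually.of_forall hXS)

lemma IsConcaveMonetaryUtility.exists_value (hu : IsConcaveMonetaryUtility hτ hθ φ)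
    (hX : X ∈ RInfStop P hτ hθ) :
    ∃ f ∈ LInf P hτ, ∀ᵐ ω ∂P, φ X ω = ((f ω : ℝ) : EReal) := by
  obtain ⟨f, hf, h⟩ := hu.values X hX
  exact ⟨f, hf, by rw [h]; exact toE_ae f⟩

lemma mem_acceptanceSet_iff : X ∈ acceptanceSet hτ hθ φ ↔
    X ∈ RInfStop P hτ hθ ∧ ∀ᵐ ω ∂P, 0 ≤ φ X ω := by
  refine and_congr_right fun _ => ?_
  rw [← AEEqFun.coeFn_le]
  refine eventually_congr ?_
  filter_upwards [AEEqFun.coeFn_zero (β := EReal) (μ := P)] with ω h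
  rw [h]
  rfl

lemma IsConcaveMonetaryUtility.mono_ae (hu : IsConcaveMonetaryUtility hτ hθ φ)
    (hX : X ∈ RInfStop P hτ hθ) (hY : Y ∈ RInfStop P hτ hθ)
    (h : ∀ t, ∀ᵐ ω ∂P, X t ω ≤ Y t ω) : ∀ᵐ ω ∂P, φ X ω ≤ φ Y ω :=
  AEEqFun.coeFn_le.2 (hu.mono X hX Y hY fun t => AEEqFun.coeFn_le.1 (h t))

lemma IsConcaveMonetaryUtility.sub_cash (hu : IsConcaveMonetaryUtility hτ hθ φ)
    (hX : X ∈ RInfStop P hτ hθ) {f m : Ω →ₘ[P] ℝ} (hf : ∀ᵐ ω ∂P, φ X ω = ((f ω : ℝ) : EReal))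
    (hm : m ∈ LInf P hτ) :
    ∀ᵐ ω ∂P, φ (X + cash hτ (-m)) ω = ((f ω - m ω : ℝ) : EReal) := by
  filter_upwards [hu.translation X hX (-m) (neg_mem_LInf hm), hf, AEEqFun.coeFn_neg m]
    with ω h1 h2 h3
  rw [h1, h2, h3, ← EReal.coe_add, Pi.neg_apply, sub_eq_add_neg]

theorem AcceptanceSetClosed.continuousDecreasing (hτθ : ∀ᵐ ω ∂P, τ ω ≤ θ ω)
    (hu : IsConcaveMonetaryUtility hτ hθ φ) (hcl : AcceptanceSetClosed hτ hθ φ) :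
    ContinuousDecreasing hτ hθ φ := by
  intro Xn X hXn hX hanti hlim
  choose f hf hfX using fun n => hu.exists_value (hXn n)
  obtain ⟨g, hg, hgX⟩ := hu.exists_value hX
  have hXle : ∀ n t, ∀ᵐ ω ∂P, X t ω ≤ Xn n t ω := by
    intro n t
    have h : ∀ᵐ ω ∂P, ∀ m, n ≤ m → Xn m t ω ≤ Xn n t ω :=
      ae_all_iff.2 fun m => ae_all_iff.2 fun hm => AEEqFun.coeFn_le.2 (hanti hm t)
    filter_upwards [h, hlim t] with ω h1 h2
    exact le_of_tendsto h2 (eventually_atTop.2 ⟨n, h1⟩)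
  have hfanti : ∀ᵐ ω ∂P, Antitone fun n => f n ω := by
    have h : ∀ᵐ ω ∂P, ∀ n, φ (Xn (n + 1)) ω ≤ φ (Xn n) ω := ae_all_iff.2 fun n =>
      AEEqFun.coeFn_le.2 (hu.mono _ (hXn _) _ (hXn _) (hanti n.le_succ))
    filter_upwards [h, ae_all_iff.2 hfX] with ω h1 h2
    refine antitone_nat_of_succ_le fun n => ?_
    have := h1 n
    rwa [h2, h2, EReal.coe_le_coe_iff] at this
  have hgf : ∀ᵐ ω ∂P, ∀ n, g ω ≤ f n ω := by
    have h := fun n => hu.mono_ae hX (hXn n) (hXle n)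
    filter_upwards [ae_all_iff.2 h, ae_all_iff.2 hfX, hgX] with ω h1 h2 h3 n
    have := h1 n
    rwa [h2, h3, EReal.coe_le_coe_iff] at this
  -- Representatives measurable for `ℱ_τ` make the limit `m` of the values `ℱ_τ`-measurable, so that
  -- it may be subtracted as cash.
  choose f' hf' hff' using fun n => (hf n).1
  have hm' : Measurable[hτ.measurableSpace] fun ω => ⨅ n, f' n ω :=
    Measurable.iInf fun n => (hf' n).measurable
  have hm'' := hm'.mono hτ.measurableSpace_le le_rfl
  let m : Ω →ₘ[P] ℝ := AEEqFun.mk (fun ω => ⨅ n, f' n ω) hm''.aestronglyMeasurable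
  have hmae : ∀ᵐ ω ∂P, m ω = ⨅ n, f n ω := by
    filter_upwards [ae_all_iff.2 hff', AEEqFun.coeFn_mk _ hm''.aestronglyMeasurable (μ := P)]
      with ω h1 h2
    simp only [h1]
    exact h2
  have hbb : ∀ᵐ ω ∂P, BddBelow (Set.range fun n => f n ω) := by
    filter_upwards [hgf] with ω h
    refine ⟨g ω, ?_⟩
    rintro _ ⟨n, rfl⟩
    exact h n
  have hflim : ∀ᵐ ω ∂P, Tendsto (fun n => f n ω) atTop (𝓝 (m ω)) := by
    filter_upwards [hmae, hfanti, hbb] with ω h1 h2 h3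
    rw [h1]
    exact tendsto_atTop_ciInf h2 h3
  have hmf : ∀ᵐ ω ∂P, ∀ n, m ω ≤ f n ω := by
    filter_upwards [hmae, hbb] with ω h1 h2 n
    rw [h1]
    exact ciInf_le h2 n
  have hm : m ∈ LInf P hτ := by
    refine ⟨⟨_, hm'.stronglyMeasurable, AEEqFun.coeFn_mk _ _⟩, ?_⟩
    obtain ⟨c, hc⟩ := (hf 0).2
    obtain ⟨b, hb⟩ := hg.2
    refine ⟨max b c, ?_⟩
    filter_upwards [hmf, hflim, hgf, hc, hb] with ω h1 h2 h3 h4 h5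
    refine abs_le.2 ⟨?_, (h1 0).trans ((abs_le.1 h4).2.trans (le_max_right _ _))⟩
    have := ge_of_tendsto' h2 h3
    linarith [(abs_le.1 h5).1, le_max_left b c]
  have hcash := cash_mem_RInfStop (hθ := hθ) hτθ (neg_mem_LInf hm)
  have hWn : ∀ n, Xn n + cash hτ (-m) ∈ RInfStop P hτ hθ := fun n =>
    add_mem_RInfStop hτθ (hXn n) hcash
  have hW := add_mem_RInfStop hτθ hX hcash
  obtain ⟨c1, hc1⟩ := isBdd_of_mem (hXn 0)
  obtain ⟨c2, hc2⟩ := isBdd_of_mem hX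
  obtain ⟨c3, hc3⟩ := isBdd_of_mem hcash
  -- Since `m ≤ φ(X^n)`, every `X^n - m` is acceptable, and a closed set keeps bounded almost sure
  -- limits. This gives `m ≤ φ(X)`.
  have hmem : X + cash hτ (-m) ∈ acceptanceSet hτ hθ φ := by
    refine mem_of_isClosed_sigmaTopology hcl (Xn := fun n => Xn n + cash hτ (-m))
      (c := max c1 c2 + c3) (fun n => ((mem_RInfStop_iff hτθ).1 (hWn n)).1) (fun n => ?_)
      ((mem_RInfStop_iff hτθ).1 hW).1 (fun n t => ?_) fun t => ?_
    · refine mem_acceptanceSet_iff.2 ⟨hWn n, ?_⟩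
      filter_upwards [hu.sub_cash (hXn n) (hfX n) hm, hmf] with ω h1 h2
      rw [h1]
      exact EReal.coe_nonneg.2 (sub_nonneg.2 (h2 n))
    · filter_upwards [hc1 t, hc2 t, hc3 t, hXle n t, AEEqFun.coeFn_le.2 (hanti n.zero_le t),
        add_ae (Xn n) (cash hτ (-m))] with ω h1 h2 h3 h4 h5 h6
      rw [h6]
      refine (abs_add_le _ _).trans (add_le_add (abs_le.2 ⟨?_, ?_⟩) h3)
      · linarith [(abs_le.1 h2).1, le_max_right c1 c2]
      · linarith [(abs_le.1 h1).2, le_max_left c1 c2]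
    · filter_upwards [hlim t, add_ae X (cash hτ (-m)),
        ae_all_iff.2 fun n => add_ae (Xn n) (cash hτ (-m))] with ω h1 h2 h3
      simp only [h2, h3]
      exact h1.add_const _
  filter_upwards [(mem_acceptanceSet_iff.1 hmem).2, hu.sub_cash hX hgX hm, hgX,
    ae_all_iff.2 hfX, hflim, hgf] with ω h1 h2 h3 h4 h5 h6
  rw [h2, EReal.coe_nonneg] at h1
  have hgm : g ω = m ω := le_antisymm (ge_of_tendsto' h5 h6) (by linarith)
  simp only [h3, h4, hgm]
  exact (continuous_coe_real_ereal.tendsto _).comp h5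

lemma tendsto_iSup_add {x : ℕ → ℝ} {l : ℝ} (h : Tendsto x atTop (𝓝 l))
    (hb : BddAbove (Set.range x)) : Tendsto (fun n => ⨆ m, x (n + m)) atTop (𝓝 l) := by
  rw [Metric.tendsto_atTop] at h ⊢
  intro ε hε
  obtain ⟨N, hN⟩ := h (ε / 2) (half_pos hε)
  refine ⟨N, fun n hn => ?_⟩
  have hb' : BddAbove (Set.range fun m => x (n + m)) :=
    hb.mono (by rintro _ ⟨m, rfl⟩; exact ⟨n + m, rfl⟩)
  have h1 : ∀ m, |x (n + m) - l| < ε / 2 := fun m => hN (n + m) (by omega)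
  have h2 : (⨆ m, x (n + m)) ≤ l + ε / 2 := ciSup_le fun m => by linarith [(abs_lt.1 (h1 m)).2]
  have h3 := le_ciSup hb' 0
  rw [Real.dist_eq, abs_lt]
  constructor <;> linarith [(abs_lt.1 (h1 0)).1]

/-- `ℛ^∞_{τ,θ}` is closed under bounded almost sure convergence. -/
lemma mem_RInfStop_of_tendsto (hτθ : ∀ᵐ ω ∂P, τ ω ≤ θ ω) {Xn : ℕ → Proc P} {c : ℝ}
    (hXn : ∀ n, Xn n ∈ RInfStop P hτ hθ) (hc : ∀ n t, ∀ᵐ ω ∂P, |Xn n t ω| ≤ c)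
    (hlim : ∀ t, ∀ᵐ ω ∂P, Tendsto (fun n => Xn n t ω) atTop (𝓝 (X t ω))) :
    X ∈ RInfStop P hτ hθ := by
  replace hXn := fun n => (mem_RInfStop_iff hτθ).1 (hXn n)
  rw [mem_RInfStop_iff hτθ]
  refine ⟨⟨fun t => ?_, c, fun t => ?_⟩, ?_⟩
  · choose g hg hXg using fun n => (hXn n).1.1 t
    have hm : Measurable[ℱ t] fun ω => limsup (fun n => g n ω) atTop :=
      Measurable.limsup fun n => (hg n).measurable
    refine ⟨_, hm.stronglyMeasurable, ?_⟩
    filter_upwards [hlim t, ae_all_iff.2 hXg] with ω h1 h2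
    simp only [← h2]
    exact h1.limsup_eq.symm
  · filter_upwards [hlim t, ae_all_iff.2 fun n => hc n t] with ω h1 h2
    exact le_of_tendsto' h1.abs h2
  · filter_upwards [ae_all_iff.2 hlim, ae_all_iff.2 fun n => (hXn n).2] with ω h1 h2 t
    refine ⟨fun ht => ?_, fun ht => ?_⟩
    · refine tendsto_nhds_unique (h1 t) ?_
      simp only [fun n => (h2 n t).1 ht]
      exact tendsto_const_nhds
    · refine tendsto_nhds_unique (h1 (t + 1)) ?_
      simp only [fun n => (h2 n t).2 ht]
      exact h1 t

/-- The acceptance set is closed under bounded almost sure convergence. -/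
lemma mem_acceptanceSet_of_tendsto (hτθ : ∀ᵐ ω ∂P, τ ω ≤ θ ω)
    (hu : IsConcaveMonetaryUtility hτ hθ φ) (hcont : ContinuousDecreasing hτ hθ φ)
    {Xn : ℕ → Proc P} {c : ℝ} (hXn : ∀ n, Xn n ∈ acceptanceSet hτ hθ φ)
    (hc : ∀ n t, ∀ᵐ ω ∂P, |Xn n t ω| ≤ c)
    (hlim : ∀ t, ∀ᵐ ω ∂P, Tendsto (fun n => Xn n t ω) atTop (𝓝 (X t ω))) :
    X ∈ acceptanceSet hτ hθ φ := by
  have hX := mem_RInfStop_of_tendsto hτθ (fun n => (hXn n).1) hc hlim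
  have hsm : ∀ n t, Measurable fun ω => ⨆ m, Xn (n + m) t ω := fun n t =>
    Measurable.iSup fun m => (Xn (n + m) t).stronglyMeasurable.measurable
  -- The tail suprema dominate the `Xn n`, hence are acceptable, and they decrease to `X`, so
  -- continuity for decreasing sequences applies to them.
  let S : ℕ → Proc P := fun n t =>
    AEEqFun.mk (fun ω => ⨆ m, Xn (n + m) t ω) (hsm n t).aestronglyMeasurable
  have hSae : ∀ᵐ ω ∂P, ∀ n t, S n t ω = ⨆ m, Xn (n + m) t ω :=
    ae_all_iff.2 fun n => ae_all_iff.2 fun t => AEEqFun.coeFn_mk _ _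
  have hc' : ∀ᵐ ω ∂P, ∀ n t, |Xn n t ω| ≤ c := ae_all_iff.2 fun n => ae_all_iff.2 (hc n)
  have hbdd : ∀ᵐ ω ∂P, ∀ n t, BddAbove (Set.range fun m => Xn (n + m) t ω) := by
    filter_upwards [hc'] with ω h n t
    refine ⟨c, ?_⟩
    rintro _ ⟨m, rfl⟩
    exact (abs_le.1 (h _ t)).2
  have hSR : ∀ n, S n ∈ RInfStop P hτ hθ := by
    intro n
    have hR := fun n => (mem_RInfStop_iff hτθ).1 (hXn n).1
    rw [mem_RInfStop_iff hτθ]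
    refine ⟨⟨fun t => ?_, c, fun t => ?_⟩, ?_⟩
    · choose g hg hXg using fun n => (hR n).1.1 t
      have hm : Measurable[ℱ t] fun ω => ⨆ m, g (n + m) ω :=
        Measurable.iSup fun m => (hg (n + m)).measurable
      refine ⟨_, hm.stronglyMeasurable, ?_⟩
      filter_upwards [hSae, ae_all_iff.2 hXg] with ω h1 h2
      rw [h1]
      simp only [h2]
    · filter_upwards [hSae, hc', hbdd] with ω h1 h2 h3
      rw [h1]
      refine abs_le.2 ⟨?_, ciSup_le fun m => (abs_le.1 (h2 _ t)).2⟩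
      exact (abs_le.1 (h2 (n + 0) t)).1.trans (le_ciSup (h3 n t) 0)
    · filter_upwards [hSae, ae_all_iff.2 fun n => (hR n).2] with ω h1 h2 t
      rw [h1, h1]
      refine ⟨fun ht => ?_, fun ht => ?_⟩
      · simp only [fun n => (h2 n t).1 ht, ciSup_const]
      · simp only [fun n => (h2 n t).2 ht]
  have hSanti : Antitone S := by
    refine antitone_nat_of_succ_le fun n t => ?_
    rw [← AEEqFun.coeFn_le]
    filter_upwards [hSae, hbdd] with ω h1 h2
    rw [h1, h1]
    refine ciSup_le fun m => ?_
    have := le_ciSup (h2 n t) (1 + m)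
    simpa only [add_assoc] using this
  have hSlim : ∀ t, ∀ᵐ ω ∂P, Tendsto (fun n => S n t ω) atTop (𝓝 (X t ω)) := by
    intro t
    filter_upwards [hSae, hbdd, hlim t] with ω h1 h2 h3
    simp only [h1]
    refine tendsto_iSup_add h3 ?_
    simpa only [zero_add] using h2 0 t
  have hle : ∀ n, ∀ᵐ ω ∂P, 0 ≤ φ (S n) ω := by
    intro n
    have h : ∀ t, ∀ᵐ ω ∂P, Xn n t ω ≤ S n t ω := fun t => by
      filter_upwards [hSae, hbdd] with ω h1 h2
      rw [h1]
      exact le_ciSup (h2 n t) 0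
    filter_upwards [hu.mono_ae (hXn n).1 (hSR n) h, (mem_acceptanceSet_iff.1 (hXn n)).2]
      with ω h1 h2 using h2.trans h1
  refine mem_acceptanceSet_iff.2 ⟨hX, ?_⟩
  filter_upwards [hcont S X hSR hX hSanti hSlim, ae_all_iff.2 hle] with ω h1 h2
  exact ge_of_tendsto' h1 h2

end Utility

/-! ### Times with a finite measure. -/

section Timed

variable {Ω : Type*} {mΩ : MeasurableSpace Ω} {P : Measure Ω} [IsProbabilityMeasure P]

/-- A finite measure on the set of times that charges every time. -/
abbrev timeMeasure : Measure ℕ := (Measure.count : Measure ℕ).toFinite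

lemma ae_timeMeasure_iff {p : ℕ → Prop} : (∀ᵐ t ∂timeMeasure, p t) ↔ ∀ t, p t := by
  rw [ae_toFinite, Measure.ae_count_iff]

lemma ae_timeMeasure_prod_iff {Q : ℕ × Ω → Prop} :
    (∀ᵐ p ∂(timeMeasure.prod P), Q p) ↔ ∀ t, ∀ᵐ ω ∂P, Q (t, ω) := by
  constructor
  · intro h
    exact ae_timeMeasure_iff.1 (Measure.ae_ae_of_ae_prod h)
  · intro h
    have : {p : ℕ × Ω | ¬ Q p} ⊆ ⋃ t, {t} ×ˢ {ω | ¬ Q (t, ω)} := by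
      rintro ⟨t, ω⟩ hp
      exact Set.mem_iUnion.2 ⟨t, rfl, hp⟩
    refine measure_mono_null this (measure_iUnion_null fun t => ?_)
    rw [Measure.prod_prod, ae_iff.1 (h t), MulZeroClass.mul_zero]

end Timed

/-! ### Separation from the acceptance set by an integrable family. -/

section Separation

variable {Ω : Type*} {mΩ : MeasurableSpace Ω} {P : Measure Ω} [IsProbabilityMeasure P]
  {ℱ : Filtration ℕ mΩ} {τ θ : Ω → WithTop ℕ} {hτ : IsStoppingTime ℱ τ} {hθ : IsStoppingTime ℱ θ}
  {X Y Z a b : Proc P} {φ : Proc P → Ω →ₘ[P] EReal}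

lemma IsConcaveMonetaryUtility.mix_mem (hτθ : ∀ᵐ ω ∂P, τ ω ≤ θ ω)
    (hu : IsConcaveMonetaryUtility hτ hθ φ) (hX : X ∈ acceptanceSet hτ hθ φ)
    (hY : Y ∈ acceptanceSet hτ hθ φ) {l : Ω →ₘ[P] ℝ} (hl : l ∈ LInf P hτ) (h0 : 0 ≤ l)
    (h1 : l ≤ 1) : (fun t => l * X t + (1 - l) * Y t) ∈ acceptanceSet hτ hθ φ := by
  obtain ⟨hX, hX0⟩ := mem_acceptanceSet_iff.1 hX
  obtain ⟨hY, hY0⟩ := mem_acceptanceSet_iff.1 hY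
  refine mem_acceptanceSet_iff.2
    ⟨mix_mem_RInfStop hτθ hl (sub_mem_LInf one_mem_LInf hl) hX hY, ?_⟩
  filter_upwards [hu.concave X hX Y hY l hl h0 h1, hX0, hY0, AEEqFun.coeFn_le.2 h0,
    AEEqFun.coeFn_le.2 h1, AEEqFun.coeFn_zero (β := ℝ) (μ := P),
    AEEqFun.coeFn_one (β := ℝ) (μ := P)] with ω h2 h3 h4 h5 h6 h7 h8
  rw [h7] at h5
  rw [h8] at h6
  refine le_trans (add_nonneg (mul_nonneg (EReal.coe_nonneg.2 h5) h3)
    (mul_nonneg (EReal.coe_nonneg.2 (sub_nonneg.2 h6)) h4)) h2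

/-- A stopped process takes all its values in the time interval `[τ, θ]`. -/
lemma IsStopped.exists_time (hτθ : ∀ᵐ ω ∂P, τ ω ≤ θ ω) {Xn : ℕ → Proc P}
    (hX : ∀ n, IsStopped τ θ (Xn n)) : ∀ᵐ ω ∂P, ∀ t : ℕ, τ ω ≤ t →
      τ ω ≤ ((min (t : WithTop ℕ) (θ ω)).untopA : ℕ) ∧
      ((min (t : WithTop ℕ) (θ ω)).untopA : ℕ) ≤ θ ω ∧
      ∀ n, Xn n (min (t : WithTop ℕ) (θ ω)).untopA ω = Xn n t ω := by
  filter_upwards [hτθ, ae_all_iff.2 hX] with ω h1 h2 t ht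
  refine ⟨?_, ?_, fun n => apply_min_untopA (x := fun t => Xn n t ω) (fun s => (h2 n s).2) t⟩
  · obtain h | ⟨s, hs⟩ := eq_top_or_eq_natCast (θ ω)
    · rwa [h, untopA_min_top]
    · rw [hs] at h1 ⊢
      rw [untopA_min_natCast]
      rcases min_choice t s with h | h <;> rwa [h]
  · obtain h | ⟨s, hs⟩ := eq_top_or_eq_natCast (θ ω)
    · rw [h]; exact le_top
    · rw [hs, untopA_min_natCast]
      exact_mod_cast min_le_right _ _

/-- The set `{τ ≤ t ≤ θ}`. -/
def interval (τ θ : Ω → WithTop ℕ) (t : ℕ) : Set Ω := {ω | τ ω ≤ t ∧ t ≤ θ ω}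

lemma measurableSet_interval (hτ : IsStoppingTime ℱ τ) (hθ : IsStoppingTime ℱ θ) (t : ℕ) :
    MeasurableSet[ℱ t] (interval τ θ t) :=
  MeasurableSet.inter (hτ t) (hθ.measurableSet_ge t)

lemma measurable_of_sections {f : ℕ × Ω → ℝ} (h : ∀ t, Measurable fun ω => f (t, ω)) :
    Measurable f :=
  measurable_from_prod_countable_right h

lemma exists_separating_family (hτθ : ∀ᵐ ω ∂P, τ ω ≤ θ ω)
    (hu : IsConcaveMonetaryUtility hτ hθ φ) (hcont : ContinuousDecreasing hτ hθ φ)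
    (hZ : Z ∈ RInfStop P hτ hθ) (hZC : Z ∉ acceptanceSet hτ hθ φ) :
    ∃ G : ℕ → Ω → ℝ, (∀ t, Integrable (G t) P) ∧ ∫⁻ ω, ∑' t, ‖G t ω‖ₑ ∂P < ⊤ ∧
      (∀ t, ∀ ω ∉ interval τ θ t, G t ω = 0) ∧
      ∀ X ∈ acceptanceSet hτ hθ φ, 1 ≤ ∑' t, ∫ ω, (X t ω - Z t ω) * G t ω ∂P := by
  have hI : ∀ t, MeasurableSet (interval τ θ t) := fun t =>
    ℱ.le t _ (measurableSet_interval hτ hθ t)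
  have hRI := fun {X : Proc P} (hX : X ∈ RInfStop P hτ hθ) => (mem_RInfStop_iff hτθ).1 hX
  -- Translation by `Z` puts the point to be separated at 0. Restriction to `[τ, θ]` loses no
  -- information about stopped processes and allows the separating function to be cut off outside
  -- this interval.
  let C : Set (ℕ × Ω →ₘ[timeMeasure.prod P] ℝ) := {f | ∃ X ∈ acceptanceSet hτ hθ φ,
    ∀ t, ∀ᵐ ω ∂P, f (t, ω) = (interval τ θ t).indicator (fun ω => X t ω - Z t ω) ω}
  -- From `τ` on, a stopped process at time `t` has the value it takes at `t ∧ θ`, which lies in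
  -- `[τ, θ]`. Bounds on the interval thus hold at all times.
  have hdet : ∀ {X : Proc P}, X ∈ RInfStop P hτ hθ → ∀ c : ℝ, 0 ≤ c →
      (∀ t, ∀ᵐ ω ∂P, ω ∈ interval τ θ t → |X t ω - Z t ω| ≤ c) →
      ∀ᵐ ω ∂P, ∀ t, |X t ω - Z t ω| ≤ c := by
    intro X hX c hc0 hc
    filter_upwards [IsStopped.exists_time hτθ (Xn := fun _ : ℕ => X) fun _ => (hRI hX).2,
      IsStopped.exists_time hτθ (Xn := fun _ : ℕ => Z) fun _ => (hRI hZ).2, (hRI hX).2, (hRI hZ).2,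
      ae_all_iff.2 hc] with ω h1 h2 h3 h4 h5 t
    by_cases ht : τ ω ≤ t
    · obtain ⟨h6, h7, h8⟩ := h1 t ht
      rw [← h8 0, ← (h2 t ht).2.2 0]
      exact h5 _ ⟨h6, h7⟩
    · rw [(h3 t).1 ht, (h4 t).1 ht]
      simpa
  have hconv : Convex ℝ C := by
    rintro f ⟨X, hX, hf⟩ g ⟨Y, hY, hg⟩ r s hr hs hrs
    have hl0 : (0 : Ω →ₘ[P] ℝ) ≤ AEEqFun.const Ω r := by
      rw [← AEEqFun.coeFn_le]
      filter_upwards [AEEqFun.coeFn_zero (β := ℝ) (μ := P), AEEqFun.coeFn_const (μ := P) Ω r]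
        with ω h1 h2
      rw [h1, h2]
      exact hr
    have hl1 : AEEqFun.const Ω r ≤ (1 : Ω →ₘ[P] ℝ) := by
      rw [← AEEqFun.coeFn_le]
      filter_upwards [AEEqFun.coeFn_one (β := ℝ) (μ := P), AEEqFun.coeFn_const (μ := P) Ω r]
        with ω h1 h2
      rw [h1, h2]
      simp only [Function.const_apply, Pi.one_apply]
      linarith
    refine ⟨_, hu.mix_mem hτθ hX hY (const_mem_LInf r) hl0 hl1, fun t => ?_⟩
    filter_upwards [hf t, hg t, ae_timeMeasure_prod_iff.1 (AEEqFun.coeFn_add (r • f) (s • g)) t,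
      ae_timeMeasure_prod_iff.1 (AEEqFun.coeFn_smul r f) t,
      ae_timeMeasure_prod_iff.1 (AEEqFun.coeFn_smul s g) t,
      mix_ae (AEEqFun.const Ω r) (1 - AEEqFun.const Ω r) X Y,
      AEEqFun.coeFn_const (μ := P) Ω r, AEEqFun.coeFn_sub (1 : Ω →ₘ[P] ℝ) (AEEqFun.const Ω r),
      AEEqFun.coeFn_one (β := ℝ) (μ := P)] with ω h1 h2 h3 h4 h5 h6 h7 h8 h9
    rw [h3, Pi.add_apply, h4, h5, Pi.smul_apply, Pi.smul_apply, h1, h2]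
    by_cases hω : ω ∈ interval τ θ t
    · simp only [Set.indicator_of_mem hω, h6, h7, h8, h9, Pi.sub_apply, Pi.one_apply,
        Function.const_apply, smul_eq_mul]
      have : s = 1 - r := by linarith
      rw [this]
      ring
    · simp [Set.indicator_of_notMem hω]
  obtain ⟨cZ, hcZ⟩ := isBdd_of_mem hZ
  have hbdd : ∀ f ∈ C, ∃ c : ℝ, ∀ᵐ p ∂(timeMeasure.prod P), |f p| ≤ c := by
    rintro f ⟨X, hX, hf⟩
    obtain ⟨cX, hcX⟩ := isBdd_of_mem hX.1
    refine ⟨cX + cZ, ae_timeMeasure_prod_iff.2 fun t => ?_⟩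
    filter_upwards [hf t, hcX t, hcZ t] with ω h1 h2 h3
    have h4 : |X t ω - Z t ω| ≤ cX + cZ := (abs_sub _ _).trans (add_le_add h2 h3)
    rw [h1]
    by_cases hω : ω ∈ interval τ θ t
    · rwa [Set.indicator_of_mem hω]
    · rw [Set.indicator_of_notMem hω, abs_zero]
      exact (abs_nonneg _).trans h4
  have h0 : (0 : ℕ × Ω →ₘ[timeMeasure.prod P] ℝ) ∉ C := by
    rintro ⟨X, hX, hf⟩
    have h1 := hdet hX.1 0 le_rfl fun t => by
      filter_upwards [hf t, ae_timeMeasure_prod_iff.1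
        (AEEqFun.coeFn_zero (β := ℝ) (μ := timeMeasure.prod P)) t] with ω h1 h2 hω
      rw [h2, Set.indicator_of_mem hω] at h1
      rw [← h1]
      simp
    refine hZC ?_
    have : X = Z := by
      funext t
      refine AEEqFun.ext ?_
      filter_upwards [h1] with ω h
      exact sub_eq_zero.1 (abs_nonpos_iff.1 (h t))
    rwa [← this]
  have hclosed : ∀ (F : ℕ → ℕ × Ω →ₘ[timeMeasure.prod P] ℝ) (f : ℕ × Ω →ₘ[timeMeasure.prod P] ℝ)
      (c : ℝ), (∀ n, F n ∈ C) → (∀ n, ∀ᵐ p ∂(timeMeasure.prod P), |F n p| ≤ c) →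
      (∀ᵐ p ∂(timeMeasure.prod P), Tendsto (fun n => F n p) atTop (𝓝 (f p))) → f ∈ C := by
    intro F f c hF hFc hlim
    choose X hX hFX using hF
    have hFX' : ∀ᵐ ω ∂P, ∀ n t, F n (t, ω)
        = (interval τ θ t).indicator (fun ω => X n t ω - Z t ω) ω :=
      ae_all_iff.2 fun n => ae_all_iff.2 (hFX n)
    have hc0 : 0 ≤ max c 0 := le_max_right _ _
    have hXZ : ∀ n, ∀ᵐ ω ∂P, ∀ t, |X n t ω - Z t ω| ≤ max c 0 := fun n =>
      hdet (hX n).1 _ hc0 fun t => by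
        filter_upwards [hFX n t, ae_timeMeasure_prod_iff.1 (hFc n) t] with ω h1 h2 hω
        rw [h1, Set.indicator_of_mem hω] at h2
        exact h2.trans (le_max_left _ _)
    have hlim' : ∀ᵐ ω ∂P, ∀ t, Tendsto (fun n => F n (t, ω)) atTop (𝓝 (f (t, ω))) :=
      ae_all_iff.2 (ae_timeMeasure_prod_iff.1 hlim)
    have hVm : ∀ t, Measurable fun ω => f (t, ω) + Z t ω := fun t =>
      (f.stronglyMeasurable.measurable.comp measurable_prodMk_left).add
        (Z t).stronglyMeasurable.measurable
    -- The limit is determined only on `[τ, θ]`. Adding `Z` back and projecting extends it to a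
    -- stopped process.
    let V : Proc P := fun t => AEEqFun.mk _ (hVm t).aestronglyMeasurable
    have hV : ∀ᵐ ω ∂P, ∀ t, V t ω = f (t, ω) + Z t ω :=
      ae_all_iff.2 fun t => AEEqFun.coeFn_mk _ _
    have hXW : ∀ᵐ ω ∂P, ∀ t, Tendsto (fun n => X n t ω) atTop (𝓝 (proj hτ hθ V t ω)) := by
      filter_upwards [hFX', hlim', hV, proj_ae hτ hθ V,
        IsStopped.exists_time hτθ fun n => (hRI (hX n).1).2,
        ae_all_iff.2 fun n => (hRI (hX n).1).2] with ω h1 h2 h3 h4 h5 h6 t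
      by_cases ht : τ ω ≤ t
      · obtain ⟨h7, h8, h9⟩ := h5 t ht
        rw [(h4 t).1 ht, h3]
        have h10 := (h2 (min (t : WithTop ℕ) (θ ω)).untopA).add_const
          (Z (min (t : WithTop ℕ) (θ ω)).untopA ω)
        refine h10.congr fun n => ?_
        rw [h1, Set.indicator_of_mem (s := interval τ θ _) ⟨h7, h8⟩, sub_add_cancel, h9]
      · rw [(h4 t).2 ht]
        simp only [fun n => (h6 n t).1 ht]
        exact tendsto_const_nhds
    have hW : proj hτ hθ V ∈ acceptanceSet hτ hθ φ := by
      refine mem_acceptanceSet_of_tendsto hτθ hu hcont hX (c := max c 0 + cZ) (fun n t => ?_)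
        (ae_all_iff.1 hXW)
      filter_upwards [hXZ n, hcZ t] with ω h1 h2
      have h3 : X n t ω = (X n t ω - Z t ω) + Z t ω := by ring
      rw [h3]
      exact (abs_add_le _ _).trans (add_le_add (h1 t) h2)
    refine ⟨_, hW, fun t => ?_⟩
    filter_upwards [hFX', hlim', hXW] with ω h1 h2 h3
    refine tendsto_nhds_unique (h2 t) ?_
    simp only [h1]
    by_cases hω : ω ∈ interval τ θ t
    · simp only [Set.indicator_of_mem hω]
      exact (h3 t).sub_const _
    · simp only [Set.indicator_of_notMem hω]
      exact tendsto_const_nhds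
  obtain ⟨g, hg, hsep⟩ := exists_separating_integrable hconv hbdd hclosed h0
  -- The masses of the single times, absorbed into the family so that the integral over the product
  -- becomes a plain sum over times.
  let w : ℕ → ℝ := fun t => (timeMeasure : Measure ℕ).real {t}
  have hgt : ∀ t, Integrable (fun ω => g (t, ω)) P := ae_timeMeasure_iff.1 hg.prod_right_ae
  refine ⟨fun t => (interval τ θ t).indicator fun ω => w t * g (t, ω), fun t => ?_, ?_, ?_, ?_⟩
  · exact ((hgt t).const_mul _).indicator (hI t)
  · rw [lintegral_tsum fun t => (((hgt t).const_mul _).indicator (hI t)).aestronglyMeasurable.enorm]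
    refine lt_of_le_of_lt ?_ hg.2
    rw [lintegral_prod _ hg.aestronglyMeasurable.enorm, lintegral_countable']
    refine ENNReal.tsum_le_tsum fun t => ?_
    rw [← lintegral_mul_const'' _ (hgt t).aestronglyMeasurable.enorm]
    refine lintegral_mono fun ω => ?_
    have hw : ‖w t‖ₑ = timeMeasure {t} := by
      rw [Real.enorm_of_nonneg measureReal_nonneg]
      exact ENNReal.ofReal_toReal (measure_ne_top _ _)
    by_cases hω : ω ∈ interval τ θ t
    · rw [Set.indicator_of_mem hω, enorm_mul, hw, mul_comm]
    · rw [Set.indicator_of_notMem hω, enorm_zero]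
      exact zero_le
  · intro t ω hω
    exact Set.indicator_of_notMem hω _
  · intro X hX
    have hm : Measurable fun p : ℕ × Ω =>
        (interval τ θ p.1).indicator (fun ω => X p.1 ω - Z p.1 ω) p.2 :=
      measurable_of_sections fun t => ((X t).stronglyMeasurable.measurable.sub
        (Z t).stronglyMeasurable.measurable).indicator (hI t)
    let f : ℕ × Ω →ₘ[timeMeasure.prod P] ℝ := AEEqFun.mk _ hm.aestronglyMeasurable
    have hf : ∀ t, ∀ᵐ ω ∂P, f (t, ω)
        = (interval τ θ t).indicator (fun ω => X t ω - Z t ω) ω :=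
      ae_timeMeasure_prod_iff.1 (AEEqFun.coeFn_mk _ hm.aestronglyMeasurable)
    have hfC : f ∈ C := ⟨X, hX, hf⟩
    obtain ⟨c, hc⟩ := hbdd f hfC
    have hfg : Integrable (fun p => f p * g p) (timeMeasure.prod P) :=
      hg.bdd_mul f.aestronglyMeasurable hc
    refine (hsep f hfC).trans (le_of_eq ?_)
    rw [integral_prod _ hfg, integral_countable hfg.integral_prod_left]
    refine tsum_congr fun t => ?_
    rw [smul_eq_mul, ← integral_const_mul]
    refine integral_congr_ae ?_
    filter_upwards [hf t] with ω h
    simp only [h]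
    by_cases hω : ω ∈ interval τ θ t
    · simp only [Set.indicator_of_mem hω]
      ring
    · simp only [Set.indicator_of_notMem hω, MulZeroClass.mul_zero, MulZeroClass.zero_mul]

end Separation

/-! ### Positivity and division by a conditional expectation. -/

section Integrals

lemma ae_nonneg_of_forall_setIntegral {α : Type*} {m mα : MeasurableSpace α} {μ : Measure α}
    [IsProbabilityMeasure μ] (hm : m ≤ mα) {f : α → ℝ}
    (hf : AEStronglyMeasurable[m] f μ) (hi : Integrable f μ)
    (h : ∀ B, MeasurableSet[m] B → 0 ≤ ∫ ω in B, f ω ∂μ) : ∀ᵐ ω ∂μ, 0 ≤ f ω := by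
  obtain ⟨g, hg, hfg⟩ := hf
  have hB : MeasurableSet[m] {ω | g ω < 0} := hg.measurable measurableSet_Iio
  have hB' := hm _ hB
  have h1 : ∀ᵐ ω ∂μ, ω ∈ {ω | g ω < 0} → f ω < 0 := by
    filter_upwards [hfg] with ω h1 h2
    rw [h1]
    exact h2
  have h2 : 0 ≤ᵐ[μ.restrict {ω | g ω < 0}] fun ω => -f ω := by
    rw [EventuallyLE, ae_restrict_iff' hB']
    filter_upwards [h1] with ω h3 h4
    simpa using (h3 h4).le
  have h3 : ∫ ω in {ω | g ω < 0}, -f ω ∂μ ≤ 0 := by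
    rw [integral_neg]
    linarith [h _ hB]
  have h4 := (setIntegral_eq_zero_iff_of_nonneg_ae h2 hi.neg.integrableOn).1
    (le_antisymm h3 (integral_nonneg_of_ae h2))
  rw [EventuallyEq, ae_restrict_iff' hB'] at h4
  filter_upwards [h1, h4, hfg] with ω h5 h6 h7
  by_contra hlt
  have h8 : ω ∈ {ω | g ω < 0} := by
    rw [not_le, h7] at hlt
    exact hlt
  have h9 := h5 h8
  have h10 : -f ω = 0 := h6 h8
  linarith

/-- Dividing a nonnegative random variable by its conditional expectation gives an integrable
random variable. -/
lemma integrable_inv_condExp_mul {α : Type*} {m mα : MeasurableSpace α} {μ : Measure α}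
    [IsProbabilityMeasure μ] (hm : m ≤ mα) {N : α → ℝ}
    (hN : Integrable N μ) (hN0 : ∀ᵐ ω ∂μ, 0 ≤ N ω) :
    Integrable (fun ω => ((μ[N | m]) ω)⁻¹ * N ω) μ := by
  have hum : StronglyMeasurable[m] (μ[N | m]) := stronglyMeasurable_condExp
  have hu0 : ∀ᵐ ω ∂μ, 0 ≤ (μ[N | m]) ω := condExp_nonneg hN0
  have hvm : Measurable[m] fun ω => ((μ[N | m]) ω)⁻¹ := hum.measurable.inv
  have hvm' := hvm.mono hm le_rfl
  have hsm : AEStronglyMeasurable (fun ω => ((μ[N | m]) ω)⁻¹ * N ω) μ :=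
    hvm'.aestronglyMeasurable.mul hN.aestronglyMeasurable
  -- With a bounded multiplier, `E[v_n N] = E[v_n E[N | m]] ≤ 1`, and Fatou's lemma removes the
  -- truncation. Where `E[N | m] = 0` the inverse is 0, which respects the bound.
  let v : ℕ → α → ℝ := fun n ω => min ((μ[N | m]) ω)⁻¹ n
  have hvn : ∀ n, Measurable[m] (v n) := fun n => hvm.min measurable_const
  have hvb : ∀ n, ∀ᵐ ω ∂μ, 0 ≤ v n ω ∧ ‖v n ω‖ ≤ n := by
    intro n
    filter_upwards [hu0] with ω h
    have h1 : 0 ≤ v n ω := le_min (inv_nonneg.2 h) n.cast_nonneg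
    refine ⟨h1, ?_⟩
    rw [Real.norm_of_nonneg h1]
    exact min_le_right _ _
  have hint : ∀ n, Integrable (fun ω => v n ω * N ω) μ := fun n =>
    hN.bdd_mul ((hvn n).mono hm le_rfl).aestronglyMeasurable ((hvb n).mono fun ω h => h.2)
  have hle : ∀ n, ∫⁻ ω, ENNReal.ofReal (v n ω * N ω) ∂μ ≤ 1 := by
    intro n
    rw [← ofReal_integral_eq_lintegral_ofReal (hint n) (by
      filter_upwards [hvb n, hN0] with ω h1 h2 using mul_nonneg h1.1 h2), ← ENNReal.ofReal_one]
    refine ENNReal.ofReal_le_ofReal ?_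
    rw [← integral_condExp hm (f := fun ω => v n ω * N ω)]
    have h1 : ∫ ω, (μ[fun ω => v n ω * N ω | m]) ω ∂μ ≤ ∫ _, (1 : ℝ) ∂μ := by
      refine integral_mono_ae integrable_condExp (integrable_const _) ?_
      filter_upwards [condExp_stronglyMeasurable_mul_of_bound₀ hm
        (hvn n).stronglyMeasurable.aestronglyMeasurable hN n ((hvb n).mono fun ω h => h.2), hu0]
        with ω h1 h2
      refine (le_of_eq h1).trans ?_
      calc v n ω * (μ[N | m]) ω ≤ ((μ[N | m]) ω)⁻¹ * (μ[N | m]) ω :=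
            mul_le_mul_of_nonneg_right (min_le_left _ _) h2
        _ ≤ 1 := inv_mul_le_one
    simpa using h1
  refine ⟨hsm, ?_⟩
  have hlim : ∀ ω, Tendsto (fun n : ℕ => ENNReal.ofReal (v n ω * N ω)) atTop
      (𝓝 (ENNReal.ofReal (((μ[N | m]) ω)⁻¹ * N ω))) := by
    intro ω
    refine (ENNReal.continuous_ofReal.tendsto _).comp (Tendsto.mul_const _ ?_)
    refine tendsto_const_nhds.congr' ?_
    obtain ⟨n, hn⟩ := exists_nat_ge ((μ[N | m]) ω)⁻¹
    filter_upwards [eventually_ge_atTop n] with k hk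
    exact (min_eq_left (hn.trans (by exact_mod_cast hk))).symm
  have h2 : ∫⁻ ω, ENNReal.ofReal (((μ[N | m]) ω)⁻¹ * N ω) ∂μ ≤ 1 := by
    calc ∫⁻ ω, ENNReal.ofReal (((μ[N | m]) ω)⁻¹ * N ω) ∂μ
        = ∫⁻ ω, liminf (fun n : ℕ => ENNReal.ofReal (v n ω * N ω)) atTop ∂μ :=
          lintegral_congr fun ω => (hlim ω).liminf_eq.symm
      _ ≤ liminf (fun n : ℕ => ∫⁻ ω, ENNReal.ofReal (v n ω * N ω) ∂μ) atTop :=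
          lintegral_liminf_le' fun n => (hint n).aestronglyMeasurable.aemeasurable.ennreal_ofReal
      _ ≤ 1 := liminf_le_of_le (by isBoundedDefault) fun b hb => by
          obtain ⟨n, hn⟩ := hb.exists
          exact hn.trans (hle n)
  have h3 : ∫⁻ ω, ‖((μ[N | m]) ω)⁻¹ * N ω‖ₑ ∂μ
      = ∫⁻ ω, ENNReal.ofReal (((μ[N | m]) ω)⁻¹ * N ω) ∂μ := by
    refine lintegral_congr_ae ?_
    filter_upwards [hN0, hu0] with ω h1 h2
    exact Real.enorm_of_nonneg (mul_nonneg (inv_nonneg.2 h2) h1)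
  rw [HasFiniteIntegral, h3]
  exact h2.trans_lt ENNReal.one_lt_top

end Integrals

/-! ### A nonnegative adapted separating density. -/

section Density

variable {Ω : Type*} {mΩ : MeasurableSpace Ω} {P : Measure Ω} [IsProbabilityMeasure P]
  {ℱ : Filtration ℕ mΩ} {τ θ : Ω → WithTop ℕ} {hτ : IsStoppingTime ℱ τ} {hθ : IsStoppingTime ℱ θ}
  {X Y Z a b d : Proc P} {φ : Proc P → Ω →ₘ[P] EReal}

lemma IsConcaveMonetaryUtility.map_zero (hτθ : ∀ᵐ ω ∂P, τ ω ≤ θ ω)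
    (hu : IsConcaveMonetaryUtility hτ hθ φ) : ∀ᵐ ω ∂P, φ 0 ω = 0 := by
  have h := hu.localProperty 0 (zero_mem_RInfStop hτθ) ∅ (@MeasurableSet.empty Ω hτ.measurableSpace)
  have h0 : (fun t => ind P (hτ.measurableSpace_le ∅ (@MeasurableSet.empty Ω hτ.measurableSpace)) * (0 : Proc P) t) = 0 :=
    funext fun t => CondUtility.mul_zero _
  rw [h0] at h
  filter_upwards [h] with ω h1
  rw [h1, Set.indicator_empty]

lemma IsConcaveMonetaryUtility.mem_of_nonneg (hτθ : ∀ᵐ ω ∂P, τ ω ≤ θ ω)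
    (hu : IsConcaveMonetaryUtility hτ hθ φ) (hX : X ∈ RInfStop P hτ hθ)
    (h : ∀ t, ∀ᵐ ω ∂P, 0 ≤ X t ω) : X ∈ acceptanceSet hτ hθ φ := by
  refine mem_acceptanceSet_iff.2 ⟨hX, ?_⟩
  have h0 : ∀ t, ∀ᵐ ω ∂P, (0 : Proc P) t ω ≤ X t ω := fun t => by
    filter_upwards [h t, AEEqFun.coeFn_zero (β := ℝ) (μ := P)] with ω h1 h2
    have h3 : (0 : Proc P) t ω = 0 := h2
    rwa [h3]
  filter_upwards [hu.mono_ae (zero_mem_RInfStop hτθ) hX h0, hu.map_zero hτθ] with ω h1 h2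
  rwa [h2] at h1

lemma zero_mem_acceptanceSet (hτθ : ∀ᵐ ω ∂P, τ ω ≤ θ ω)
    (hu : IsConcaveMonetaryUtility hτ hθ φ) : 0 ∈ acceptanceSet hτ hθ φ :=
  hu.mem_of_nonneg hτθ (zero_mem_RInfStop hτθ) fun t => by
    filter_upwards [AEEqFun.coeFn_zero (β := ℝ) (μ := P)] with ω h
    have h3 : (0 : Proc P) t ω = 0 := h
    rw [h3]

/-- A process outside of the acceptance set is separated from it by a positive density. -/
lemma exists_separating_density (hτθ : ∀ᵐ ω ∂P, τ ω ≤ θ ω)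
    (hu : IsConcaveMonetaryUtility hτ hθ φ) (hcont : ContinuousDecreasing hτ hθ φ)
    (hZ : Z ∈ RInfStop P hτ hθ) (hZC : Z ∉ acceptanceSet hτ hθ φ) :
    ∃ d : Proc P, IsDensity ℱ τ θ d ∧
      ∀ X ∈ acceptanceSet hτ hθ φ, 1 + ∫ ω, series Z d ω ∂P ≤ ∫ ω, series X d ω ∂P := by
  obtain ⟨G, hG, hGfin, hGsupp, hsep⟩ := exists_separating_family hτθ hu hcont hZ hZC
  let d := adaptedPart P ℱ G
  have hdfin : ∫⁻ ω, ∑' t, ‖d t ω‖ₑ ∂P < ⊤ :=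
    lintegral_adaptedPart_lt_top (fun t => (hG t).aestronglyMeasurable) hGfin
  have hsupp := adaptedPart_support (P := P) (measurableSet_interval hτ hθ) hG hGsupp
  have hser : ∀ W ∈ RInf P ℱ, ∫ ω, series W d ω ∂P = ∑' t, ∫ ω, W t ω * G t ω ∂P := by
    intro W hW
    rw [integral_series hW.2 hdfin]
    exact tsum_congr fun t => integral_mul_adaptedPart hW (hG t)
  have hR := fun {X : Proc P} (hX : X ∈ RInfStop P hτ hθ) => ((mem_RInfStop_iff hτθ).1 hX).1
  have hsep' : ∀ X ∈ acceptanceSet hτ hθ φ,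
      1 + ∫ ω, series Z d ω ∂P ≤ ∫ ω, series X d ω ∂P := by
    intro X hX
    have hW : (fun t => 1 * X t + AEEqFun.const Ω (-1) * Z t) ∈ RInfStop P hτ hθ :=
      mix_mem_RInfStop hτθ one_mem_LInf (const_mem_LInf _) hX.1 hZ
    have h1 := hsep X hX
    have h2 : ∀ᵐ ω ∂P, ∀ t, ((1 * X t + AEEqFun.const Ω (-1) * Z t : Ω →ₘ[P] ℝ)) ω = X t ω - Z t ω := by
      filter_upwards [mix_ae 1 (AEEqFun.const Ω (-1)) X Z,
        AEEqFun.coeFn_one (β := ℝ) (μ := P), AEEqFun.coeFn_const (μ := P) Ω (-1 : ℝ)]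
        with ω h1 h2 h3 t
      rw [h1, h2, h3, Pi.one_apply, Function.const_apply]
      ring
    have h3 : ∑' t, ∫ ω, (X t ω - Z t ω) * G t ω ∂P
        = ∫ ω, series (fun t => 1 * X t + AEEqFun.const Ω (-1) * Z t) d ω ∂P := by
      rw [hser _ (hR hW)]
      refine tsum_congr fun t => integral_congr_ae ?_
      filter_upwards [h2] with ω h
      rw [h]
    have h4 : ∫ ω, series (fun t => 1 * X t + AEEqFun.const Ω (-1) * Z t) d ω ∂P
        = ∫ ω, (series X d ω - series Z d ω) ∂P := by
      refine integral_congr_ae ?_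
      filter_upwards [series_mix_left 1 (AEEqFun.const Ω (-1)) (hR hX.1).2 (hR hZ).2 hdfin,
        AEEqFun.coeFn_one (β := ℝ) (μ := P), AEEqFun.coeFn_const (μ := P) Ω (-1 : ℝ)]
        with ω h1 h2 h3
      rw [h1, h2, h3, Pi.one_apply, Function.const_apply]
      ring
    rw [h3, h4, integral_sub (integrable_series (hR hX.1).2 hdfin)
      (integrable_series (hR hZ).2 hdfin)] at h1
    linarith
  have hpos : ∀ W ∈ RInfStop P hτ hθ, (∀ t, ∀ᵐ ω ∂P, 0 ≤ W t ω) →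
      0 ≤ ∫ ω, series W d ω ∂P := by
    intro W hW hW0
    -- All multiples `n W` of a nonnegative `W` are acceptable. A negative integral of `W` would
    -- exceed any fixed lower bound after scaling.
    have h1 : ∀ n : ℕ, 1 + ∫ ω, series Z d ω ∂P ≤ n * ∫ ω, series W d ω ∂P := by
      intro n
      have hc := const_mem_LInf (hτ := hτ) (P := P) (n : ℝ)
      have h2 := hsep' _ (hu.mem_of_nonneg hτθ (mul_mem_RInfStop hτθ hc hW) fun t => by
        filter_upwards [mul_ae (AEEqFun.const Ω (n : ℝ)) W, hW0 t,
          AEEqFun.coeFn_const (μ := P) Ω (n : ℝ)] with ω h1 h2 h3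
        rw [h1, h3]
        exact mul_nonneg n.cast_nonneg h2)
      rw [← integral_const_mul]
      refine h2.trans (le_of_eq (integral_congr_ae ?_))
      filter_upwards [mul_ae (AEEqFun.const Ω (n : ℝ)) W,
        AEEqFun.coeFn_const (μ := P) Ω (n : ℝ)] with ω h1 h2
      simp only [series, h1, h2, Function.const_apply, mul_assoc, tsum_mul_left]
    by_contra! hneg
    obtain ⟨n, hn⟩ := exists_nat_gt ((1 + ∫ ω, series Z d ω ∂P) / ∫ ω, series W d ω ∂P)
    rw [div_lt_iff_of_neg hneg] at hn
    linarith [h1 n]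
  refine ⟨d, ⟨isAdapted_adaptedPart G, hdfin, ?_, hsupp⟩, hsep'⟩
  refine ae_all_iff.2 fun t => ?_
  have hdi : Integrable (d t) P := by
    refine integrable_condExp.congr (f := P[G t | ℱ t]) ?_
    filter_upwards [adaptedPart_ae (P := P) (ℱ := ℱ) G] with ω h
    rw [← h]
  refine ae_nonneg_of_forall_setIntegral (ℱ.le t) (isAdapted_adaptedPart G t) hdi fun B hB => ?_
  have hB' := ℱ.le t _ hB
  -- The test process is `1_B` at the single time `t`. Projection does not change it on `[τ, θ]`,
  -- where `d` is supported, so its pairing is the integral of `d t` over `B`.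
  let V : Proc P := fun s => if s = t then ind P hB' else 0
  have hVt : ∀ᵐ ω ∂P, ∀ s, V s ω = if s = t then B.indicator (fun _ => (1 : ℝ)) ω else 0 := by
    filter_upwards [ind_ae (P := P) hB', AEEqFun.coeFn_zero (β := ℝ) (μ := P)] with ω h1 h2 s
    by_cases hs : s = t
    · simp only [V, hs, if_true, h1]
    · simp only [V, hs, if_false, h2, Pi.zero_apply]
  have hV : V ∈ RInf P ℱ := by
    refine ⟨fun s => ?_, 1, fun s => ?_⟩
    · by_cases hs : s = t
      · subst hs
        simp only [V, if_true]
        exact ⟨_, stronglyMeasurable_const.indicator hB, ind_ae hB'⟩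
      · simp only [V, hs, if_false]
        exact ⟨_, stronglyMeasurable_zero, AEEqFun.coeFn_zero⟩
    · filter_upwards [hVt] with ω h
      rw [h]
      by_cases hs : s = t <;> by_cases hω : ω ∈ B <;> simp [hs, hω]
  have h1 := hpos (proj hτ hθ V) ⟨V, hV, rfl⟩ fun s => by
    filter_upwards [proj_ae hτ hθ V, hVt] with ω h1 h2
    by_cases hs : τ ω ≤ s
    · rw [(h1 s).1 hs, h2]
      split_ifs
      · exact Set.indicator_nonneg (fun _ _ => zero_le_one) _
      · exact le_rfl
    · rw [(h1 s).2 hs]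
  refine h1.trans (le_of_eq ?_)
  rw [← integral_indicator hB']
  refine integral_congr_ae ?_
  filter_upwards [proj_ae hτ hθ V, hVt, hsupp] with ω h1 h2 h3
  have h4 : ∀ s, proj hτ hθ V s ω * d s ω = V s ω * d s ω := by
    intro s
    by_cases hs : ω ∈ interval τ θ s
    · rw [(h1 s).1 hs.1, untopA_min_of_le hs.2]
    · have h5 : d s ω = 0 := h3 s hs
      rw [h5, MulZeroClass.mul_zero, MulZeroClass.mul_zero]
  simp only [series, h4]
  rw [tsum_eq_single t fun s hs => by rw [h2, if_neg hs, MulZeroClass.zero_mul], h2, if_pos rfl]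
  by_cases hω : ω ∈ B <;> simp [hω]

end Density

/-! ### Normalization of densities and pasting of acceptable processes. -/

section Normalization

variable {Ω : Type*} {mΩ : MeasurableSpace Ω} {P : Measure Ω} [IsProbabilityMeasure P]
  {ℱ : Filtration ℕ mΩ} {τ θ : Ω → WithTop ℕ} {hτ : IsStoppingTime ℱ τ} {hθ : IsStoppingTime ℱ θ}
  {X Y Z a b d : Proc P} {φ : Proc P → Ω →ₘ[P] EReal}

/-- The integral of a process against a density is a weighted expectation of its conditional
pairing with a normalized density. -/
lemma IsDensity.exists_normalized (hτfin : ∀ᵐ ω ∂P, τ ω < ⊤) (hτθ : ∀ᵐ ω ∂P, τ ω ≤ θ ω)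
    (hd : IsDensity ℱ τ θ d) : ∃ a ∈ DStop P hτ hθ, ∃ u : Ω → ℝ,
      Integrable u P ∧ (∀ᵐ ω ∂P, 0 ≤ u ω) ∧
      ∀ X, IsBdd X → ∫ ω, u ω * condPairing hτ θ X a ω ∂P = ∫ ω, series X d ω ∂P := by
  have hm := hτ.measurableSpace_le
  have hN : Integrable (series 1 d) P := integrable_series isBdd_one hd.lintegral
  have hN0 : ∀ᵐ ω ∂P, 0 ≤ series 1 d ω := by
    filter_upwards [hd.nonneg, one_ae (P := P)] with ω h1 h2
    refine tsum_nonneg fun t => ?_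
    rw [h2, one_mul]
    exact h1 t
  let u : Ω → ℝ := P[series 1 d | hτ.measurableSpace]
  have hum : StronglyMeasurable[hτ.measurableSpace] u := stronglyMeasurable_condExp
  have hu0 : ∀ᵐ ω ∂P, 0 ≤ u ω := condExp_nonneg hN0
  have hvm : Measurable[hτ.measurableSpace] fun ω => (u ω)⁻¹ := hum.measurable.inv
  have hvm' := (hvm.mono hm le_rfl).aestronglyMeasurable (μ := P)
  let v : Ω →ₘ[P] ℝ := AEEqFun.mk (fun ω => (u ω)⁻¹) hvm'
  have hv : ∀ᵐ ω ∂P, v ω = (u ω)⁻¹ := AEEqFun.coeFn_mk _ _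
  have hvτ : AEStronglyMeasurable[hτ.measurableSpace] v P := ⟨_, hvm.stronglyMeasurable, hv⟩
  have hB : MeasurableSet[hτ.measurableSpace] {ω | u ω = 0} :=
    hum.measurable (measurableSet_singleton 0)
  have hB' := hm _ hB
  let k : Ω →ₘ[P] ℝ := ind P hB'
  have hk : ∀ᵐ ω ∂P, k ω = {ω | u ω = 0}.indicator (fun _ => (1 : ℝ)) ω := ind_ae hB'
  have hkL : k ∈ LInf P hτ := ind_mem_LInf hB hB'
  have hk0 : ∀ᵐ ω ∂P, 0 ≤ k ω := by
    filter_upwards [hk] with ω h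
    rw [h]
    exact Set.indicator_nonneg (fun _ _ => zero_le_one) _
  obtain ⟨a₀, ha₀⟩ := nonempty_DStop (hτ := hτ) (hθ := hθ) hτfin hτθ
  obtain ⟨hd₀, hp₀⟩ := (mem_DStop_iff hτθ).1 ha₀
  have hvN : Integrable (fun ω => v ω * series 1 d ω) P := by
    refine (integrable_inv_condExp_mul hm hN hN0).congr ?_
    filter_upwards [hv] with ω h
    rw [h]
  have hkN : Integrable (fun ω => k ω * series 1 (incr a₀) ω) P := by
    obtain ⟨-, c, hc⟩ := hkL
    exact (integrable_series isBdd_one hd₀.lintegral).bdd_mul k.aestronglyMeasurable hc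
  -- Where `u > 0` the density is divided by its conditional mass. Where `u = 0`, `v` is 0 by the
  -- convention for inverses and the fixed element `a₀` fills in. The factor `v` may be unbounded,
  -- so integrability rests on `integrable_inv_condExp_mul`.
  let e : Proc P := fun t => v * d t + k * incr a₀ t
  have he : ∀ᵐ ω ∂P, ∀ t, e t ω = v ω * d t ω + k ω * incr a₀ t ω := mix_ae v k d (incr a₀)
  have he0 : ∀ᵐ ω ∂P, ∀ t, 0 ≤ e t ω := by
    filter_upwards [he, hv, hu0, hk0, hd.nonneg, hd₀.nonneg] with ω h1 h2 h3 h4 h5 h6 t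
    rw [h1, h2]
    exact add_nonneg (mul_nonneg (inv_nonneg.2 h3) (h5 t)) (mul_nonneg h4 (h6 t))
  have hes : ∀ X, IsBdd X → ∀ᵐ ω ∂P,
      series X e ω = v ω * series X d ω + k ω * series X (incr a₀) ω := fun X hX =>
    series_mix_right v k hX hd.lintegral hd₀.lintegral
  have hdens : IsDensity ℱ τ θ e := by
    refine ⟨fun t => ?_, ?_, he0, ?_⟩
    · exact ((isAdapted_mul hvτ hd.adapted
        (hd.support.mono fun ω h t ht => h t fun h' => ht h'.1) t).add
        (isAdapted_mul hkL.1 hd₀.adapted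
          (hd₀.support.mono fun ω h t ht => h t fun h' => ht h'.1) t)).congr
          (AEEqFun.coeFn_add _ _).symm
    · have h : ∀ᵐ ω ∂P, ∑' t, ‖e t ω‖ₑ
          = ENNReal.ofReal (v ω * series 1 d ω + k ω * series 1 (incr a₀) ω) := by
        filter_upwards [hes 1 isBdd_one, he0, he, one_ae (P := P),
          ae_summable_mul isBdd_one hd.lintegral, ae_summable_mul isBdd_one hd₀.lintegral]
          with ω h1 h2 h3 h4 h5 h6
        simp only [h4, one_mul] at h5 h6
        rw [← h1]
        simp only [series, h4, one_mul, Real.enorm_of_nonneg (h2 _)]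
        refine (ENNReal.ofReal_tsum_of_nonneg h2 ?_).symm
        simp only [h3]
        exact (h5.mul_left _).add (h6.mul_left _)
      rw [lintegral_congr_ae h]
      exact (hvN.add hkN).lintegral_lt_top
    · filter_upwards [he, hd.support, hd₀.support] with ω h1 h2 h3 t ht
      rw [h1, h2 t ht, h3 t ht, MulZeroClass.mul_zero, MulZeroClass.mul_zero, add_zero]
  have hdens' : IsDensity ℱ τ θ (incr (ofIncr e)) := by rwa [incr_ofIncr]
  have ha : ofIncr e ∈ DStop P hτ hθ := by
    refine (mem_DStop_iff hτθ).2 ⟨hdens', AEEqFun.ext ?_⟩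
    have h0 := condPairing_ae hτ hdens'.support 1
    rw [incr_ofIncr] at h0
    have h1 : P[series 1 e | hτ.measurableSpace] =ᵐ[P]
        P[(v * series 1 d : Ω → ℝ) + (k * series 1 (incr a₀) : Ω → ℝ)| hτ.measurableSpace] :=
      condExp_congr_ae (hes 1 isBdd_one)
    have h2 := condExp_add (m := hτ.measurableSpace) hvN hkN
    have h3 := condExp_mul_of_aestronglyMeasurable_left hvτ hvN hN
    have h4 := condExp_mul_of_aestronglyMeasurable_left hkL.1 hkN
      (integrable_series isBdd_one hd₀.lintegral)
    have h5 := condPairing_ae hτ hd₀.support 1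
    rw [hp₀] at h5
    filter_upwards [h0, h1, h2, h3, h4, h5, hv, hk,
      AEEqFun.coeFn_one (β := ℝ) (μ := P)] with ω h0 h1 h2 h3 h4 h5 h6 h7 h8
    rw [h0, h1, h8]
    refine h2.trans ?_
    rw [Pi.add_apply]
    refine (congrArg₂ (· + ·) h3 h4).trans ?_
    simp only [Pi.mul_apply]
    rw [← h5, h8, h6, h7]
    change (u ω)⁻¹ * u ω + _ = _
    by_cases h : u ω = 0
    · simp [h]
    · simp [h]
  -- On `{u = 0}` the nonnegative total mass of `d` has integral 0. So `d` vanishes there, and its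
  -- replacement by `a₀` does not affect the identity `d = u e`.
  have hNB : ∀ᵐ ω ∂P, u ω = 0 → series 1 d ω = 0 := by
    have h1 : ∫ ω in {ω | u ω = 0}, series 1 d ω ∂P = 0 := by
      rw [← setIntegral_condExp hm hN hB, setIntegral_congr_fun (g := fun _ => (0 : ℝ)) hB'
        fun ω hω => hω]
      simp
    have h2 := (setIntegral_eq_zero_iff_of_nonneg_ae (ae_restrict_of_ae hN0) hN.integrableOn).1 h1
    rw [EventuallyEq, ae_restrict_iff' hB'] at h2
    exact h2
  have hsd : ∀ᵐ ω ∂P, u ω = 0 → ∀ t, d t ω = 0 := by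
    filter_upwards [hNB, hd.nonneg, one_ae (P := P), ae_summable_mul isBdd_one hd.lintegral]
      with ω h1 h2 h3 h4 h5
    simp only [h3, one_mul] at h4
    have h6 := h1 h5
    simp only [series, h3, one_mul] at h6
    have h7 := (hasSum_zero_iff_of_nonneg h2).1 (h6 ▸ h4.hasSum)
    exact fun t => congrFun h7 t
  refine ⟨_, ha, u, integrable_condExp, hu0, fun X hX => ?_⟩
  have hX' : ∀ᵐ ω ∂P, series X d ω = u ω * series X (incr (ofIncr e)) ω := by
    rw [incr_ofIncr]
    filter_upwards [hes X hX, hv, hk, hsd] with ω h1 h2 h3 h4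
    rw [h1, h2, h3]
    by_cases h : u ω = 0
    · simp [series, h4 h, h]
    · rw [Set.indicator_of_notMem (s := {ω | u ω = 0}) h]
      field_simp
      simp
  rw [integral_mul_condPairing hdens' hX hum.aestronglyMeasurable
    ((integrable_series hX hd.lintegral).congr hX')]
  exact (integral_congr_ae hX').symm

/-- Two elements of the acceptance set can be pasted to one with the smaller conditional
pairing. -/
lemma IsConcaveMonetaryUtility.exists_condPairing_le_min (hτθ : ∀ᵐ ω ∂P, τ ω ≤ θ ω)
    (hu : IsConcaveMonetaryUtility hτ hθ φ) (ha : IsDensity ℱ τ θ (incr a))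
    (hX : X ∈ acceptanceSet hτ hθ φ) (hY : Y ∈ acceptanceSet hτ hθ φ) :
    ∃ W ∈ acceptanceSet hτ hθ φ, ∀ᵐ ω ∂P,
      condPairing hτ θ W a ω ≤ condPairing hτ θ X a ω ∧
      condPairing hτ θ W a ω ≤ condPairing hτ θ Y a ω := by
  obtain ⟨f, hf, hXf⟩ := aestronglyMeasurable_condPairing (hτ := hτ) (θ := θ) X a
  obtain ⟨g, hg, hYg⟩ := aestronglyMeasurable_condPairing (hτ := hτ) (θ := θ) Y a
  -- The pasting uses `X` where its form is the smaller one and `Y` elsewhere; this event belongs to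
  -- `ℱ_τ`.
  have hA : MeasurableSet[hτ.measurableSpace] {ω | f ω ≤ g ω} :=
    measurableSet_le (mδ := hτ.measurableSpace) hf.measurable hg.measurable
  have hA' := hτ.measurableSpace_le _ hA
  have hl := ind_mem_LInf (P := P) hA hA'
  have hi := ind_ae (P := P) hA'
  have h0 : 0 ≤ ind P hA' := by
    rw [← AEEqFun.coeFn_le]
    filter_upwards [hi, AEEqFun.coeFn_zero (β := ℝ) (μ := P)] with ω h1 h2
    rw [h1, h2]
    exact Set.indicator_nonneg (fun _ _ => zero_le_one) _
  have h1 : ind P hA' ≤ 1 := by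
    rw [← AEEqFun.coeFn_le]
    filter_upwards [hi, AEEqFun.coeFn_one (β := ℝ) (μ := P)] with ω h1 h2
    rw [h1, h2]
    exact Set.indicator_le_self' (fun _ _ => zero_le_one) _
  refine ⟨_, hu.mix_mem hτθ hX hY hl h0 h1, ?_⟩
  filter_upwards [condPairing_mix_left ha (isBdd_of_mem hX.1) (isBdd_of_mem hY.1) hl
    (sub_mem_LInf one_mem_LInf hl), hi, hXf, hYg, AEEqFun.coeFn_sub 1 (ind P hA'),
    AEEqFun.coeFn_one (β := ℝ) (μ := P)] with ω h1 h2 h3 h4 h5 h6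
  rw [h1, h5, Pi.sub_apply, h6, h2, h3, h4, Pi.one_apply]
  by_cases h : f ω ≤ g ω
  · rw [Set.indicator_of_mem (s := {ω | f ω ≤ g ω}) h]
    simpa using h
  · rw [Set.indicator_of_notMem (s := {ω | f ω ≤ g ω}) h]
    simpa using (not_le.1 h).le

end Normalization

/-! ### The dual functional `φ^#` and the representation. -/

section Dual

variable {Ω : Type*} {mΩ : MeasurableSpace Ω} {P : Measure Ω} [IsProbabilityMeasure P]
  {ℱ : Filtration ℕ mΩ} {τ θ : Ω → WithTop ℕ} {hτ : IsStoppingTime ℱ τ} {hθ : IsStoppingTime ℱ θ}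
  {X Y Z a b : Proc P} {γ φ : Proc P → Ω →ₘ[P] EReal}

lemma phiSharp_le (hX : X ∈ acceptanceSet hτ hθ φ) (a : Proc P) :
    ∀ᵐ ω ∂P, phiSharp hτ hθ φ a ω ≤ ((condPairing hτ θ X a ω : ℝ) : EReal) := by
  filter_upwards [essInfimum_le (Set.mem_image_of_mem
    (fun X => toE (condPairing hτ θ X a)) hX), toE_ae (condPairing hτ θ X a)] with ω h1 h2
  rwa [h2] at h1

lemma le_phiSharp {g : Ω → EReal} (hg : AEStronglyMeasurable g P)
    (h : ∀ X ∈ acceptanceSet hτ hθ φ, ∀ᵐ ω ∂P, g ω ≤ ((condPairing hτ θ X a ω : ℝ) : EReal)) :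
    ∀ᵐ ω ∂P, g ω ≤ phiSharp hτ hθ φ a ω := by
  refine le_essInfimum hg ?_
  rintro _ ⟨X, hX, rfl⟩
  filter_upwards [h X hX, toE_ae (condPairing hτ θ X a)] with ω h1 h2
  rwa [h2]

lemma aestronglyMeasurable_phiSharp (hC : (acceptanceSet hτ hθ φ).Nonempty) (a : Proc P) :
    AEStronglyMeasurable[hτ.measurableSpace] (phiSharp hτ hθ φ a) P := by
  refine aestronglyMeasurable_essInfimum (hC.image _) ?_
  rintro _ ⟨X, -, rfl⟩
  exact (continuous_coe_real_ereal.comp_aestronglyMeasurable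
    (aestronglyMeasurable_condPairing X a)).congr (EventuallyEq.symm (toE_ae _))

lemma IsConcaveMonetaryUtility.exists_condPairing_le (hτθ : ∀ᵐ ω ∂P, τ ω ≤ θ ω)
    (hu : IsConcaveMonetaryUtility hτ hθ φ) (ha : IsDensity ℱ τ θ (incr a)) {Xn : ℕ → Proc P}
    (hX : ∀ n, Xn n ∈ acceptanceSet hτ hθ φ) (n : ℕ) :
    ∃ W ∈ acceptanceSet hτ hθ φ, ∀ᵐ ω ∂P, ∀ k ≤ n,
      condPairing hτ θ W a ω ≤ condPairing hτ θ (Xn k) a ω := by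
  induction n with
  | zero =>
    refine ⟨Xn 0, hX 0, Eventually.of_forall fun ω k hk => ?_⟩
    rw [Nat.le_zero.1 hk]
  | succ n ih =>
    obtain ⟨V, hV, hVX⟩ := ih
    obtain ⟨W, hW, hWV⟩ := hu.exists_condPairing_le_min hτθ ha hV (hX (n + 1))
    refine ⟨W, hW, ?_⟩
    filter_upwards [hVX, hWV] with ω h1 h2 k hk
    obtain hk | rfl := Nat.le_succ_iff.1 hk
    · exact h2.1.trans (h1 k hk)
    · exact h2.2

/-- A process whose conditional pairings dominate `φ^#` belongs to the acceptance set. -/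
lemma IsConcaveMonetaryUtility.mem_of_phiSharp_le (hτfin : ∀ᵐ ω ∂P, τ ω < ⊤)
    (hτθ : ∀ᵐ ω ∂P, τ ω ≤ θ ω) (hu : IsConcaveMonetaryUtility hτ hθ φ)
    (hcont : ContinuousDecreasing hτ hθ φ) (hZ : Z ∈ RInfStop P hτ hθ)
    (h : ∀ a ∈ DStop P hτ hθ, ∀ᵐ ω ∂P,
      phiSharp hτ hθ φ a ω ≤ ((condPairing hτ θ Z a ω : ℝ) : EReal)) :
    Z ∈ acceptanceSet hτ hθ φ := by
  by_contra hZC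
  obtain ⟨d, hd, hsep⟩ := exists_separating_density hτθ hu hcont hZ hZC
  obtain ⟨a, ha, u, hui, hu0, hud⟩ := hd.exists_normalized (hτ := hτ) (hθ := hθ) hτfin hτθ
  have ha' := ((mem_DStop_iff hτθ).1 ha).1
  have hC : (acceptanceSet hτ hθ φ).Nonempty := ⟨0, zero_mem_acceptanceSet hτθ hu⟩
  obtain ⟨w, hwS, hw⟩ := exists_seq_essInfimum_eq
    (hC.image fun X => toE (condPairing hτ θ X a))
  choose X hXC hXw using hwS
  choose W hWC hWX using hu.exists_condPairing_le hτθ ha' hXC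
  have hWX' : ∀ᵐ ω ∂P, ∀ n, ∀ k ≤ n,
      condPairing hτ θ (W n) a ω ≤ condPairing hτ θ (X k) a ω := ae_all_iff.2 hWX
  have hbdd := fun {X : Proc P} (hX : X ∈ RInfStop P hτ hθ) =>
    (condPairing_mem_LInf ha ha' (isBdd_of_mem hX)).2
  obtain ⟨cZ, hcZ⟩ := hbdd hZ
  obtain ⟨cX, hcX⟩ := hbdd (hXC 0).1
  -- `φ^#(a)` may be `-∞`, so the forms of `W n` may lack a common lower bound. The maximum with the
  -- form of `Z` restores one, and `φ^#(a) ≤ ⟨Z, a⟩` makes `⟨Z, a⟩` the limit.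
  have hlim : ∀ᵐ ω ∂P, Tendsto (fun n => max (condPairing hτ θ (W n) a ω)
      (condPairing hτ θ Z a ω)) atTop (𝓝 (condPairing hτ θ Z a ω)) := by
    filter_upwards [h a ha, hw, hWX', ae_all_iff.2 fun n => toE_ae (condPairing hτ θ (X n) a)]
      with ω h1 h2 h3 h4
    have h5 : ⨅ n, ((condPairing hτ θ (X n) a ω : ℝ) : EReal)
        ≤ ((condPairing hτ θ Z a ω : ℝ) : EReal) := by
      simp only [← h4, fun n => hXw n]
      rw [← h2]
      exact h1
    refine tendsto_order.2 ⟨fun r hr => Eventually.of_forall fun n => hr.trans_le (le_max_right _ _),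
      fun r hr => ?_⟩
    obtain ⟨k, hk⟩ := iInf_lt_iff.1 (h5.trans_lt (EReal.coe_lt_coe_iff.2 hr))
    filter_upwards [eventually_ge_atTop k] with n hn
    exact max_lt ((h3 n k hn).trans_lt (EReal.coe_lt_coe_iff.1 hk)) hr
  have hmax : ∀ n, AEStronglyMeasurable (fun ω => max (condPairing hτ θ (W n) a ω)
      (condPairing hτ θ Z a ω)) P := fun n =>
    (condPairing hτ θ (W n) a).aestronglyMeasurable.sup (condPairing hτ θ Z a).aestronglyMeasurable
  have hmaxb : ∀ᵐ ω ∂P, ∀ n, |max (condPairing hτ θ (W n) a ω) (condPairing hτ θ Z a ω)|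
      ≤ max cX cZ := by
    filter_upwards [hWX', hcX, hcZ] with ω h1 h2 h3 n
    refine abs_le.2 ⟨?_, max_le ?_ ?_⟩
    · linarith [(abs_le.1 h3).1, le_max_right cX cZ,
        le_max_right (condPairing hτ θ (W n) a ω) (condPairing hτ θ Z a ω)]
    · exact (h1 n 0 n.zero_le).trans ((abs_le.1 h2).2.trans (le_max_left _ _))
    · exact (abs_le.1 h3).2.trans (le_max_right _ _)
  have hint : ∀ n, Integrable (fun ω => u ω * max (condPairing hτ θ (W n) a ω)
      (condPairing hτ θ Z a ω)) P := fun n =>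
    hui.mul_bdd (hmax n) (hmaxb.mono fun ω h => h n)
  have htend : Tendsto (fun n => ∫ ω, u ω * max (condPairing hτ θ (W n) a ω)
      (condPairing hτ θ Z a ω) ∂P) atTop (𝓝 (∫ ω, u ω * condPairing hτ θ Z a ω ∂P)) := by
    refine tendsto_integral_of_dominated_convergence (fun ω => |u ω| * max cX cZ)
      (fun n => (hint n).aestronglyMeasurable) (hui.abs.mul_const _) (fun n => ?_) ?_
    · filter_upwards [hmaxb] with ω h
      rw [Real.norm_eq_abs, abs_mul]
      exact mul_le_mul_of_nonneg_left (h n) (abs_nonneg _)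
    · filter_upwards [hlim] with ω h
      exact h.const_mul _
  -- The separation survives the passage to the maximum because `u ≥ 0`. In the limit it reads `1 +
  -- x ≤ x`.
  have hle : ∀ n, 1 + ∫ ω, u ω * condPairing hτ θ Z a ω ∂P
      ≤ ∫ ω, u ω * max (condPairing hτ θ (W n) a ω) (condPairing hτ θ Z a ω) ∂P := by
    intro n
    obtain ⟨c, hc⟩ := hbdd (hWC n).1
    have h1 := hsep _ (hWC n)
    rw [← hud _ (isBdd_of_mem hZ), ← hud _ (isBdd_of_mem (hWC n).1)] at h1
    refine h1.trans (integral_mono_ae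
      (hui.mul_bdd (condPairing hτ θ (W n) a).aestronglyMeasurable hc) (hint n) ?_)
    filter_upwards [hu0] with ω h
    exact mul_le_mul_of_nonneg_left (le_max_left _ _) h
  linarith [ge_of_tendsto' htend hle]

/-- `X - φ(X)` is acceptable, and its form is `⟨X, a⟩ - φ(X)`. -/
lemma IsConcaveMonetaryUtility.phiSharp_le_sub (hτθ : ∀ᵐ ω ∂P, τ ω ≤ θ ω)
    (hu : IsConcaveMonetaryUtility hτ hθ φ) (hX : X ∈ RInfStop P hτ hθ) {f : Ω →ₘ[P] ℝ}
    (hf : f ∈ LInf P hτ) (hfX : ∀ᵐ ω ∂P, φ X ω = ((f ω : ℝ) : EReal)) (ha : a ∈ DStop P hτ hθ) :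
    ∀ᵐ ω ∂P, phiSharp hτ hθ φ a ω ≤ ((condPairing hτ θ X a ω - f ω : ℝ) : EReal) := by
  have hn := neg_mem_LInf hf
  have ha' := ((mem_DStop_iff hτθ).1 ha).1
  have hmem : X + cash hτ (-f) ∈ acceptanceSet hτ hθ φ := by
    refine mem_acceptanceSet_iff.2
      ⟨add_mem_RInfStop hτθ hX (cash_mem_RInfStop hτθ hn), ?_⟩
    filter_upwards [hu.sub_cash hX hfX hf] with ω h
    rw [h, sub_self, EReal.coe_zero]
  filter_upwards [phiSharp_le hmem a, condPairing_add (hτ := hτ) ha' (isBdd_of_mem hX)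
    (isBdd_cash hn), condPairing_cash ha ha' hn, AEEqFun.coeFn_neg f] with ω h1 h2 h3 h4
  rwa [h2, h3, h4, Pi.neg_apply, ← sub_eq_add_neg] at h1

/-- The dual representation of a concave monetary utility functional that is continuous for
bounded decreasing sequences. -/
theorem IsConcaveMonetaryUtility.represents_phiSharp (hτfin : ∀ᵐ ω ∂P, τ ω < ⊤)
    (hτθ : ∀ᵐ ω ∂P, τ ω ≤ θ ω) (hu : IsConcaveMonetaryUtility hτ hθ φ)
    (hcont : ContinuousDecreasing hτ hθ φ) : Represents hτ hθ (phiSharp hτ hθ φ) φ := by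
  intro X hX
  obtain ⟨f, hf, hfX⟩ := hu.exists_value hX
  obtain ⟨c, hc⟩ := hf.2
  let I : Ω →ₘ[P] EReal := essInfimum (penalized hτ θ (phiSharp hτ hθ φ) X '' DStop P hτ hθ)
  have hI : AEStronglyMeasurable[hτ.measurableSpace] I P := by
    refine aestronglyMeasurable_essInfimum ((nonempty_DStop hτfin hτθ).image _) ?_
    rintro _ ⟨a, -, rfl⟩
    exact aestronglyMeasurable_penalized
      (aestronglyMeasurable_phiSharp ⟨0, zero_mem_acceptanceSet hτθ hu⟩ a)
  have hfI : ∀ᵐ ω ∂P, ((f ω : ℝ) : EReal) ≤ I ω := by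
    refine le_essInfimum
      (continuous_coe_real_ereal.comp_aestronglyMeasurable f.aestronglyMeasurable) ?_
    rintro _ ⟨a, ha, rfl⟩
    filter_upwards [hu.phiSharp_le_sub hτθ hX hf hfX ha, penalized_ae (phiSharp hτ hθ φ) X a]
      with ω h1 h2
    rw [h2]
    exact (coe_le_coe_sub_iff _ _ _).2 h1
  obtain ⟨J, hJ, hIJ⟩ := hI
  -- The infimum `I` is not yet known to be finite. Truncated at `c + 1`, above the bound `c` of
  -- `φ(X)`, it becomes an admissible amount of cash.
  have hmm : Measurable[hτ.measurableSpace] fun ω => (min (J ω) ((c + 1 : ℝ) : EReal)).toReal :=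
    Measurable.ereal_toReal (hJ.measurable.min measurable_const)
  let m : Ω →ₘ[P] ℝ := AEEqFun.mk _ (hmm.mono hτ.measurableSpace_le le_rfl).aestronglyMeasurable
  have hmae : ∀ᵐ ω ∂P, m ω = (min (J ω) ((c + 1 : ℝ) : EReal)).toReal := AEEqFun.coeFn_mk _ _
  have hmI : ∀ᵐ ω ∂P, ((m ω : ℝ) : EReal) = min (I ω) ((c + 1 : ℝ) : EReal) := by
    filter_upwards [hmae, hIJ, hfI] with ω h1 h2 h3
    rw [h1, ← h2]
    refine EReal.coe_toReal ?_ ?_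
    · exact ne_top_of_le_ne_top (EReal.coe_ne_top _) (min_le_right _ _)
    · exact ne_of_gt (lt_min ((EReal.bot_lt_coe _).trans_le h3) (EReal.bot_lt_coe _))
  have hm : m ∈ LInf P hτ := by
    refine ⟨⟨_, hmm.stronglyMeasurable, hmae⟩, c + 1, ?_⟩
    filter_upwards [hmI, hfI, hc] with ω h1 h2 h3
    refine abs_le.2 ⟨EReal.coe_le_coe_iff.1 ?_, EReal.coe_le_coe_iff.1 ?_⟩
    · rw [h1]
      refine le_min (le_trans (EReal.coe_le_coe_iff.2 ?_) h2) (EReal.coe_le_coe_iff.2 ?_)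
      · linarith [(abs_le.1 h3).1]
      · linarith [abs_nonneg (f ω)]
    · rw [h1]
      exact min_le_right _ _
  have hn := neg_mem_LInf hm
  -- `m ≤ ⟨X, a⟩ - φ^#(a)` for all `a` says that the forms of `X - m` dominate `φ^#`. Hence `X - m`
  -- is acceptable and `m ≤ φ(X)`.
  have hmem : X + cash hτ (-m) ∈ acceptanceSet hτ hθ φ := by
    refine hu.mem_of_phiSharp_le hτfin hτθ hcont
      (add_mem_RInfStop hτθ hX (cash_mem_RInfStop hτθ hn)) fun a ha => ?_
    have ha' := ((mem_DStop_iff hτθ).1 ha).1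
    filter_upwards [hmI, condPairing_add (hτ := hτ) ha' (isBdd_of_mem hX) (isBdd_cash hn),
      condPairing_cash ha ha' hn, AEEqFun.coeFn_neg m, penalized_ae (phiSharp hτ hθ φ) X a,
      essInfimum_le (Set.mem_image_of_mem (penalized hτ θ (phiSharp hτ hθ φ) X) ha)]
      with ω h1 h2 h3 h4 h5 h6
    rw [h2, h3, h4, Pi.neg_apply, ← sub_eq_add_neg]
    refine (coe_le_coe_sub_iff _ _ _).1 ?_
    rw [← h5, h1]
    exact (min_le_left _ _).trans h6
  refine AEEqFun.ext ?_
  filter_upwards [hfX, hfI, hmI, hc, (mem_acceptanceSet_iff.1 hmem).2, hu.sub_cash hX hfX hm]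
    with ω h1 h2 h3 h4 h5 h6
  rw [h6, EReal.coe_nonneg, sub_nonneg, ← EReal.coe_le_coe_iff, h3] at h5
  rw [h1]
  refine le_antisymm h2 ((min_le_iff.1 h5).resolve_right fun h7 => ?_)
  have := EReal.coe_le_coe_iff.1 h7
  linarith [(abs_le.1 h4).2]

lemma IsConcaveMonetaryUtility.phiSharp_nonpos (hτθ : ∀ᵐ ω ∂P, τ ω ≤ θ ω)
    (hu : IsConcaveMonetaryUtility hτ hθ φ) (ha : a ∈ DStop P hτ hθ) :
    phiSharp hτ hθ φ a ≤ 0 := by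
  have hz := condPairing_cash ha ((mem_DStop_iff hτθ).1 ha).1 (zero_mem_LInf (hτ := hτ))
  rw [cash_zero] at hz
  rw [← AEEqFun.coeFn_le]
  filter_upwards [phiSharp_le (zero_mem_acceptanceSet hτθ hu) a, hz,
    AEEqFun.coeFn_zero (β := ℝ) (μ := P), AEEqFun.coeFn_zero (β := EReal) (μ := P)]
    with ω h1 h2 h3 h4
  rw [h2, h3] at h1
  rw [h4]
  exact h1

/-- At `X = 0` the representation reads `0 = φ(0) = ess inf (-φ^#(a))`, which is the normalization
of the penalty. -/
lemma isPenalty_phiSharp (hτθ : ∀ᵐ ω ∂P, τ ω ≤ θ ω) (hu : IsConcaveMonetaryUtility hτ hθ φ)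
    (hφ : Represents hτ hθ (phiSharp hτ hθ φ) φ) : IsPenalty hτ hθ (phiSharp hτ hθ φ) := by
  refine ⟨fun a _ => aestronglyMeasurable_phiSharp ⟨0, zero_mem_acceptanceSet hτθ hu⟩ a,
    fun a ha => hu.phiSharp_nonpos hτθ ha, ?_, fun g hg => ?_⟩
  · rintro _ ⟨a, ha, rfl⟩
    exact hu.phiSharp_nonpos hτθ ha
  have h0 := hφ 0 (zero_mem_RInfStop hτθ)
  have hgm : AEStronglyMeasurable (fun ω => -g ω) P :=
    continuous_neg.comp_aestronglyMeasurable g.aestronglyMeasurable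
  have h1 := le_essInfimum (S := penalized hτ θ (phiSharp hτ hθ φ) 0 '' DStop P hτ hθ) hgm (by
    rintro _ ⟨a, ha, rfl⟩
    have hz := condPairing_cash ha ((mem_DStop_iff hτθ).1 ha).1 (zero_mem_LInf (hτ := hτ))
    rw [cash_zero] at hz
    filter_upwards [penalized_ae (phiSharp hτ hθ φ) 0 a, hz,
      AEEqFun.coeFn_zero (β := ℝ) (μ := P),
      AEEqFun.coeFn_le.2 (hg (Set.mem_image_of_mem _ ha))] with ω h1 h2 h3 h4
    have h5 : penalized hτ θ (phiSharp hτ hθ φ) 0 a ω = -phiSharp hτ hθ φ a ω := by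
      rw [h1, h2, h3, Pi.zero_apply, EReal.coe_zero, zero_sub]
    rw [h5]
    exact EReal.neg_le_neg_iff.2 h4)
  rw [← h0] at h1
  rw [← AEEqFun.coeFn_le]
  filter_upwards [h1, hu.map_zero hτθ, AEEqFun.coeFn_zero (β := EReal) (μ := P)] with ω h1 h2 h3
  rw [h2] at h1
  rw [h3]
  exact EReal.neg_le_zero.1 h1

/-- The form of the pasted process is that of `a` on `A` and that of `b` off `A`, so lower bounds
for the forms can be glued along `A`. -/
lemma phiSharp_paste (ha : IsDensity ℱ τ θ (incr a)) (hb : IsDensity ℱ τ θ (incr b)) {A : Set Ω}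
    (hA : MeasurableSet[hτ.measurableSpace] A) (hA' : MeasurableSet A) :
    (phiSharp hτ hθ φ fun t => ind P hA' * a t + ind P hA'.compl * b t)
      =ᵐ[P] A.indicator (phiSharp hτ hθ φ a) + Aᶜ.indicator (phiSharp hτ hθ φ b) := by
  classical
  have hAc : MeasurableSet[hτ.measurableSpace] Aᶜ := hA.compl
  have hmix : ∀ X ∈ acceptanceSet hτ hθ φ, ∀ᵐ ω ∂P,
      (ω ∈ A → condPairing hτ θ X (fun t => ind P hA' * a t + ind P hA'.compl * b t) ω
        = condPairing hτ θ X a ω) ∧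
      (ω ∉ A → condPairing hτ θ X (fun t => ind P hA' * a t + ind P hA'.compl * b t) ω
        = condPairing hτ θ X b ω) := by
    intro X hX
    filter_upwards [condPairing_mix_right ha hb (isBdd_of_mem hX.1) (ind_mem_LInf hA hA')
      (ind_mem_LInf hAc hA'.compl), ind_ae (P := P) hA', ind_ae (P := P) hA'.compl]
      with ω h1 h2 h3
    rw [h1, h2, h3]
    constructor <;> intro hω <;> simp [hω]
  have hm : ∀ c, Measurable (phiSharp hτ hθ φ c : Ω → EReal) := fun c =>
    (phiSharp hτ hθ φ c).stronglyMeasurable.measurable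
  let c : Proc P := fun t => ind P hA' * a t + ind P hA'.compl * b t
  have h1 := le_phiSharp (hτ := hτ) (hθ := hθ) (φ := φ) (a := c)
    (g := A.piecewise (phiSharp hτ hθ φ a) (phiSharp hτ hθ φ b))
    ((hm a).piecewise hA' (hm b)).aestronglyMeasurable fun X hX => by
      filter_upwards [hmix X hX, phiSharp_le hX a, phiSharp_le hX b] with ω h1 h2 h3
      by_cases hω : ω ∈ A
      · rwa [Set.piecewise_eq_of_mem _ _ _ hω, h1.1 hω]
      · rwa [Set.piecewise_eq_of_notMem _ _ _ hω, h1.2 hω]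
  -- The value `⊥` off `A` is a lower bound for free, so this compares the two dual values on `A`
  -- only.
  have h2 := le_phiSharp (hτ := hτ) (hθ := hθ) (φ := φ) (a := a)
    (g := A.piecewise (phiSharp hτ hθ φ c) fun _ => ⊥)
    ((hm c).piecewise hA' measurable_const).aestronglyMeasurable fun X hX => by
      filter_upwards [hmix X hX, phiSharp_le hX c] with ω h1 h2
      by_cases hω : ω ∈ A
      · rwa [Set.piecewise_eq_of_mem _ _ _ hω, ← h1.1 hω]
      · rw [Set.piecewise_eq_of_notMem _ _ _ hω]
        exact bot_le
  have h3 := le_phiSharp (hτ := hτ) (hθ := hθ) (φ := φ) (a := b)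
    (g := A.piecewise (fun _ => ⊥) (phiSharp hτ hθ φ c))
    (measurable_const.piecewise hA' (hm c)).aestronglyMeasurable fun X hX => by
      filter_upwards [hmix X hX, phiSharp_le hX c] with ω h1 h2
      by_cases hω : ω ∈ A
      · rw [Set.piecewise_eq_of_mem _ _ _ hω]
        exact bot_le
      · rwa [Set.piecewise_eq_of_notMem _ _ _ hω, ← h1.2 hω]
  filter_upwards [h1, h2, h3] with ω h1 h2 h3
  rw [Pi.add_apply]
  by_cases hω : ω ∈ A
  · rw [Set.piecewise_eq_of_mem _ _ _ hω] at h1 h2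
    rw [Set.indicator_of_mem hω, Set.indicator_of_notMem (s := Aᶜ) (fun h => h hω), add_zero]
    exact le_antisymm h2 h1
  · rw [Set.piecewise_eq_of_notMem _ _ _ hω] at h1 h3
    rw [Set.indicator_of_notMem hω, Set.indicator_of_mem (s := Aᶜ) hω, zero_add]
    exact le_antisymm h3 h1

/-- `φ^#` is the largest function that represents `φ`. -/
lemma Represents.le_phiSharp (hφ : Represents hτ hθ γ φ) (ha : a ∈ DStop P hτ hθ) :
    γ a ≤ phiSharp hτ hθ φ a := by
  rw [← AEEqFun.coeFn_le]
  refine CondUtility.le_phiSharp (γ a).aestronglyMeasurable fun X hX => ?_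
  obtain ⟨hX, h0⟩ := mem_acceptanceSet_iff.1 hX
  have h := (hφ.le_iff hX (f := fun _ => 0) aestronglyMeasurable_const).1
    (by simpa only [EReal.coe_zero] using h0) a ha
  simpa only [sub_zero] using h

end Dual

end CondUtility

end

theorem theorem3 {Ω : Type*} {mΩ : MeasurableSpace Ω} (P : MeasureTheory.Measure Ω)
    [MeasureTheory.IsProbabilityMeasure P] (ℱ : MeasureTheory.Filtration ℕ mΩ)
    (hℱ0 : ∀ A : Set Ω, MeasurableSet[ℱ 0] A → P A = 0 ∨ P A = 1)
    (τ θ : Ω → WithTop ℕ) (hτ : MeasureTheory.IsStoppingTime ℱ τ)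
    (hθ : MeasureTheory.IsStoppingTime ℱ θ)
    (hτfin : ∀ᵐ ω ∂P, τ ω < ⊤) (hτθ : ∀ᵐ ω ∂P, τ ω ≤ θ ω)
    (φ : CondUtility.Proc P → Ω →ₘ[P] EReal) :
    List.TFAE [
      ∃ γ : CondUtility.Proc P → Ω →ₘ[P] EReal,
        CondUtility.IsPenalty hτ hθ γ ∧ CondUtility.Represents hτ hθ γ φ,
      CondUtility.IsConcaveMonetaryUtility hτ hθ φ ∧ CondUtility.AcceptanceSetClosed hτ hθ φ,
      CondUtility.IsConcaveMonetaryUtility hτ hθ φ ∧ CondUtility.ContinuousDecreasing hτ hθ φ] ∧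
    (CondUtility.IsConcaveMonetaryUtility hτ hθ φ ∧ CondUtility.AcceptanceSetClosed hτ hθ φ →
      CondUtility.IsSpecialPenalty hτ hθ (CondUtility.phiSharp hτ hθ φ) ∧
      CondUtility.Represents hτ hθ (CondUtility.phiSharp hτ hθ φ) φ ∧
      ∀ γ : CondUtility.Proc P → Ω →ₘ[P] EReal,
        CondUtility.IsPenalty hτ hθ γ → CondUtility.Represents hτ hθ γ φ →
        ∀ a ∈ CondUtility.DStop P hτ hθ, γ a ≤ CondUtility.phiSharp hτ hθ φ a) := by
  have h12 : (∃ γ : CondUtility.Proc P → Ω →ₘ[P] EReal,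
      CondUtility.IsPenalty hτ hθ γ ∧ CondUtility.Represents hτ hθ γ φ) →
      CondUtility.IsConcaveMonetaryUtility hτ hθ φ ∧ CondUtility.AcceptanceSetClosed hτ hθ φ := by
    rintro ⟨γ, hγ, hφ⟩
    exact ⟨hφ.isConcaveMonetaryUtility hτfin hτθ hγ, hφ.acceptanceSetClosed hτθ hγ⟩
  -- The penalty produced from the third condition is `φ^#` itself, so this closes the cycle and
  -- also serves the supplement.
  have hrep : CondUtility.IsConcaveMonetaryUtility hτ hθ φ ∧
      CondUtility.ContinuousDecreasing hτ hθ φ →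
      CondUtility.IsPenalty hτ hθ (CondUtility.phiSharp hτ hθ φ) ∧
      CondUtility.Represents hτ hθ (CondUtility.phiSharp hτ hθ φ) φ := by
    rintro ⟨hu, hcont⟩
    have hφ := hu.represents_phiSharp hτfin hτθ hcont
    exact ⟨CondUtility.isPenalty_phiSharp hτθ hu hφ, hφ⟩
  refine ⟨?_, fun ⟨hu, hcl⟩ => ?_⟩
  · tfae_have 1 → 2 := h12
    tfae_have 2 → 3 := fun ⟨hu, hcl⟩ => ⟨hu, hcl.continuousDecreasing hτθ hu⟩
    tfae_have 3 → 1 := fun h => ⟨_, hrep h⟩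
    tfae_finish
  · obtain ⟨hpen, hφ⟩ := hrep ⟨hu, hcl.continuousDecreasing hτθ hu⟩
    exact ⟨⟨hpen, fun a ha b hb A hA => CondUtility.phiSharp_paste
        ((CondUtility.mem_DStop_iff hτθ).1 ha).1 ((CondUtility.mem_DStop_iff hτθ).1 hb).1 hA _⟩,
      hφ, fun γ _ hγ a ha => hγ.le_phiSharp ha⟩
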